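/- In Fair Correlation Clustering one is given a finite graph $G=(V,E)$ and a coloring $V\to\{1,\dots,k\}$ of its vertices (not necessarily a proper one). A set $S\subseteq V$ is fair if each color has the same proportion in $S$ as in $V$, and a partition of $V$ is fair if all its sets are fair. The task is to find a fair partition of $V$ that has, among all fair partitions, the minimum cost, where the cost is the number of pairs of distinct non-adjacent vertices that lie in the same set plus the number of edges whose endpoints lie in different sets. Theorem. Let $F$ be a forest with $n\ge 1$ vertices, each colored in one of $k\ge 2$ colors. Let the colors be distributed in a ratio of $c_1:c_2:\dots:c_k$ with positive integers $c_i$ such that $\gcd(c_1,\dots,c_k)=1$. Then Fair Correlation Clustering on $F$ can be solved in time $$O\!\left(n^{2\,\mathrm{setvars}+\mathrm{setmax}+2}\cdot \mathrm{setvars}^{\mathrm{setmax}}\right),\qquad \mathrm{setvars}=\prod_{i=1}^k (c_i+1),\quad \mathrm{setmax}=\sum_{i=1}^k c_i .$$ In particular, the running time is polynomial in $n$ whenever the size $d=\sum_{i=1}^k c_i$ of the smallest non-empty fair sets is bounded by a constant. Here there is one algorithm for all inputs, and the constant in the $O$-notation is absolute ($k$ and the $c_i$ may depend on $n$). The algorithm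 is a word RAM program that receives $n$, $k$, the array of colors and the adjacency matrix of $F$, and outputs an array of labels such that two vertices are in the same set of the partition if and only if they have the same label. Constants, register and memory accesses, arithmetic operations, comparisons, assignments and tests cost one step each, and all numbers occurring in the run also satisfy the two bounds stated for the running time (up to an absolute constant factor for the first, and a polynomial in $n$ that depends only on $d$ for the second). -/

import Mathlib

namespace FairCC

/-! ### Fair correlation clustering -/

section Problem

variable {V : Type*} [Fintype V] [DecidableEq V] {k : ℕ}

/-- The set of elements of color `i`. -/
def colorClass (col : V → Fin k) (i : Fin k) : Finset V :=
  Finset.univ.filter fun v => col v = i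

/-- The colors are distributed in a ratio of `c 0 : c 1 : … : c (k - 1)`. -/
def HasColorRatio (col : V → Fin k) (c : Fin k → ℕ) : Prop :=
  ∀ i j, (colorClass col i).card * c j = (colorClass col j).card * c i

/-- A set is fair if every color has the same proportion in it as in the universe. -/
def IsFairSet (col : V → Fin k) (S : Finset V) : Prop :=
  ∀ i, ((S ∩ colorClass col i).card : ℚ) / (S.card : ℚ)
    = ((colorClass col i).card : ℚ) / (Fintype.card V : ℚ)

/-- A partition of the universe is fair if all its sets are fair. -/
def IsFairPartition (col : V → Fin k) (P : Finpartition (Finset.univ : Finset V)) : Prop :=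
  ∀ S ∈ P.parts, IsFairSet col S

/-- The endpoints of `e` lie in the same set of the partition. -/
def SameCluster (P : Finpartition (Finset.univ : Finset V)) (e : Sym2 V) : Prop :=
  ∀ u ∈ e, ∀ v ∈ e, P.part u = P.part v

/-- Number of non-adjacent pairs of distinct vertices inside the clusters. -/
noncomputable def intraCost (G : SimpleGraph V) (P : Finpartition (Finset.univ : Finset V)) : ℕ :=
  {e : Sym2 V | e ∈ Gᶜ.edgeSet ∧ SameCluster P e}.ncard

/-- Number of edges between different clusters. -/
noncomputable def interCost (G : SimpleGraph V) (P : Finpartition (Finset.univ : Finset V)) : ℕ :=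
  {e : Sym2 V | e ∈ G.edgeSet ∧ ¬ SameCluster P e}.ncard

/-- The correlation clustering cost (number of disagreements). -/
noncomputable def ccCost (G : SimpleGraph V) (P : Finpartition (Finset.univ : Finset V)) : ℕ :=
  intraCost G P + interCost G P

/-- `P` is a fair partition of minimum cost among all fair partitions, i.e. a solution
of Fair Correlation Clustering on the graph `G` with the coloring `col`. -/
def IsMinCostFair (G : SimpleGraph V) (col : V → Fin k)
    (P : Finpartition (Finset.univ : Finset V)) : Prop :=
  IsFairPartition col P ∧
    ∀ Q : Finpartition (Finset.univ : Finset V), IsFairPartition col Q → ccCost G P ≤ ccCost G Q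

end Problem

/-! ### A word RAM

Programs act on numbered registers and on a memory addressed by numbers. Every constant,
register access, memory access, arithmetic operation, assignment, store and test costs one
step. Words are bounded: a run with word bound `W` is only defined as long as every number
that is computed, used as an address or stored is at most `W`. -/

/-- Contents of the registers and of the memory. -/
structure State where
  reg : ℕ → ℕ
  mem : ℕ → ℕ

/-- The operations on words: truncated subtraction, integer division and remainder, and the
comparisons with value 1 for true and 0 for false. -/
inductive Op
  | add | sub | mul | div | mod | eq | lt

def Op.apply : Op → ℕ → ℕ → ℕ
  | .add, x, y => x + y
  | .sub, x, y => x - y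
  | .mul, x, y => x * y
  | .div, x, y => x / y
  | .mod, x, y => x % y
  | .eq, x, y => if x = y then 1 else 0
  | .lt, x, y => if x < y then 1 else 0

/-- Expressions: constants, registers, memory cells (indirect addressing), operations. -/
inductive Term
  | const (c : ℕ)
  | reg (r : ℕ)
  | load (a : Term)
  | op (o : Op) (x y : Term)

namespace Term

/-- Value of an expression. -/
def eval (s : State) : Term → ℕ
  | const c => c
  | reg r => s.reg r
  | load a => s.mem (a.eval s)
  | op o x y => o.apply (x.eval s) (y.eval s)

/-- Number of steps needed to evaluate an expression. -/
def steps : Term → ℕ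
  | const _ => 1
  | reg _ => 1
  | load a => a.steps + 1
  | op _ x y => x.steps + y.steps + 1

/-- All numbers occurring in the evaluation, including intermediate results, are at most `W`. -/
def Fits (W : ℕ) (s : State) : Term → Prop
  | const c => c ≤ W
  | reg r => s.reg r ≤ W
  | load a => a.Fits W s ∧ s.mem (a.eval s) ≤ W
  | op o x y => x.Fits W s ∧ y.Fits W s ∧ o.apply (x.eval s) (y.eval s) ≤ W

end Term

/-- Programs. -/
inductive Prog
  | skip
  | assign (r : ℕ) (x : Term)
  | store (a x : Term)
  | seq (p q : Prog)
  | cond (b : Term) (p q : Prog)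
  | loop (b : Term) (p : Prog)

/-- `Run W p s s' t`: with word bound `W`, the program `p` started in state `s` halts in
state `s'` after exactly `t` steps. Tests succeed on non-zero values; `loop b p` repeats `p`
as long as the test `b` succeeds. -/
inductive Run (W : ℕ) : Prog → State → State → ℕ → Prop
  | skip (s : State) : Run W .skip s s 1
  | assign (s : State) (r : ℕ) (x : Term) (hx : x.Fits W s) :
      Run W (.assign r x) s ⟨Function.update s.reg r (x.eval s), s.mem⟩ (x.steps + 1)
  | store (s : State) (a x : Term) (ha : a.Fits W s) (hx : x.Fits W s) :
      Run W (.store a x) s ⟨s.reg, Function.update s.mem (a.eval s) (x.eval s)⟩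
        (a.steps + x.steps + 1)
  | seq {p q : Prog} {s₁ s₂ s₃ : State} {t₁ t₂ : ℕ}
      (hp : Run W p s₁ s₂ t₁) (hq : Run W q s₂ s₃ t₂) : Run W (.seq p q) s₁ s₃ (t₁ + t₂)
  | condTrue {b : Term} {p q : Prog} {s₁ s₂ : State} {t : ℕ}
      (hf : b.Fits W s₁) (hb : b.eval s₁ ≠ 0) (hp : Run W p s₁ s₂ t) :
      Run W (.cond b p q) s₁ s₂ (b.steps + 1 + t)
  | condFalse {b : Term} {p q : Prog} {s₁ s₂ : State} {t : ℕ}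
      (hf : b.Fits W s₁) (hb : b.eval s₁ = 0) (hq : Run W q s₁ s₂ t) :
      Run W (.cond b p q) s₁ s₂ (b.steps + 1 + t)
  | loopTrue {b : Term} {p : Prog} {s₁ s₂ s₃ : State} {t₁ t₂ : ℕ}
      (hf : b.Fits W s₁) (hb : b.eval s₁ ≠ 0) (hp : Run W p s₁ s₂ t₁)
      (hl : Run W (.loop b p) s₂ s₃ t₂) : Run W (.loop b p) s₁ s₃ (b.steps + 1 + t₁ + t₂)
  | loopFalse {b : Term} {p : Prog} {s : State} (hf : b.Fits W s) (hb : b.eval s = 0) :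
      Run W (.loop b p) s s (b.steps + 1)

/-! ### Solving the problem on the word RAM -/

open Classical in
/-- The initial state for the graph `G` on the vertices `0, …, n - 1` colored by `col`:
registers 0 and 1 hold `n` and the number of colors, memory cell `v` holds the color of `v`,
cell `n + u * n + v` the adjacency of `u` and `v` (1 or 0), and everything else is 0. -/
noncomputable def inputState {n k : ℕ} (G : SimpleGraph (Fin n)) (col : Fin n → Fin k) : State where
  reg r := if r = 0 then n else if r = 1 then k else 0
  mem a :=
    if h : a < n then (col ⟨a, h⟩ : ℕ)
    else if ∃ u v : Fin n, a = n + u * n + v ∧ G.Adj u v then 1 else 0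

/-- The final state describes the partition `P`: memory cells `0, …, n - 1` hold labels of the
vertices, and two vertices have the same label exactly if they are in the same set of `P`. -/
def OutputIs {n : ℕ} (s : State) (P : Finpartition (Finset.univ : Finset (Fin n))) : Prop :=
  ∀ u v : Fin n, s.mem u = s.mem v ↔ P.part u = P.part v

/-- Given `G` and `col`, the program `p` halts within `T` steps with a solution of
Fair Correlation Clustering, and all numbers occurring in the run are at most `W`. -/
def SolvesWithin {n k : ℕ} (p : Prog) (G : SimpleGraph (Fin n)) (col : Fin n → Fin k)
    (T W : ℕ) : Prop :=
  ∃ (t : ℕ) (s : State), t ≤ T ∧ Run W p (inputState G col) s t ∧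
    ∃ P : Finpartition (Finset.univ : Finset (Fin n)), IsMinCostFair G col P ∧ OutputIs s P

/-- The number of colorings of sets with at most `c i` elements of each color `i`. -/
def setvars {k : ℕ} (c : Fin k → ℕ) : ℕ := ∏ i, (c i + 1)

/-- The size of the smallest fair sets. -/
def setmax {k : ℕ} (c : Fin k → ℕ) : ℕ := ∑ i, c i

/-- The expression `n ^ (2 * setvars + setmax + 2) * setvars ^ setmax`. -/
def timeBound {k : ℕ} (n : ℕ) (c : Fin k → ℕ) : ℕ :=
  n ^ (2 * setvars c + setmax c + 2) * setvars c ^ setmax c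

end FairCC

/-! Write `d = setmax c` and `s = setvars c`. As the `c i` are coprime, the color classes have sizes
`m * c i`, and every fair set has `j * c i` vertices of color `i` for some `j ≥ 1`.

Reduction to minimal fair sets. A fair set `S` with `j ≥ 2` in a forest splits into a minimal fair
set and a fair rest with at most `|S| - 2` edges between them (`exists_fair_split`). The
non-adjacent pairs that are separated pay for the edges that are cut, so splitting never raises the
cost, and some optimum has only sets of size `d` (`FairLabel.exists_uniform`). Among such partitions
the number of pairs inside the sets is constant, so minimizing the cost means maximizing the number
of edges inside the sets (`cost2_of_uniform`).

Weights. Color `i` gets the place value `∏ j < i, (c j + 1)` as its weight, so a minimal fair set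
weighs `s - 1`. Conversely, if all sets of a partition weigh `s - 1`, then all of them are minimal
fair sets, although a single set of this weight need not be fair (`card_color_of_isFinal`). The task
becomes to pack weighted vertices into sets of weight `s - 1` with as many inner edges as possible.

Pieces. A solution can be built in two stages: choose pieces of weight less than `s`, then glue
pieces together regardless of adjacency. Whether pieces can be glued to sets of weight `s - 1`
depends only on the multiset of their weights. It is coded as a number in base `n`, the multiplicity
of weight `t` being the digit at `n ^ (t - 1)`; no multiplicity reaches `n` because there are two
different weights (`card_pieceW_lt`). Gluing increases the code (`lt_glue`), so gluability is
tabulated from the largest code downwards (`GlueTable`).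

Dynamic program. A leaf `v` of the forest on the current representatives is merged into its neighbor
`p`, or into any other representative if it is isolated, until one blob remains. The table of a blob
lists the attainable triples of gain, weight of the piece of the representative, and multiset of the
other pieces, packed into numbers below `L = 2 * n * s * n ^ (s - 1)`. In a merge the pieces of `v`
and `p` are joined (`blobCode_keep_right`) or the piece of `v` is closed (`blobCode_cut_right`).
Following any packing through the merges shows that the last table contains a gluable entry with at
least its gain (`Tables.complete`, `exists_goodEntry`); conversely the pointers stored in the
entries lead back to an actual set of pieces (`Trace.step`). Gluing these in one pass over all pairs
of vertices gives the solution (`Glued.isFinal`).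

Time. There are `n - 1` merges with `L ^ 2` pairs of entries each, and everything else is cheaper.
Since `n * L ^ 2 = 4 * n ^ (2 * s + 1) * s ^ 2` and `d ≥ 2`, the stated bound follows. Programs are
verified with a weakest precondition that counts steps, together with a frame rule. -/

namespace FairCC

open Finset

set_option linter.unusedSectionVars false

set_option linter.unusedSimpArgs false

open Term

/-! ### A program logic for the word RAM -/

infixr:30 " ;; " => Prog.seq

instance : Add Term := ⟨Term.op .add⟩
instance : Sub Term := ⟨Term.op .sub⟩
instance : Mul Term := ⟨Term.op .mul⟩
instance : Div Term := ⟨Term.op .div⟩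
instance : Mod Term := ⟨Term.op .mod⟩

namespace Term

/-- Equality test. -/
def eqT (x y : Term) : Term := .op .eq x y

/-- Comparison. -/
def ltT (x y : Term) : Term := .op .lt x y

/-- Address of cell `i` of array `j`; register 2 holds the length of the input. -/
def adr (j : ℕ) (i : Term) : Term := reg 2 + (const 16 * i + const j)

/-- Contents of cell `i` of array `j`. -/
def rd (j : ℕ) (i : Term) : Term := load (adr j i)

variable (W : ℕ) (s : State) (x y : Term) (c r j : ℕ)

@[simp] theorem eval_const : (const c).eval s = c := rfl
@[simp] theorem eval_reg : (reg r).eval s = s.reg r := rfl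
@[simp] theorem eval_load : (load x).eval s = s.mem (x.eval s) := rfl
@[simp] theorem eval_add : (x + y).eval s = x.eval s + y.eval s := rfl
@[simp] theorem eval_sub : (x - y).eval s = x.eval s - y.eval s := rfl
@[simp] theorem eval_mul : (x * y).eval s = x.eval s * y.eval s := rfl
@[simp] theorem eval_div : (x / y).eval s = x.eval s / y.eval s := rfl
@[simp] theorem eval_mod : (x % y).eval s = x.eval s % y.eval s := rfl
@[simp] theorem eval_eqT : (eqT x y).eval s = if x.eval s = y.eval s then 1 else 0 := rfl
@[simp] theorem eval_ltT : (ltT x y).eval s = if x.eval s < y.eval s then 1 else 0 := rfl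

@[simp] theorem steps_const : (const c).steps = 1 := rfl
@[simp] theorem steps_reg : (reg r).steps = 1 := rfl
@[simp] theorem steps_load : (load x).steps = x.steps + 1 := rfl
@[simp] theorem steps_add : (x + y).steps = x.steps + y.steps + 1 := rfl
@[simp] theorem steps_sub : (x - y).steps = x.steps + y.steps + 1 := rfl
@[simp] theorem steps_mul : (x * y).steps = x.steps + y.steps + 1 := rfl
@[simp] theorem steps_div : (x / y).steps = x.steps + y.steps + 1 := rfl
@[simp] theorem steps_mod : (x % y).steps = x.steps + y.steps + 1 := rfl
@[simp] theorem steps_eqT : (eqT x y).steps = x.steps + y.steps + 1 := rfl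
@[simp] theorem steps_ltT : (ltT x y).steps = x.steps + y.steps + 1 := rfl

variable {W s}

theorem Fits.eval_le : ∀ {x : Term}, x.Fits W s → x.eval s ≤ W
  | const _, h => h
  | reg _, h => h
  | load _, h => h.2
  | op _ _ _, h => h.2.2

theorem Fits.mono {W' : ℕ} (hW : W ≤ W') : ∀ {x : Term}, x.Fits W s → x.Fits W' s
  | const _, h => le_trans h hW
  | reg _, h => le_trans h hW
  | load _, h => ⟨h.1.mono hW, h.2.trans hW⟩
  | op _ _ _, h => ⟨h.1.mono hW, h.2.1.mono hW, h.2.2.trans hW⟩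

variable (W s)

@[simp] theorem fits_const : (const c).Fits W s ↔ c ≤ W := Iff.rfl
@[simp] theorem fits_reg : (reg r).Fits W s ↔ s.reg r ≤ W := Iff.rfl
@[simp] theorem fits_load :
    (load x).Fits W s ↔ x.Fits W s ∧ s.mem (x.eval s) ≤ W := Iff.rfl
@[simp] theorem fits_add :
    (x + y).Fits W s ↔ x.Fits W s ∧ y.Fits W s ∧ x.eval s + y.eval s ≤ W := Iff.rfl
@[simp] theorem fits_mul :
    (x * y).Fits W s ↔ x.Fits W s ∧ y.Fits W s ∧ x.eval s * y.eval s ≤ W := Iff.rfl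
@[simp] theorem fits_sub : (x - y).Fits W s ↔ x.Fits W s ∧ y.Fits W s :=
  ⟨fun h => ⟨h.1, h.2.1⟩, fun h => ⟨h.1, h.2, (Nat.sub_le _ _).trans h.1.eval_le⟩⟩
@[simp] theorem fits_div : (x / y).Fits W s ↔ x.Fits W s ∧ y.Fits W s :=
  ⟨fun h => ⟨h.1, h.2.1⟩, fun h => ⟨h.1, h.2, (Nat.div_le_self _ _).trans h.1.eval_le⟩⟩
@[simp] theorem fits_mod : (x % y).Fits W s ↔ x.Fits W s ∧ y.Fits W s :=
  ⟨fun h => ⟨h.1, h.2.1⟩, fun h => ⟨h.1, h.2, (Nat.mod_le _ _).trans h.1.eval_le⟩⟩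
theorem fits_eqT : (eqT x y).Fits W s ↔ x.Fits W s ∧ y.Fits W s ∧
    (if x.eval s = y.eval s then 1 else 0) ≤ W := Iff.rfl
theorem fits_ltT : (ltT x y).Fits W s ↔ x.Fits W s ∧ y.Fits W s ∧
    (if x.eval s < y.eval s then 1 else 0) ≤ W := Iff.rfl

end Term

/-- Number stored in cell `i` of array `j`, for inputs of length `Z`. -/
def cell (Z j i : ℕ) : ℕ := Z + (16 * i + j)

/-- The arrays are interleaved with stride 16, so that each of them is unbounded and no length has
to be fixed beforehand; the residue modulo 16 tells the arrays apart. -/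
theorem cell_inj {Z j i j' i' : ℕ} (hj : j < 16) (hj' : j' < 16) :
    cell Z j i = cell Z j' i' ↔ j = j' ∧ i = i' := by
  unfold cell; omega

@[simp] theorem Term.eval_adr (s : State) (j : ℕ) (i : Term) :
    (Term.adr j i).eval s = cell (s.reg 2) j (i.eval s) := rfl

@[simp] theorem Term.eval_rd (s : State) (j : ℕ) (i : Term) :
    (Term.rd j i).eval s = s.mem (cell (s.reg 2) j (i.eval s)) := rfl

@[simp] theorem Term.steps_adr (j : ℕ) (i : Term) : (Term.adr j i).steps = i.steps + 6 := by
  simp [adr]; omega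

@[simp] theorem Term.steps_rd (j : ℕ) (i : Term) : (Term.rd j i).steps = i.steps + 7 := by
  simp [rd]

@[simp] theorem Term.fits_adr (W : ℕ) (s : State) (j : ℕ) (i : Term) :
    (Term.adr j i).Fits W s ↔ i.Fits W s ∧ cell (s.reg 2) j (i.eval s) ≤ W ∧ 16 ≤ W := by
  have h : (Term.adr j i).Fits W s ↔ (s.reg 2 ≤ W ∧ ((16 ≤ W ∧ i.Fits W s ∧ 16 * i.eval s ≤ W) ∧
    j ≤ W ∧ 16 * i.eval s + j ≤ W) ∧ cell (s.reg 2) j (i.eval s) ≤ W) := Iff.rfl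
  rw [h]
  unfold cell
  constructor
  · rintro ⟨h1, ⟨⟨h2, h3, h4⟩, h5, h6⟩, h7⟩
    exact ⟨h3, h7, h2⟩
  · rintro ⟨h1, h2, h3⟩
    refine ⟨?_, ⟨⟨?_, h1, ?_⟩, ?_, ?_⟩, h2⟩ <;> omega

@[simp] theorem Term.fits_rd (W : ℕ) (s : State) (j : ℕ) (i : Term) :
    (Term.rd j i).Fits W s ↔ i.Fits W s ∧ cell (s.reg 2) j (i.eval s) ≤ W ∧ 16 ≤ W ∧
      s.mem (cell (s.reg 2) j (i.eval s)) ≤ W := by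
  rw [Term.rd, Term.fits_load, Term.fits_adr, Term.eval_adr]; tauto

theorem Run.mono {W W' : ℕ} (hW : W ≤ W') {p : Prog} {s s' : State} {t : ℕ}
    (h : Run W p s s' t) : Run W' p s s' t := by
  induction h with
  | skip s => exact .skip s
  | assign s r x hx => exact .assign s r x (hx.mono hW)
  | store s a x ha hx => exact .store s a x (ha.mono hW) (hx.mono hW)
  | seq _ _ h1 h2 => exact .seq h1 h2
  | condTrue hf hb _ h => exact .condTrue (hf.mono hW) hb h
  | condFalse hf hb _ h => exact .condFalse (hf.mono hW) hb h
  | loopTrue hf hb _ _ h1 h2 => exact .loopTrue (hf.mono hW) hb h1 h2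
  | loopFalse hf hb => exact .loopFalse (hf.mono hW) hb

/-- Assignment to a register. -/
def State.set (s : State) (r v : ℕ) : State := ⟨Function.update s.reg r v, s.mem⟩

/-- Assignment to a memory cell. -/
def State.write (s : State) (a v : ℕ) : State := ⟨s.reg, Function.update s.mem a v⟩

@[simp] theorem State.set_mem (s : State) (r v : ℕ) : (s.set r v).mem = s.mem := rfl
@[simp] theorem State.write_reg (s : State) (a v : ℕ) : (s.write a v).reg = s.reg := rfl
theorem State.set_reg (s : State) (r v q : ℕ) :
    (s.set r v).reg q = if q = r then v else s.reg q := by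
  simp [State.set, Function.update_apply]
theorem State.write_mem (s : State) (a v b : ℕ) :
    (s.write a v).mem b = if b = a then v else s.mem b := by
  simp [State.write, Function.update_apply]

@[simp] theorem State.set_reg_self (s : State) (r v : ℕ) : (s.set r v).reg r = v := by
  simp [State.set_reg]

/-- All registers and memory cells contain numbers up to `W`. -/
structure Bounded (W : ℕ) (s : State) : Prop where
  reg : ∀ r, s.reg r ≤ W
  mem : ∀ a, s.mem a ≤ W

/-- Only values that passed `Fits` are ever stored. Hence every read of a register or of a cell fits
automatically, and in the proofs below only addresses and results of additions and multiplications
need an estimate. -/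
theorem Run.bounded {W : ℕ} {p : Prog} {s s' : State} {t : ℕ} (h : Run W p s s' t)
    (hB : Bounded W s) : Bounded W s' := by
  induction h with
  | skip s => exact hB
  | assign s r x hx =>
    refine ⟨fun q => ?_, hB.mem⟩
    simp only [Function.update_apply]
    split
    · exact hx.eval_le
    · exact hB.reg q
  | store s a x ha hx =>
    refine ⟨hB.reg, fun q => ?_⟩
    simp only [Function.update_apply]
    split
    · exact hx.eval_le
    · exact hB.mem q
  | seq _ _ h1 h2 => exact h2 (h1 hB)
  | condTrue _ _ _ h => exact h hB
  | condFalse _ _ _ h => exact h hB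
  | loopTrue _ _ _ _ h1 h2 => exact h2 (h1 hB)
  | loopFalse _ _ => exact hB

/-- Weakest precondition with a ghost variable for the time that has elapsed, for states
that contain only numbers up to `W`. -/
def wp (W : ℕ) (p : Prog) (Q : State → ℕ → Prop) (s : State) (τ : ℕ) : Prop :=
  Bounded W s → ∃ s' t, Run W p s s' t ∧ Q s' (τ + t)

/-! ### Rules for the weakest precondition -/

section wp

variable {W : ℕ} {p q : Prog} {Q Q' : State → ℕ → Prop} {s : State} {τ : ℕ}

/-- Makes the boundedness of the current state available, which bounds values that are known only as
contents of memory. -/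
theorem wp_bounded (h : Bounded W s → wp W p Q s τ) : wp W p Q s τ := fun hB => h hB hB

theorem wp_mono (h : wp W p Q s τ) (hQ : ∀ s' τ', Q s' τ' → Q' s' τ') : wp W p Q' s τ := by
  intro hB
  obtain ⟨s', t, h1, h2⟩ := h hB
  exact ⟨s', t, h1, hQ _ _ h2⟩

theorem wp_skip (h : Q s (τ + 1)) : wp W .skip Q s τ := fun _ => ⟨s, 1, .skip s, h⟩

theorem wp_assign {r : ℕ} {x : Term} (hx : Bounded W s → x.Fits W s)
    (h : Q (s.set r (x.eval s)) (τ + (x.steps + 1))) : wp W (.assign r x) Q s τ :=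
  fun hB => ⟨_, _, .assign s r x (hx hB), h⟩

theorem wp_store {a x : Term} (ha : Bounded W s → a.Fits W s ∧ x.Fits W s)
    (h : Q (s.write (a.eval s) (x.eval s)) (τ + (a.steps + x.steps + 1))) :
    wp W (.store a x) Q s τ :=
  fun hB => ⟨_, _, .store s a x (ha hB).1 (ha hB).2, h⟩

theorem wp_seq (h : wp W p (fun s' τ' => wp W q Q s' τ') s τ) : wp W (.seq p q) Q s τ := by
  intro hB
  obtain ⟨s1, t1, h1, h2⟩ := h hB
  obtain ⟨s2, t2, h2, h3⟩ := h2 (h1.bounded hB)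
  exact ⟨s2, t1 + t2, .seq h1 h2, by rwa [← add_assoc]⟩

theorem wp_cond {b : Term} (hb : Bounded W s → b.Fits W s)
    (h1 : b.eval s ≠ 0 → wp W p Q s (τ + (b.steps + 1)))
    (h2 : b.eval s = 0 → wp W q Q s (τ + (b.steps + 1))) : wp W (.cond b p q) Q s τ := by
  intro hB
  by_cases h : b.eval s = 0
  · obtain ⟨s', t, h3, h4⟩ := h2 h hB
    exact ⟨s', _, .condFalse (hb hB) h h3, by rwa [← add_assoc]⟩
  · obtain ⟨s', t, h3, h4⟩ := h1 h hB
    exact ⟨s', _, .condTrue (hb hB) h h3, by rwa [← add_assoc]⟩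

end wp

/-- Assignment to a cell of an array. -/
def put (j : ℕ) (i x : Term) : Prog := .store (.adr j i) x

theorem wp_put {W : ℕ} {Q : State → ℕ → Prop} {s : State} {τ j : ℕ} {i x : Term}
    (h : Bounded W s → i.Fits W s ∧ x.Fits W s ∧ cell (s.reg 2) j (i.eval s) ≤ W ∧ 16 ≤ W)
    (hQ : Q (s.write (cell (s.reg 2) j (i.eval s)) (x.eval s)) (τ + (i.steps + x.steps + 7))) :
    wp W (put j i x) Q s τ := by
  refine wp_store (fun hB => ?_) ?_
  · obtain ⟨h1, h2, h3, h4⟩ := h hB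
    exact ⟨(Term.fits_adr _ _ _ _).2 ⟨h1, h3, h4⟩, h2⟩
  · rw [Term.eval_adr, Term.steps_adr]
    convert hQ using 2
    omega

/-- The program writes only to the registers in `R` and to the arrays in `J`. -/
def Prog.mods (R J : List ℕ) : Prog → Bool
  | .skip => true
  | .assign r _ => R.contains r
  -- This is exactly the shape of `Term.adr`. Every other store is rejected, so an accepted program
  -- never touches the input cells below `Z`.
  | .store (.op .add (.reg 2) (.op .add (.op .mul (.const 16) _) (.const j))) _ =>
      J.contains j && decide (j < 16)
  | .store _ _ => false
  | .seq p q => p.mods R J && q.mods R J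
  | .cond _ p q => p.mods R J && q.mods R J
  | .loop _ p => p.mods R J

/-- `s'` arises from `s` by changing only registers in `R` and arrays in `J`. -/
structure Frame (Z : ℕ) (R J : List ℕ) (s s' : State) : Prop where
  reg : ∀ r, R.contains r = false → s'.reg r = s.reg r
  arr : ∀ j i, J.contains j = false → j < 16 → s'.mem (cell Z j i) = s.mem (cell Z j i)
  inp : ∀ a, a < Z → s'.mem a = s.mem a

theorem Frame.refl (Z : ℕ) (R J : List ℕ) (s : State) : Frame Z R J s s :=
  ⟨fun _ _ => rfl, fun _ _ _ _ => rfl, fun _ _ => rfl⟩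

theorem Frame.trans {Z : ℕ} {R J : List ℕ} {s s' s'' : State} (h : Frame Z R J s s')
    (h' : Frame Z R J s' s'') : Frame Z R J s s'' :=
  ⟨fun r hr => (h'.reg r hr).trans (h.reg r hr),
    fun j i hj hj' => (h'.arr j i hj hj').trans (h.arr j i hj hj'),
    fun a ha => (h'.inp a ha).trans (h.inp a ha)⟩

theorem Frame.set {Z : ℕ} {R J : List ℕ} {s s' : State} (h : Frame Z R J s s') {r v : ℕ}
    (hr : R.contains r = true) : Frame Z R J s (s'.set r v) := by
  refine ⟨fun q hq => ?_, h.arr, h.inp⟩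
  rw [State.set_reg, if_neg (by rintro rfl; rw [hr] at hq; exact absurd hq (by simp)), h.reg q hq]

theorem Frame.mono {Z : ℕ} {R J R' J' : List ℕ} {s s' : State} (h : Frame Z R J s s')
    (hR : R ⊆ R') (hJ : J ⊆ J') : Frame Z R' J' s s' := by
  refine ⟨fun r hr => h.reg r ?_, fun j i hj hj' => h.arr j i ?_ hj', h.inp⟩ <;>
  · simp only [List.contains_eq_mem, decide_eq_false_iff_not] at *
    tauto

/-- Register 2 has to stay unmodified because every array address is formed from it: only then does
a store to array `j` remain in array `j` throughout the run. -/
theorem Run.frame {W Z : ℕ} {R J : List ℕ} {p : Prog} {s s' : State} {t : ℕ}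
    (h : Run W p s s' t) (hZ : s.reg 2 = Z) (h2 : R.contains 2 = false)
    (hm : p.mods R J = true) : Frame Z R J s s' := by
  induction h with
  | skip s => exact .refl _ _ _ _
  | assign s r x hx => exact (Frame.refl Z R J s).set (r := r) (v := x.eval s) hm
  | store s a x ha hx =>
    unfold Prog.mods at hm
    split at hm <;> simp_all only [reduceCtorEq, Prog.store.injEq, Bool.and_eq_true,
      decide_eq_true_eq, Bool.false_eq_true]
    rename_i i j x' heq
    obtain ⟨rfl, rfl⟩ := heq
    have ha : Term.eval s (.op .add (.reg 2) (.op .add (.op .mul (.const 16) i) (.const j)))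
        = cell Z j (i.eval s) := by rw [← hZ]; rfl
    refine ⟨fun _ _ => rfl, fun j' i' hj hj' => ?_, fun a ha' => ?_⟩
    · simp only [Function.update_apply, ha, cell_inj hj' hm.2]
      rw [if_neg]
      rintro ⟨rfl, -⟩
      rw [hm.1] at hj
      exact absurd hj (by simp)
    · simp only [Function.update_apply, ha]
      rw [if_neg]
      unfold cell
      omega
  | seq _ _ h1 h2' =>
    simp only [Prog.mods, Bool.and_eq_true] at hm
    have h3 := h1 hZ hm.1
    exact h3.trans (h2' ((h3.reg 2 h2).trans hZ) hm.2)
  | condTrue hf hb _ h =>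
    simp only [Prog.mods, Bool.and_eq_true] at hm
    exact h hZ hm.1
  | condFalse hf hb _ h =>
    simp only [Prog.mods, Bool.and_eq_true] at hm
    exact h hZ hm.2
  | loopTrue hf hb _ _ h1 h2' =>
    have h3 := h1 hZ hm
    exact h3.trans (h2' ((h3.reg 2 h2).trans hZ) hm)
  | loopFalse hf hb => exact .refl _ _ _ _

theorem wp_frame {W Z : ℕ} {R J : List ℕ} {p : Prog} {Q : State → ℕ → Prop} {s : State} {τ : ℕ}
    (hZ : s.reg 2 = Z) (h2 : R.contains 2 = false) (hm : p.mods R J = true)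
    (h : wp W p Q s τ) : wp W p (fun s' τ' => Frame Z R J s s' ∧ Q s' τ') s τ := by
  intro hB
  obtain ⟨s', t, h1, h3⟩ := h hB
  exact ⟨s', t, h1, h1.frame hZ h2 hm, h3⟩

/-- Repeat `p` with register `i` running through the numbers less than register `b`. -/
def forLoop (i b : ℕ) (p : Prog) : Prog :=
  .seq (.assign i (.const 0))
    (.loop (.ltT (.reg i) (.reg b)) (.seq p (.assign i (.reg i + .const 1))))

/-- The rule for `forLoop`: `I` is the invariant and `K` bounds the time of one iteration. -/
theorem wp_forLoop_of_inv {W : ℕ} {i b : ℕ} {p : Prog} {Q : State → ℕ → Prop}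
    {s : State} {τ : ℕ} (I : ℕ → State → Prop) (K N : ℕ)
    (hN : s.reg b = N) (hNW : N + 1 ≤ W) (hib : b ≠ i)
    (hI : ∀ j s' v, I j s' → I j (s'.set i v)) (h0 : I 0 s)
    (hstep : ∀ j s' τ', j < N → s'.reg i = j → s'.reg b = N → I j s' →
      wp W p (fun s'' τ'' => τ'' ≤ τ' + K ∧ s''.reg i = j ∧ s''.reg b = N ∧ I (j + 1) s'') s' τ')
    (hpost : ∀ s' τ', I N s' → τ' ≤ τ + N * (K + 8) + 6 → Q s' τ') :
    wp W (forLoop i b p) Q s τ := by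
  -- Induction on the number `m` of remaining iterations. The test and the increment cost 4 steps
  -- each, hence `K + 8` per iteration; the failing test costs 4, and the initial assignment will
  -- add 2.
  have key : ∀ m j, j + m = N → ∀ s' τ', s'.reg i = j → s'.reg b = N → I j s' →
      wp W (.loop (.ltT (.reg i) (.reg b)) (.seq p (.assign i (.reg i + .const 1))))
        (fun s'' τ'' => I N s'' ∧ τ'' ≤ τ' + m * (K + 8) + 4) s' τ' := by
    intro m
    induction m with
    | zero =>
      intro j hj s' τ' hij hb' hIj
      obtain rfl : j = N := by omega
      refine fun hB => ⟨s', _, .loopFalse ?_ ?_, hIj, ?_⟩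
      · simp only [Term.fits_ltT, Term.fits_reg, Term.eval_reg, hij, hb']
        simp; omega
      · simp [hij, hb']
      · simp
    | succ m ih =>
      intro j hj s' τ' hij hb' hIj hB
      obtain ⟨s1, t1, hr1, ht1, hi1, hb1, hI1⟩ :=
        hstep j s' (τ' + 4) (by omega) hij hb' hIj hB
      have hr3 : Run W (.assign i (.reg i + .const 1)) s1 (s1.set i (j + 1)) 4 := by
        have hx : (Term.reg i + Term.const 1).Fits W s1 := by
          simp only [Term.fits_add, Term.fits_reg, Term.fits_const, Term.eval_reg,
            Term.eval_const, hi1]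
          omega
        have h := Run.assign s1 i _ hx
        rwa [Term.eval_add, Term.eval_reg, Term.eval_const, hi1] at h
      obtain ⟨s2, t2, hr2, hI2, ht2⟩ := ih (j + 1) (by omega) (s1.set i (j + 1))
        (τ' + 4 + t1 + 4) (by simp) (by rw [State.set_reg, if_neg hib, hb1]) (hI _ _ _ hI1)
        (hr3.bounded (hr1.bounded hB))
      refine ⟨s2, _, .loopTrue ?_ ?_ (.seq hr1 hr3) hr2, hI2, ?_⟩
      · simp only [Term.fits_ltT, Term.fits_reg, Term.eval_reg, hij, hb']
        refine ⟨by omega, by omega, ?_⟩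
        split <;> omega
      · simp only [Term.eval_ltT, Term.eval_reg, hij, hb']
        rw [if_pos (by omega)]
        omega
      · simp only [Term.steps_ltT, Term.steps_reg]
        have : (m + 1) * (K + 8) = m * (K + 8) + K + 8 := by ring
        omega
  refine wp_seq (wp_assign (fun _ => by simp) ?_)
  refine wp_mono (key N 0 (by omega) _ _ (by simp) (by rw [State.set_reg, if_neg hib, hN])
    (hI _ _ _ h0)) ?_
  rintro s' τ' ⟨h3, h4⟩
  refine hpost s' τ' h3 ?_
  simp only [Term.steps_const] at h4
  omega

/-- The rule for `forLoop` together with the frame rule. -/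
theorem wp_forLoop {W Z : ℕ} (R J : List ℕ) {i b : ℕ} {p : Prog} {Q : State → ℕ → Prop}
    {s : State} {τ : ℕ} (I : ℕ → State → Prop) (K N : ℕ)
    (hN : s.reg b = N) (hNW : N + 1 ≤ W)
    (hZ : s.reg 2 = Z) (h2 : R.contains 2 = false) (hi2 : i ≠ 2) (hp : p.mods R J = true)
    (hi : R.contains i = false) (hb : R.contains b = false) (hib : b ≠ i)
    (hI : ∀ j s' v, I j s' → I j (s'.set i v))
    (h0 : I 0 s)
    (hstep : ∀ j s' τ', j < N → Frame Z (i :: R) J s s' → s'.reg i = j → I j s' →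
      wp W p (fun s'' τ'' => τ'' ≤ τ' + K ∧ I (j + 1) s'') s' τ')
    (hpost : ∀ s' τ', Frame Z (i :: R) J s s' → I N s' → τ' ≤ τ + N * (K + 8) + 6 → Q s' τ') :
    wp W (forLoop i b p) Q s τ := by
  refine wp_forLoop_of_inv (fun j s' => Frame Z (i :: R) J s s' ∧ I j s') K N hN hNW hib
    (fun j s' v h => ⟨h.1.set (by simp), hI _ _ _ h.2⟩) ⟨.refl _ _ _ _, h0⟩ ?_
    (fun s' τ' h => hpost s' τ' h.1 h.2)
  rintro j s' τ' hj hij hb' ⟨hF, hIj⟩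
  refine wp_mono (wp_frame ((hF.reg 2 (by simpa [Ne.symm hi2] using h2)).trans hZ) h2 hp
    (hstep j s' τ' hj hF hij hIj)) ?_
  rintro s'' τ'' ⟨hF', h3, h4⟩
  exact ⟨h3, (hF'.reg i hi).trans hij, (hF'.reg b hb).trans hb',
    hF.trans (hF'.mono (by simp) (by simp)), h4⟩

/-! ### Edges of forests -/

section Forest

variable {V : Type*} [Fintype V] [DecidableEq V]

open Classical in
/-- Entries of the adjacency matrix. -/
noncomputable def adj01 (G : SimpleGraph V) (x y : V) : ℕ := if G.Adj x y then 1 else 0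

theorem adj01_comm (G : SimpleGraph V) (x y : V) : adj01 G x y = adj01 G y x := by
  by_cases h : G.Adj x y
  · simp [adj01, h, h.symm]
  · have h2 : ¬ G.Adj y x := fun h2 => h h2.symm
    simp [adj01, h, h2]

theorem adj01_self (G : SimpleGraph V) (x : V) : adj01 G x x = 0 := by simp [adj01]

theorem adj01_le (G : SimpleGraph V) (x y : V) : adj01 G x y ≤ 1 := by
  unfold adj01; split <;> omega

theorem adj01_eq_zero {G : SimpleGraph V} {x y : V} : adj01 G x y = 0 ↔ ¬ G.Adj x y := by
  simp [adj01]

/-- Number of ordered pairs of adjacent vertices, the first from `X`, the second from `Y`. -/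
noncomputable def e2 (G : SimpleGraph V) (X Y : Finset V) : ℕ := ∑ x ∈ X, ∑ y ∈ Y, adj01 G x y

theorem e2_comm (G : SimpleGraph V) (X Y : Finset V) : e2 G X Y = e2 G Y X := by
  unfold e2
  rw [sum_comm]
  exact sum_congr rfl fun x _ => sum_congr rfl fun y _ => adj01_comm _ _ _

theorem sum_adj01 (G : SimpleGraph V) : ∑ x, ∑ y, adj01 G x y = 2 * G.edgeSet.ncard := by
  classical
  rw [← SimpleGraph.coe_edgeFinset, Set.ncard_coe_finset, ← G.sum_degrees_eq_twice_card_edges]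
  refine sum_congr rfl fun x _ => ?_
  rw [← G.card_neighborFinset_eq_degree, G.neighborFinset_eq_filter, card_filter]
  exact sum_congr rfl fun y _ => by unfold adj01; congr

/-- A forest extends to a spanning tree of the complete graph, which has one edge less than
vertices. -/
theorem ncard_edgeSet_lt {G : SimpleGraph V} [Nonempty V] (hG : G.IsAcyclic) :
    G.edgeSet.ncard + 1 ≤ Fintype.card V := by
  classical
  obtain ⟨T, hGT, -, hT⟩ :=
    SimpleGraph.connected_top.exists_isTree_le_of_le_of_isAcyclic (V := V) le_top hG
  rw [← hT.card_edgeFinset, ← SimpleGraph.coe_edgeFinset, Set.ncard_coe_finset]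
  exact Nat.add_le_add_right (card_le_card (by simpa using hGT)) 1

/-- The edge bound for the induced forest on `X`; ordered pairs count each edge twice. -/
theorem e2_self_le {G : SimpleGraph V} (hG : G.IsAcyclic) {X : Finset V} (hX : X.Nonempty) :
    e2 G X X + 2 ≤ 2 * #X := by
  classical
  have : Nonempty (X : Set V) := hX.to_subtype
  have h := ncard_edgeSet_lt (hG.induce (X : Set V))
  have h2 : e2 G X X = 2 * (G.induce (X : Set V)).edgeSet.ncard := by
    rw [← sum_adj01]
    unfold e2
    rw [← sum_coe_sort]
    refine sum_congr rfl fun x _ => ?_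
    rw [← sum_coe_sort]
    refine sum_congr rfl fun y _ => ?_
    simp [adj01]
  simp only [coe_sort_coe, Fintype.card_coe] at h
  omega

theorem e2_union (G : SimpleGraph V) {A B : Finset V} (h : Disjoint A B) :
    e2 G (A ∪ B) (A ∪ B) = e2 G A A + e2 G B B + 2 * e2 G A B := by
  have h1 : e2 G (A ∪ B) (A ∪ B) = (e2 G A A + e2 G A B) + (e2 G B A + e2 G B B) := by
    unfold e2
    rw [sum_union h]
    simp only [sum_union h, sum_add_distrib]
  rw [h1, e2_comm G B A]; ring

/-- A forest has a vertex with at most one neighbor. -/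
theorem exists_leaf {G : SimpleGraph V} (hG : G.IsAcyclic) {X : Finset V} (hX : 2 ≤ #X) :
    ∃ v ∈ X, ∃ p ∈ X, v ≠ p ∧ ∀ w ∈ X, w ≠ p → ¬ G.Adj v w := by
  classical
  have h := e2_self_le hG (X := X) (card_pos.1 (by omega))
  -- The degrees within `X` add up to at most `2 * #X - 2`, so not all of them are at least 2.
  have h1 : ∃ v ∈ X, ∑ y ∈ X, adj01 G v y ≤ 1 := by
    by_contra! hc
    have : ∑ x ∈ X, 2 ≤ e2 G X X := sum_le_sum fun x hx => hc x hx
    simp only [sum_const, smul_eq_mul] at this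
    omega
  obtain ⟨v, hv, hd⟩ := h1
  have hc : #{y ∈ X | G.Adj v y} ≤ 1 := by
    rw [card_filter]
    convert hd
    unfold adj01; congr
  by_cases he : ∃ p ∈ X, G.Adj v p
  · obtain ⟨p, hp, hvp⟩ := he
    refine ⟨v, hv, p, hp, hvp.ne, fun w hw hwp hvw => hwp ?_⟩
    exact card_le_one.1 hc _ (by simp [hw, hvw]) _ (by simp [hp, hvp])
  · push Not at he
    -- Here `v` is isolated in `X` and any other vertex serves as `p`. Thus the elimination also
    -- passes from one component of the forest to another.
    obtain ⟨p, hp⟩ : (X.erase v).Nonempty := by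
      rw [← card_pos, card_erase_of_mem hv]; omega
    exact ⟨v, hv, p, mem_of_mem_erase hp, (ne_of_mem_erase hp).symm, fun w hw _ => he w hw⟩

end Forest

/-! ### The cost of a labelling -/

section Cost

variable {V ι : Type*} [Fintype V] [DecidableEq V] [DecidableEq ι]

/-- Number of ordered pairs of adjacent vertices with the same label. -/
noncomputable def gain2 (G : SimpleGraph V) (f : V → ι) : ℕ :=
  ∑ x, ∑ y, if f x = f y then adj01 G x y else 0

/-- Contribution to the cost of an ordered pair of vertices with the same label. -/
noncomputable def kap (G : SimpleGraph V) (x y : V) : ℤ := if x = y then 0 else 1 - 2 * adj01 G x y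

/-- Twice the cost of a labelling, up to a constant. -/
noncomputable def cost2 (G : SimpleGraph V) (f : V → ι) : ℤ :=
  ∑ x, ∑ y, if f x = f y then kap G x y else 0

/-- The constant on the right charges every edge as if it were cut. An edge inside a set takes this
charge back and a non-adjacent pair inside a set adds its own: this is `kap`, with values -1 and 1.
The graphs `H1` and `H2` below consist of the two kinds of disagreements. -/
theorem two_mul_ccCost (G : SimpleGraph V) (P : Finpartition (univ : Finset V)) (f : V → ι)
    (hf : ∀ u v, P.part u = P.part v ↔ f u = f v) :
    (2 * ccCost G P : ℤ) = cost2 G f + ∑ x, ∑ y, (adj01 G x y : ℤ) := by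
  classical
  let H1 : SimpleGraph V :=
    { Adj := fun x y => Gᶜ.Adj x y ∧ f x = f y
      symm := ⟨fun x y h => ⟨h.1.symm, h.2.symm⟩⟩
      loopless := ⟨fun x h => h.1.ne rfl⟩ }
  let H2 : SimpleGraph V :=
    { Adj := fun x y => G.Adj x y ∧ f x ≠ f y
      symm := ⟨fun x y h => ⟨h.1.symm, h.2.symm⟩⟩
      loopless := ⟨fun x h => h.1.ne rfl⟩ }
  have hs : ∀ x y, SameCluster P s(x, y) ↔ f x = f y := by
    intro x y
    simp only [SameCluster, Sym2.mem_iff, hf]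
    refine ⟨fun h => h x (.inl rfl) y (.inr rfl), ?_⟩
    rintro h u (rfl | rfl) v (rfl | rfl) <;> simp [h]
  have h1 : intraCost G P = H1.edgeSet.ncard := by
    unfold intraCost
    congr 1
    ext e
    induction e with
    | _ x y => simp only [Set.mem_ofPred_eq, hs, SimpleGraph.mem_edgeSet]; rfl
  have h2 : interCost G P = H2.edgeSet.ncard := by
    unfold interCost
    congr 1
    ext e
    induction e with
    | _ x y => simp only [Set.mem_ofPred_eq, hs, SimpleGraph.mem_edgeSet]; rfl
  have h3 : 2 * ccCost G P = ∑ x, ∑ y, (adj01 H1 x y + adj01 H2 x y) := by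
    simp only [sum_add_distrib, sum_adj01, ccCost, h1, h2]
    ring
  have h4 : (2 * ccCost G P : ℤ) = ∑ x, ∑ y, ((adj01 H1 x y + adj01 H2 x y : ℕ) : ℤ) := by
    exact_mod_cast h3
  rw [h4, cost2, ← sum_add_distrib]
  refine sum_congr rfl fun x _ => ?_
  rw [← sum_add_distrib]
  refine sum_congr rfl fun y _ => ?_
  by_cases hxy : x = y
  · subst hxy; simp [adj01_self, kap]
  · by_cases ha : G.Adj x y <;> by_cases hl : f x = f y <;>
      simp [adj01, kap, H1, H2, hxy, ha, hl]

/-- With all classes of size `d`, the number of ordered pairs inside the classes is always `|V| * (d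
- 1)`. Only the edges among them distinguish two such labellings, so minimal cost amounts to maximal
gain. -/
theorem cost2_of_uniform (G : SimpleGraph V) {f : V → ι} {d : ℕ}
    (hf : ∀ u, #{x | f x = f u} = d) :
    cost2 G f = (Fintype.card V : ℤ) * (d - 1) - 2 * gain2 G f := by
  have h : ∀ x y, (if f x = f y then kap G x y else 0) =
      ((if f y = f x then 1 else 0) - (if x = y then 1 else 0))
        - 2 * ((if f x = f y then adj01 G x y else 0 : ℕ) : ℤ) := by
    intro x y
    by_cases hxy : x = y
    · subst hxy; simp [adj01_self, kap]
    · by_cases hl : f x = f y <;> simp [kap, hxy, hl, eq_comm]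
  unfold cost2 gain2
  simp only [h, sum_sub_distrib]
  have h2 : ∀ x, ∑ y, (if f y = f x then (1 : ℤ) else 0) = d := by
    intro x
    rw [← hf x, card_filter]
    push_cast
    rfl
  simp only [h2]
  simp only [sum_const, card_univ, nsmul_eq_mul, sum_ite_eq, mem_univ, if_true, ← mul_sum]
  push_cast
  ring

end Cost

/-! ### Fair labellings -/

section Fair

variable {V ι : Type*} [Fintype V] [DecidableEq V] [DecidableEq ι] {k : ℕ}

/-- The ratio gives `#(color i) * d = |V| * c i` with `d = setmax c`. So `d` divides all `|V| * c
i`, hence their gcd `|V|`, and `m` is the quotient. -/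
theorem exists_card_colorClass {col : V → Fin k} {c : Fin k → ℕ} (hV : 0 < Fintype.card V)
    (hk : 0 < k) (hc : ∀ i, 0 < c i)
    (hg : univ.gcd c = 1) (hr : HasColorRatio col c) :
    ∃ m, 0 < m ∧ ∀ i, #(colorClass col i) = m * c i := by
  have hsum : ∑ i, #(colorClass col i) = Fintype.card V := by
    rw [← card_univ, card_eq_sum_card_fiberwise (f := col) (t := univ) (by simp)]
    rfl
  have hd : 0 < setmax c := by
    unfold setmax
    exact sum_pos (fun i _ => hc i) ⟨⟨0, hk⟩, mem_univ _⟩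
  have h1 : ∀ i, #(colorClass col i) * setmax c = Fintype.card V * c i := by
    intro i
    rw [← hsum, setmax, mul_sum, sum_mul]
    exact sum_congr rfl fun j _ => hr i j
  have h2 : setmax c ∣ Fintype.card V := by
    have h3 : setmax c ∣ univ.gcd fun i => Fintype.card V * c i :=
      dvd_gcd fun i _ => ⟨#(colorClass col i), by rw [← h1 i]; ring⟩
    rwa [Finset.gcd_mul_left, hg, mul_one, normalize_eq] at h3
  obtain ⟨m, hm⟩ := h2
  refine ⟨m, ?_, fun i => ?_⟩
  · rcases Nat.eq_zero_or_pos m with rfl | h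
    · simp at hm; omega
    · exact h
  · have h3 := h1 i
    rw [hm] at h3
    exact Nat.eq_of_mul_eq_mul_right hd (by rw [h3]; ring)

/-- The sets of vertices with equal labels are fair. -/
def FairLabel (col : V → Fin k) (c : Fin k → ℕ) (f : V → ι) : Prop :=
  ∀ u i, #{x | f x = f u ∧ col x = i} * setmax c = c i * #{x | f x = f u}

theorem card_eq_sum_colors (col : V → Fin k) (X : Finset V) : #X = ∑ i, #{x ∈ X | col x = i} :=
  card_eq_sum_card_fiberwise (f := col) (t := univ) (by simp)

theorem isFairPartition_iff {col : V → Fin k} {c : Fin k → ℕ} {m : ℕ} (hm : 0 < m)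
    (hcol : ∀ i, #(colorClass col i) = m * c i)
    (P : Finpartition (univ : Finset V)) (f : V → ι)
    (hf : ∀ u v, P.part u = P.part v ↔ f u = f v) :
    IsFairPartition col P ↔ FairLabel col c f := by
  have hV : Fintype.card V = m * setmax c := by
    rw [← card_univ, card_eq_sum_colors col, setmax, mul_sum]
    exact sum_congr rfl fun i _ => hcol i
  have hpart : ∀ u, P.part u = ({x | f x = f u} : Finset V) := by
    intro u
    ext x
    rw [P.mem_part_iff_part_eq_part (mem_univ _) (mem_univ _), hf]
    simp
  have hset : ∀ u, IsFairSet col (P.part u) ↔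
      ∀ i, #{x | f x = f u ∧ col x = i} * setmax c = c i * #{x | f x = f u} := by
    intro u
    refine forall_congr' fun i => ?_
    have h1 : P.part u ∩ colorClass col i = ({x | f x = f u ∧ col x = i} : Finset V) := by
      rw [hpart, colorClass, ← filter_and]
    have hpos : 0 < #{x | f x = f u} := card_pos.2 ⟨u, by simp⟩
    have hposV : 0 < Fintype.card V := Fintype.card_pos_iff.2 ⟨u⟩
    rw [h1, hpart, div_eq_div_iff (by positivity) (by positivity), hV, hcol]
    norm_cast
    constructor
    · intro h
      exact Nat.eq_of_mul_eq_mul_left hm (by linarith)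
    · intro h
      linear_combination m * h
  constructor
  · intro h u
    exact (hset u).1 (h _ (P.part_mem.2 (mem_univ u)))
  · intro h S hS
    obtain ⟨u, hu⟩ := P.nonempty_of_mem_parts hS
    rw [← P.part_eq_of_mem hS hu]
    exact (hset u).2 (h u)

/-- The same gcd argument inside one class: its size is divisible by `setmax c`. -/
theorem FairLabel.exists_mul {col : V → Fin k} {c : Fin k → ℕ} (hg : univ.gcd c = 1)
    (hd : 0 < setmax c) {f : V → ι} (hf : FairLabel col c f) (u : V) :
    ∃ j, 0 < j ∧ #{x | f x = f u} = j * setmax c ∧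
      ∀ i, #{x | f x = f u ∧ col x = i} = j * c i := by
  have h2 : setmax c ∣ #{x | f x = f u} := by
    have h3 : setmax c ∣ univ.gcd fun i => #{x | f x = f u} * c i :=
      dvd_gcd fun i _ => ⟨#{x | f x = f u ∧ col x = i}, by
        have := hf u i
        linarith⟩
    rwa [Finset.gcd_mul_left, hg, mul_one, normalize_eq] at h3
  obtain ⟨j, hj⟩ := h2
  have hpos : 0 < #{x | f x = f u} := card_pos.2 ⟨u, by simp⟩
  refine ⟨j, ?_, by rw [hj]; ring, fun i => ?_⟩
  · rcases Nat.eq_zero_or_pos j with rfl | h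
    · simp at hj; simp [hj] at hpos
    · exact h
  · have h3 := hf u i
    rw [hj] at h3
    exact Nat.eq_of_mul_eq_mul_right hd (by rw [h3]; ring)

/-- The colors do not interact, so the color classes of `T` can be filled up one by one within `S`.
-/
theorem exists_fair_subset {col : V → Fin k} {c : Fin k → ℕ} {S T : Finset V} (hTS : T ⊆ S)
    (hT : ∀ i, #{x ∈ T | col x = i} ≤ c i) (hS : ∀ i, c i ≤ #{x ∈ S | col x = i}) :
    ∃ A, T ⊆ A ∧ A ⊆ S ∧ ∀ i, #{x ∈ A | col x = i} = c i := by
  have h : ∀ i, ∃ A : Finset V, {x ∈ T | col x = i} ⊆ A ∧ A ⊆ {x ∈ S | col x = i} ∧ #A = c i :=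
    fun i => exists_subsuperset_card_eq (filter_subset_filter _ hTS) (hT i) (hS i)
  choose A h1 h2 h3 using h
  refine ⟨({x ∈ S | x ∈ A (col x)} : Finset V), fun x hx => ?_, filter_subset _ _, fun i => ?_⟩
  · exact mem_filter.2 ⟨hTS hx, h1 (col x) (by simp [hx])⟩
  · rw [← h3 i]
    congr 1
    ext x
    simp only [mem_filter]
    constructor
    · rintro ⟨⟨-, hx⟩, rfl⟩; exact hx
    · intro hx
      have := mem_filter.1 (h2 i hx)
      exact ⟨⟨this.1, by rwa [this.2]⟩, this.2⟩

/-- A fair set in a forest which is not minimal can be split at a small number of edges. -/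
theorem exists_fair_split {G : SimpleGraph V} (hG : G.IsAcyclic) {col : V → Fin k}
    {c : Fin k → ℕ} (hk : 2 ≤ k) (hc : ∀ i, 0 < c i) {S : Finset V} {j : ℕ} (hj : 2 ≤ j)
    (hS : ∀ i, #{x ∈ S | col x = i} = j * c i) :
    ∃ A ⊆ S, (∀ i, #{x ∈ A | col x = i} = c i) ∧ e2 G A (S \ A) + 2 ≤ #S := by
  have hd : setmax c ≤ #S - setmax c ∧ 0 < setmax c := by
    have : #S = j * setmax c := by
      rw [card_eq_sum_colors col, setmax, mul_sum]
      exact sum_congr rfl fun i _ => hS i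
    have h2 : 2 * setmax c ≤ j * setmax c := Nat.mul_le_mul_right _ hj
    refine ⟨by omega, ?_⟩
    unfold setmax
    exact sum_pos (fun i _ => hc i) ⟨⟨0, by omega⟩, mem_univ _⟩
  have hle : ∀ i, c i ≤ #{x ∈ S | col x = i} := fun i => by
    rw [hS]; exact Nat.le_mul_of_pos_left _ (by omega)
  have hcard : ∀ A : Finset V, (∀ i, #{x ∈ A | col x = i} = c i) → #A = setmax c := by
    intro A hA
    rw [card_eq_sum_colors col, setmax]
    exact sum_congr rfl fun i _ => hA i
  have hsplit : ∀ A ⊆ S, e2 G S S = e2 G A A + e2 G (S \ A) (S \ A) + 2 * e2 G A (S \ A) := by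
    intro A hA
    rw [← e2_union G disjoint_sdiff, union_sdiff_of_subset hA]
  have hSne : S.Nonempty := card_pos.1 (by omega)
  have hSe := e2_self_le hG hSne
  let i0 : Fin k := ⟨0, by omega⟩
  let X : Finset V := {x ∈ S | col x = i0}
  -- The bound on the edges of a forest only gives a cut of `#S - 1` edges; one more has to be
  -- saved. If an edge joins color `i0` to another color, its ends can both be put into `A`, as each
  -- color occurs at most once among them. Otherwise color `i0` is disconnected from the rest of
  -- `S`, and the two parts together have at most `#S - 2` edges, so any `A` will do.
  by_cases hbi : ∃ a ∈ X, ∃ b ∈ S \ X, G.Adj a b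
  · obtain ⟨a, ha, b, hb, hab⟩ := hbi
    have haX : a ∈ S ∧ col a = i0 := by simpa [X] using ha
    have hbX : b ∈ S ∧ col b ≠ i0 := by
      have := mem_sdiff.1 hb
      exact ⟨this.1, fun h => this.2 (by simp [X, this.1, h])⟩
    obtain ⟨A, hTA, hAS, hA⟩ := exists_fair_subset (col := col) (c := c) (S := S) (T := {a, b})
      (by intro x hx; simp only [mem_insert, mem_singleton] at hx
          rcases hx with rfl | rfl
          exacts [haX.1, hbX.1])
      (by
        intro i
        refine le_trans (card_le_one.2 ?_) (hc i)
        intro x hx y hy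
        simp only [mem_filter, mem_insert, mem_singleton] at hx hy
        obtain ⟨rfl | rfl, h1⟩ := hx <;> obtain ⟨rfl | rfl, h2⟩ := hy
        · rfl
        · exact absurd (h2.trans (h1.symm.trans haX.2)) hbX.2
        · exact absurd (h1.trans (h2.symm.trans haX.2)) hbX.2
        · rfl) hle
    refine ⟨A, hAS, hA, ?_⟩
    have haA : a ∈ A := hTA (by simp)
    have hbA : b ∈ A := hTA (by simp)
    have h2 : 2 ≤ e2 G A A := by
      have h3 : ∀ x ∈ ({a, b} : Finset V), 1 ≤ ∑ y ∈ A, adj01 G x y := by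
        intro x hx
        simp only [mem_insert, mem_singleton] at hx
        rcases hx with rfl | rfl
        · exact le_trans (by simp [adj01, hab])
            (single_le_sum (f := fun y => adj01 G x y) (fun _ _ => Nat.zero_le _) hbA)
        · exact le_trans (by simp [adj01, hab.symm])
            (single_le_sum (f := fun y => adj01 G x y) (fun _ _ => Nat.zero_le _) haA)
      calc 2 = ∑ x ∈ ({a, b} : Finset V), 1 := by
            rw [sum_const, card_pair hab.ne]; rfl
        _ ≤ ∑ x ∈ ({a, b} : Finset V), ∑ y ∈ A, adj01 G x y := sum_le_sum h3
        _ ≤ e2 G A A := sum_le_sum_of_subset hTA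
    have := hsplit A hAS
    omega
  · push Not at hbi
    obtain ⟨A, -, hAS, hA⟩ := exists_fair_subset (col := col) (c := c) (S := S) (T := ∅)
      (by simp) (by simp) hle
    refine ⟨A, hAS, hA, ?_⟩
    have hXS : X ⊆ S := filter_subset _ _
    have h0 : e2 G X (S \ X) = 0 :=
      sum_eq_zero fun a ha => sum_eq_zero fun b hb => adj01_eq_zero.2 (hbi a ha b hb)
    have hX : X.Nonempty := card_pos.1 (lt_of_lt_of_le (hc i0) (hle i0))
    have hX' : (S \ X).Nonempty := by
      obtain ⟨x, hx⟩ := card_pos.1 (lt_of_lt_of_le (hc ⟨1, hk⟩) (hle ⟨1, hk⟩))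
      refine ⟨x, ?_⟩
      simp only [mem_filter] at hx
      simp [X, hx.1, hx.2, i0]
    have h1 := e2_self_le hG hX
    have h2 := e2_self_le hG hX'
    have h3 := hsplit X hXS
    have h4 := hsplit A hAS
    have h5 : #(S \ X) = #S - #X := card_sdiff_of_subset hXS
    have h6 := card_le_card hXS
    omega

theorem sum_sum_kap (G : SimpleGraph V) {A B : Finset V} (h : Disjoint A B) :
    ∑ x ∈ A, ∑ y ∈ B, kap G x y = #A * #B - 2 * e2 G A B := by
  have h1 : ∀ x ∈ A, ∀ y ∈ B, kap G x y = 1 - 2 * (adj01 G x y : ℤ) := by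
    intro x hx y hy
    have : x ≠ y := fun he => disjoint_left.1 h hx (he ▸ hy)
    simp [kap, this]
  rw [sum_congr rfl fun x hx => sum_congr rfl (h1 x hx)]
  simp only [sum_sub_distrib, ← mul_sum, sum_const, e2]
  push_cast
  simp

/-- Splitting a set of a fair labelling. -/
theorem FairLabel.exists_refine {G : SimpleGraph V} (hG : G.IsAcyclic) {col : V → Fin k}
    {c : Fin k → ℕ} (hk : 2 ≤ k) (hc : ∀ i, 0 < c i) (hg : univ.gcd c = 1) {f : V → ℕ}
    (hf : FairLabel col c f) {u : V} (hu : #{x | f x = f u} ≠ setmax c) :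
    ∃ f' : V → ℕ, FairLabel col c f' ∧ cost2 G f' ≤ cost2 G f ∧
      #{v | #{x | f' x = f' v} ≠ setmax c} < #{v | #{x | f x = f v} ≠ setmax c} := by
  have hd : 2 ≤ setmax c := by
    unfold setmax
    calc 2 ≤ k := hk
      _ = ∑ i : Fin k, 1 := by simp
      _ ≤ ∑ i, c i := sum_le_sum fun i _ => hc i
  obtain ⟨j, hj0, hj, hji⟩ := hf.exists_mul hg (by omega) u
  have hj2 : 2 ≤ j := by
    rcases Nat.lt_or_ge j 2 with h | h
    · obtain rfl : j = 1 := by omega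
      simp at hj; contradiction
    · exact h
  set S : Finset V := {x | f x = f u} with hSdef
  have hSi : ∀ i, #{x ∈ S | col x = i} = j * c i := by
    intro i
    rw [← hji i, hSdef, filter_filter]
  obtain ⟨A, hAS, hA, hcut⟩ := exists_fair_split hG hk hc hj2 hSi
  have hAcard : #A = setmax c := by
    rw [card_eq_sum_colors col, setmax]
    exact sum_congr rfl fun i _ => hA i
  have hBcard : #(S \ A) = j * setmax c - setmax c := by
    rw [card_sdiff_of_subset hAS, hj, hAcard]
  have hBi : ∀ i, #{x ∈ S \ A | col x = i} = j * c i - c i := by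
    intro i
    have : {x ∈ S \ A | col x = i} = {x ∈ S | col x = i} \ {x ∈ A | col x = i} := by
      ext x; simp; tauto
    rw [this, card_sdiff_of_subset (filter_subset_filter _ hAS), hSi, hA]
  -- An unused label for the new set `A`; this is why the labels here are natural numbers.
  obtain ⟨a, ha⟩ := Infinite.exists_notMem_finset (univ.image f)
  have ha' : ∀ x, f x ≠ a := fun x hx => ha (mem_image.2 ⟨x, mem_univ _, hx⟩)
  let f' : V → ℕ := fun x => if x ∈ A then a else f x
  have hS : ∀ x, x ∈ S ↔ f x = f u := by simp [hSdef]
  have cA : ∀ v ∈ A, ({x | f' x = f' v} : Finset V) = A := by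
    intro v hv
    ext x
    by_cases hx : x ∈ A <;> simp [f', hv, hx, ha']
  have cB : ∀ v ∈ S \ A, ({x | f' x = f' v} : Finset V) = S \ A := by
    intro v hv
    obtain ⟨hv1, hv2⟩ := mem_sdiff.1 hv
    ext x
    by_cases hx : x ∈ A <;> simp [f', hv2, hx, (ha' _).symm, hS, (hS v).1 hv1]
  have cC : ∀ v, v ∉ S → ({x | f' x = f' v} : Finset V) = ({x | f x = f v} : Finset V) := by
    intro v hv
    have hv2 : v ∉ A := fun h => hv (hAS h)
    ext x
    by_cases hx : x ∈ A
    · have : f x ≠ f v := fun h => hv ((hS v).2 (h.symm.trans ((hS x).1 (hAS hx))))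
      simp [f', hv2, hx, (ha' _).symm, this]
    · simp [f', hv2, hx]
  refine ⟨f', ?_, ?_, ?_⟩
  · intro v i
    rw [filter_and, ← filter_and, ← filter_filter]
    by_cases hvS : v ∈ S
    · by_cases hvA : v ∈ A
      · rw [cA v hvA, hA, hAcard]
      · rw [cB v (mem_sdiff.2 ⟨hvS, hvA⟩), hBi, hBcard, ← Nat.sub_one_mul, ← Nat.sub_one_mul]
        ring
    · rw [cC v hvS, filter_filter]
      exact hf v i
  · have hpt : ∀ x y, (if f x = f y then kap G x y else 0) =
        (if f' x = f' y then kap G x y else 0) +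
        ((if x ∈ A then if y ∈ S \ A then kap G x y else 0 else 0) +
        (if x ∈ S \ A then if y ∈ A then kap G x y else 0 else 0)) := by
      intro x y
      by_cases hx : x ∈ A <;> by_cases hy : y ∈ A
      · have h1 := (hS x).1 (hAS hx)
        have h2 := (hS y).1 (hAS hy)
        simp [f', hx, hy, h1, h2]
      · have h1 := (hS x).1 (hAS hx)
        by_cases hyS : y ∈ S
        · simp [f', hx, hy, h1, hyS, (hS y).1 hyS, (ha' _).symm]
        · have : f y ≠ f u := fun h => hyS ((hS y).2 h)
          simp [f', hx, hy, h1, hyS, this.symm, (ha' _).symm]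
      · have h1 := (hS y).1 (hAS hy)
        by_cases hxS : x ∈ S
        · simp [f', hx, hy, h1, hxS, (hS x).1 hxS, (ha' _)]
        · have : f x ≠ f u := fun h => hxS ((hS x).2 h)
          simp [f', hx, hy, h1, hxS, this, (ha' _)]
      · simp [f', hx, hy]
    have hsum : cost2 G f = cost2 G f' + ((∑ x ∈ A, ∑ y ∈ S \ A, kap G x y) +
        ∑ x ∈ S \ A, ∑ y ∈ A, kap G x y) := by
      unfold cost2
      rw [sum_congr rfl fun x _ => sum_congr rfl fun y _ => hpt x y]
      have e1 : ∀ X Y : Finset V, ∑ x, ∑ y, (if x ∈ X then if y ∈ Y then kap G x y else 0 else 0)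
          = ∑ x ∈ X, ∑ y ∈ Y, kap G x y := by
        intro X Y
        have e2 : ∀ x, ∑ y, (if x ∈ X then if y ∈ Y then kap G x y else 0 else 0)
            = if x ∈ X then ∑ y ∈ Y, kap G x y else 0 := by
          intro x
          split <;> simp
        simp only [e2, sum_ite_mem, univ_inter]
      simp only [sum_add_distrib, e1]
    rw [hsum, sum_sum_kap G disjoint_sdiff, sum_sum_kap G disjoint_sdiff.symm, e2_comm G (S \ A) A,
      hBcard, hAcard]
    have h1 : ((j * setmax c - setmax c : ℕ) : ℤ) = (j - 1) * setmax c := by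
      rw [Nat.cast_sub (Nat.le_mul_of_pos_left _ hj0)]; push_cast; ring
    rw [h1]
    have h2 : (e2 G A (S \ A) : ℤ) + 2 ≤ j * setmax c := by
      rw [hj] at hcut
      exact_mod_cast hcut
    have hd' : (2 : ℤ) ≤ setmax c := by exact_mod_cast hd
    have hj' : (2 : ℤ) ≤ j := by exact_mod_cast hj2
    -- With `d = setmax c`, half of the saving is `(j - 1) * d ^ 2 - 2 * cut`. For the largest
    -- possible cut `j * d - 2` this equals `(d - 2) ^ 2 + (j - 2) * d * (d - 2)`. It vanishes for
    -- `d = 2`, so the bound on the cut cannot be weakened.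
    nlinarith [mul_nonneg (sub_nonneg.2 hd') (sub_nonneg.2 hj'),
      mul_nonneg (mul_nonneg (sub_nonneg.2 hd') (sub_nonneg.2 hj')) (by linarith : (0:ℤ) ≤ setmax c),
      sq_nonneg ((setmax c : ℤ) - 2)]
  · refine card_lt_card ⟨fun v hv => ?_, fun h => ?_⟩
    · simp only [mem_filter, mem_univ, true_and] at hv ⊢
      by_cases hvS : v ∈ S
      · have : ({x | f x = f v} : Finset V) = S := by
          rw [(hS v).1 hvS]
        rw [this]; exact hu
      · rwa [cC v hvS] at hv
    · obtain ⟨v, hv⟩ : A.Nonempty := card_pos.1 (by omega)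
      have h1 : v ∈ ({v | #{x | f x = f v} ≠ setmax c} : Finset V) := by
        simp only [mem_filter, mem_univ, true_and]
        have : ({x | f x = f v} : Finset V) = S := by
          rw [(hS v).1 (hAS hv)]
        rw [this]; exact hu
      have h2 := h h1
      simp only [mem_filter, mem_univ, true_and] at h2
      rw [cA v hv] at h2
      exact h2 hAcard

/-- In a forest, some fair labelling of minimum cost has only minimal fair sets. -/
theorem FairLabel.exists_uniform {G : SimpleGraph V} (hG : G.IsAcyclic) {col : V → Fin k}
    {c : Fin k → ℕ} (hk : 2 ≤ k) (hc : ∀ i, 0 < c i) (hg : univ.gcd c = 1) {f : V → ℕ}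
    (hf : FairLabel col c f) :
    ∃ f' : V → ℕ, FairLabel col c f' ∧ cost2 G f' ≤ cost2 G f ∧
      ∀ v, #{x | f' x = f' v} = setmax c := by
  induction hb : #{v | #{x | f x = f v} ≠ setmax c} using Nat.strong_induction_on generalizing f with
  | _ b ih =>
    by_cases hu : ∃ u, #{x | f x = f u} ≠ setmax c
    · obtain ⟨u, hu⟩ := hu
      obtain ⟨f', h1, h2, h3⟩ := hf.exists_refine hG hk hc hg hu
      obtain ⟨f'', h4, h5, h6⟩ := ih _ (hb ▸ h3) h1 rfl
      exact ⟨f'', h4, h5.trans h2, h6⟩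
    · push Not at hu
      exact ⟨f, hf, le_rfl, hu⟩

end Fair

/-! ### Encoding of color multiplicities by numbers -/

/-- Place values of the mixed radix system with digits `0, …, c i`. -/
def rad (c : ℕ → ℕ) (i : ℕ) : ℕ := ∏ j ∈ range i, (c j + 1)

theorem rad_succ (c : ℕ → ℕ) (i : ℕ) : rad c (i + 1) = rad c i * (c i + 1) := prod_range_succ _ _

theorem rad_pos (c : ℕ → ℕ) (i : ℕ) : 0 < rad c i := prod_pos fun _ _ => Nat.succ_pos _

theorem rad_mono (c : ℕ → ℕ) : Monotone (rad c) :=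
  monotone_nat_of_le_succ fun i => by
    rw [rad_succ]; exact Nat.le_mul_of_pos_right _ (Nat.succ_pos _)

theorem rad_dvd (c : ℕ → ℕ) {i j : ℕ} (h : i ≤ j) : rad c i ∣ rad c j :=
  prod_dvd_prod_of_subset _ _ _ (range_subset_range.2 h)

theorem sum_mul_rad (c : ℕ → ℕ) (k : ℕ) : ∑ i ∈ range k, c i * rad c i + 1 = rad c k := by
  induction k with
  | zero => simp [rad]
  | succ k ih => rw [sum_range_succ, rad_succ, ← ih]; ring

/-- Modulo `rad c (i + 1)` the higher terms vanish, and the lower ones agree and cancel. What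
remains is `a i ≡ c i` modulo `c i + 1`, where `c i` is the largest residue. Equality may fail
because of carries. -/
theorem le_of_sum_mul_rad_eq {c a : ℕ → ℕ} {k i : ℕ} (hi : i < k) (hlt : ∀ j < i, a j = c j)
    (h : ∑ j ∈ range k, a j * rad c j = ∑ j ∈ range k, c j * rad c j) : c i ≤ a i := by
  have key : ∀ b : ℕ → ℕ, ∑ j ∈ range k, b j * rad c j ≡ ∑ j ∈ range (i + 1), b j * rad c j
      [MOD rad c (i + 1)] := by
    intro b
    rw [← sum_range_add_sum_Ico _ (show i + 1 ≤ k from hi)]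
    have : ∑ j ∈ Ico (i + 1) k, b j * rad c j ≡ 0 [MOD rad c (i + 1)] :=
      (Nat.modEq_zero_iff_dvd).2 (dvd_sum fun j hj =>
        Dvd.dvd.mul_left (rad_dvd c (mem_Ico.1 hj).1) _)
    simpa using Nat.ModEq.add_left (∑ j ∈ range (i + 1), b j * rad c j) this
  have h1 := (key a).symm.trans ((congrArg (· % rad c (i + 1)) h).trans (key c))
  rw [sum_range_succ, sum_range_succ, sum_congr rfl fun j hj => by
    rw [hlt j (mem_range.1 hj)]] at h1
  have h2 := Nat.ModEq.add_left_cancel' _ h1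
  rw [rad_succ, mul_comm (a i), mul_comm (c i)] at h2
  have h3 := Nat.ModEq.mul_left_cancel' (rad_pos c i).ne' h2
  have h4 : a i % (c i + 1) = c i :=
    Eq.trans h3 (Nat.mod_eq_of_lt (Nat.lt_succ_self (c i)))
  exact h4 ▸ Nat.mod_le _ _

/-- Extension of a family by zero. -/
def ext0 {k : ℕ} (c : Fin k → ℕ) (i : ℕ) : ℕ := if h : i < k then c ⟨i, h⟩ else 0

@[simp] theorem ext0_val {k : ℕ} (c : Fin k → ℕ) (i : Fin k) : ext0 c i = c i := by simp [ext0]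

theorem rad_ext0 {k : ℕ} (c : Fin k → ℕ) : rad (ext0 c) k = setvars c := by
  unfold rad setvars
  rw [← Fin.prod_univ_eq_prod_range fun j => ext0 c j + 1]
  simp

section Weight

variable {V ι : Type*} [Fintype V] [DecidableEq V] [DecidableEq ι] {k : ℕ}

/-- Weight of a vertex. -/
def rho (c : Fin k → ℕ) (col : V → Fin k) (u : V) : ℕ := rad (ext0 c) (col u)

/-- Total weight of the vertices with label `r`. -/
def pieceW (ρ : V → ℕ) (f : V → ι) (r : ι) : ℕ := ∑ x with f x = r, ρ x

theorem sum_rho (c : Fin k → ℕ) (col : V → Fin k) (X : Finset V) :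
    ∑ x ∈ X, rho c col x = ∑ i, #{x ∈ X | col x = i} * rad (ext0 c) i := by
  rw [← sum_fiberwise_of_maps_to (g := col) (t := univ) (by simp)]
  refine sum_congr rfl fun i _ => ?_
  rw [sum_congr rfl fun x hx => by rw [rho, (mem_filter.1 hx).2], sum_const, smul_eq_mul]

theorem sum_c_mul_rad (c : Fin k → ℕ) : ∑ i, c i * rad (ext0 c) i + 1 = setvars c := by
  rw [← rad_ext0, ← sum_mul_rad, ← Fin.sum_univ_eq_sum_range fun j => ext0 c j * rad (ext0 c) j]
  simp

/-- All labels that occur have the weight of a minimal fair set. -/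
def IsFinal (ρ : V → ℕ) (S : ℕ) (f : V → ι) : Prop := ∀ u, pieceW ρ f (f u) = S

theorem sum_pieceW_image (ρ : V → ℕ) (f : V → ι) :
    ∑ r ∈ univ.image f, pieceW ρ f r = ∑ x, ρ x :=
  sum_fiberwise_of_maps_to (fun x _ => mem_image_of_mem f (mem_univ x)) _

/-- The total weight shows that there are exactly `m` pieces. Go through the colors by increasing
place value: once the lower colors are right, each piece contains at least `c i` vertices of color
`i` by `le_of_sum_mul_rad_eq`. As there are only `m * c i` such vertices, equality holds in every
piece. Counting over all pieces thus rules out the carries that a single piece would allow. -/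
theorem card_color_of_isFinal {c : Fin k → ℕ} {col : V → Fin k} {m : ℕ}
    (hcol : ∀ i, #(colorClass col i) = m * c i) (hs : 1 < setvars c)
    {f : V → ι} (hf : IsFinal (rho c col) (setvars c - 1) f) (u : V) (i : Fin k) :
    #{x | f x = f u ∧ col x = i} = c i := by
  have hS := sum_c_mul_rad c
  have hQ : #(univ.image f) = m := by
    have h1 := sum_pieceW_image (rho c col) f
    rw [sum_congr rfl (g := fun _ => setvars c - 1), sum_const, smul_eq_mul, sum_rho] at h1
    · have h2 : ∑ i, #{x | col x = i} * rad (ext0 c) i = m * (setvars c - 1) := by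
        rw [← hS, Nat.add_sub_cancel, mul_sum]
        refine sum_congr rfl fun i _ => ?_
        have := hcol i
        unfold colorClass at this
        rw [this]; ring
      rw [h2] at h1
      exact Nat.eq_of_mul_eq_mul_right (by omega) h1
    · intro r hr
      obtain ⟨x, -, rfl⟩ := mem_image.1 hr
      exact hf x
  have key : ∀ j, ∀ i : Fin k, (i : ℕ) = j → ∀ r ∈ univ.image f,
      c i = #{x | f x = r ∧ col x = i} := by
    intro j
    induction j using Nat.strong_induction_on with
    | _ j ih =>
      intro i hij
      refine (sum_eq_sum_iff_of_le (f := fun _ => c i) fun r hr => ?_).1 ?_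
      · have h := le_of_sum_mul_rad_eq (c := ext0 c)
          (a := ext0 fun i => #{x | f x = r ∧ col x = i}) (k := k) (i := i) i.2 ?_ ?_
        · simpa using h
        · intro l hl
          have hlk : l < k := hl.trans i.2
          have := ih l (hij ▸ hl) ⟨l, hlk⟩ rfl r hr
          simp [ext0, hlk, this]
        · rw [← Fin.sum_univ_eq_sum_range fun j => ext0 _ j * rad (ext0 c) j,
            ← Fin.sum_univ_eq_sum_range fun j => ext0 _ j * rad (ext0 c) j]
          simp only [ext0_val]
          obtain ⟨x, -, rfl⟩ := mem_image.1 hr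
          have h1 := hf x
          rw [pieceW, sum_rho] at h1
          simp only [filter_filter] at h1
          omega
      · rw [sum_const, hQ, smul_eq_mul, ← hcol i, colorClass,
          card_eq_sum_card_fiberwise (f := f) (t := univ.image f)
            (fun x _ => by simp)]
        refine sum_congr rfl fun r _ => ?_
        rw [filter_filter]
        congr 1
        ext x; simp [and_comm]
  exact (key i i rfl (f u) (mem_image_of_mem f (mem_univ u))).symm

theorem isFinal_of_card_color {c : Fin k → ℕ} {col : V → Fin k} {f : V → ι}
    (h : ∀ u i, #{x | f x = f u ∧ col x = i} = c i) :
    IsFinal (rho c col) (setvars c - 1) f := by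
  intro u
  rw [pieceW, sum_rho, ← sum_c_mul_rad c, Nat.add_sub_cancel]
  exact sum_congr rfl fun i _ => by rw [filter_filter, h]

theorem card_eq_of_card_color {c : Fin k → ℕ} {col : V → Fin k} {f : V → ι} {u : V}
    (h : ∀ i, #{x | f x = f u ∧ col x = i} = c i) : #{x | f x = f u} = setmax c := by
  rw [card_eq_sum_colors col, setmax]
  exact sum_congr rfl fun i _ => by rw [filter_filter, h]

/-- Replaces arbitrary labels by representatives, so that every labelling can be compared with those
by vertices. -/
theorem exists_rep {α β : Type*} (f : α → β) : ∃ g : α → α, ∀ u v, g u = g v ↔ f u = f v :=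
  ⟨fun u => (Quotient.mk (Setoid.ker f) u).out, fun u v => by
    rw [Quotient.out_inj, Quotient.eq]; rfl⟩

/-- A labelling with pieces of the right weight and with as many edges inside the pieces as
possible gives an optimal solution. -/
theorem isMinCostFair_of_isFinal {G : SimpleGraph V} (hG : G.IsAcyclic) {col : V → Fin k}
    {c : Fin k → ℕ} (hk : 2 ≤ k) (hc : ∀ i, 0 < c i) (hg : univ.gcd c = 1) {m : ℕ} (hm : 0 < m)
    (hcol : ∀ i, #(colorClass col i) = m * c i) {f : V → V}
    (hf : IsFinal (rho c col) (setvars c - 1) f)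
    (hmax : ∀ f' : V → V, IsFinal (rho c col) (setvars c - 1) f' → gain2 G f' ≤ gain2 G f)
    (P : Finpartition (univ : Finset V)) (hP : ∀ u v, P.part u = P.part v ↔ f u = f v) :
    IsMinCostFair G col P := by
  have hs : 1 < setvars c := by
    unfold setvars
    calc 1 < c ⟨0, by omega⟩ + 1 := Nat.lt_add_of_pos_left (hc _)
      _ ≤ _ := single_le_prod' (f := fun i => c i + 1) (fun _ _ => by omega) (mem_univ _)
  have hcc := card_color_of_isFinal hcol hs hf
  have hu : ∀ u, #{x | f x = f u} = setmax c := fun u => card_eq_of_card_color (hcc u)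
  refine ⟨(isFairPartition_iff hm hcol P f hP).2 fun u i => by rw [hcc, hu], fun Q hQ => ?_⟩
  classical
  -- The sets of `Q` are numbered because the splitting argument works with labels in `ℕ`.
  let e := Fintype.equivFin V
  obtain ⟨g, hg'⟩ := exists_rep Q.part
  have hg2 : ∀ u v, Q.part u = Q.part v ↔ (e (g u) : ℕ) = e (g v) := by
    intro u v
    rw [← hg', Fin.val_inj, e.injective.eq_iff]
  have hfair := (isFairPartition_iff hm hcol Q (fun u => (e (g u) : ℕ)) hg2).1 hQ
  obtain ⟨f1, h1, h2, h3⟩ := hfair.exists_uniform hG hk hc hg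
  have hd : 0 < setmax c := by
    unfold setmax
    exact sum_pos (fun i _ => hc i) ⟨⟨0, by omega⟩, mem_univ _⟩
  have h4 : ∀ u i, #{x | f1 x = f1 u ∧ col x = i} = c i := by
    intro u i
    have := h1 u i
    rw [h3] at this
    exact Nat.eq_of_mul_eq_mul_right hd this
  obtain ⟨f2, hf2⟩ := exists_rep f1
  have h6 : gain2 G f1 = gain2 G f2 := by simp only [gain2, hf2]
  have h7 : gain2 G f2 ≤ gain2 G f := hmax f2 (isFinal_of_card_color fun u i => by
    simp only [hf2]; exact h4 u i)
  have h8 := two_mul_ccCost G P f hP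
  have h9 := two_mul_ccCost G Q _ hg2
  rw [cost2_of_uniform G hu] at h8
  rw [cost2_of_uniform G h3] at h2
  have : (2 * ccCost G P : ℤ) ≤ 2 * ccCost G Q := by
    rw [h8, h9]
    have : (gain2 G f2 : ℤ) ≤ gain2 G f := by exact_mod_cast h7
    rw [h6] at h2
    linarith
  have h10 : 2 * ccCost G P ≤ 2 * ccCost G Q := by exact_mod_cast this
  omega

/-- The set of all vertices is fair, and splitting it repeatedly ends in minimal fair sets. This
ensures that the program finds some gluable entry. -/
theorem exists_isFinal {G : SimpleGraph V} (hG : G.IsAcyclic) {col : V → Fin k}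
    {c : Fin k → ℕ} (hk : 2 ≤ k) (hc : ∀ i, 0 < c i) (hg : univ.gcd c = 1) {m : ℕ}
    (hcol : ∀ i, #(colorClass col i) = m * c i) :
    ∃ f : V → V, IsFinal (rho c col) (setvars c - 1) f := by
  have hfair : FairLabel col c (fun _ : V => 0) := by
    intro u i
    have := hcol i
    unfold colorClass at this
    simp only [true_and, this]
    rw [card_eq_sum_colors col, setmax, mul_sum, mul_sum]
    refine sum_congr rfl fun j _ => ?_
    have := hcol j
    unfold colorClass at this
    rw [filter_filter]
    simp only [true_and, this]
    ring
  obtain ⟨f1, h1, -, h3⟩ := hfair.exists_uniform hG hk hc hg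
  have hd : 0 < setmax c := by
    unfold setmax
    exact sum_pos (fun i _ => hc i) ⟨⟨0, by omega⟩, mem_univ _⟩
  have h4 : ∀ u i, #{x | f1 x = f1 u ∧ col x = i} = c i := by
    intro u i
    have := h1 u i
    rw [h3] at this
    exact Nat.eq_of_mul_eq_mul_right hd this
  obtain ⟨f2, hf2⟩ := exists_rep f1
  exact ⟨f2, isFinal_of_card_color fun u i => by simp only [hf2]; exact h4 u i⟩

end Weight

/-! ### Encoding of multisets of weights by numbers -/

/-- The number that stands for a single piece of weight `t`. -/
def pw (n t : ℕ) : ℕ := if t = 0 then 0 else n ^ (t - 1)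

@[simp] theorem pw_zero (n : ℕ) : pw n 0 = 0 := rfl
theorem pw_succ (n t : ℕ) : pw n (t + 1) = n ^ t := rfl

theorem digits_lt {n : ℕ} {a : ℕ → ℕ} (ha : ∀ t, a t < n) (k : ℕ) :
    ∑ t ∈ range k, a t * n ^ t < n ^ k := by
  induction k with
  | zero => simp
  | succ k ih =>
    rw [sum_range_succ, pow_succ]
    have := Nat.mul_le_mul_right (n ^ k) (ha k)
    have h2 : (a k).succ * n ^ k = a k * n ^ k + n ^ k := Nat.succ_mul _ _
    have h3 : n ^ k * n = n * n ^ k := mul_comm _ _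
    omega

theorem digits_div_mod {n : ℕ} {a : ℕ → ℕ} (ha : ∀ t, a t < n) {k y : ℕ} (hy : y < k) :
    (∑ t ∈ range k, a t * n ^ t) / n ^ y % n = a y := by
  induction y generalizing k a with
  | zero =>
    obtain ⟨k, rfl⟩ := Nat.exists_eq_succ_of_ne_zero (by omega : k ≠ 0)
    rw [sum_range_succ']
    have : ∑ t ∈ range k, a (t + 1) * n ^ (t + 1) = n * ∑ t ∈ range k, a (t + 1) * n ^ t := by
      rw [mul_sum]
      exact sum_congr rfl fun t _ => by ring
    rw [this]
    simp [Nat.mod_eq_of_lt (ha 0)]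
  | succ y ih =>
    obtain ⟨k, rfl⟩ := Nat.exists_eq_succ_of_ne_zero (by omega : k ≠ 0)
    have hn : 0 < n := lt_of_le_of_lt (Nat.zero_le _) (ha 0)
    rw [sum_range_succ']
    have : ∑ t ∈ range k, a (t + 1) * n ^ (t + 1) = n * ∑ t ∈ range k, a (t + 1) * n ^ t := by
      rw [mul_sum]
      exact sum_congr rfl fun t _ => by ring
    rw [this, pow_succ', ← Nat.div_div_eq_div_mul]
    rw [pow_zero, mul_one, Nat.mul_add_div hn, Nat.div_eq_of_lt (ha 0), add_zero]
    exact ih (a := fun t => a (t + 1)) (fun t => ha _) (by omega)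

/-! ### Multiplicities as digits in base `n` -/

section Digits

variable {α : Type*} [DecidableEq α] {X : Finset α} {g : α → ℕ} {n s : ℕ}

/-- Labels that do not occur have weight 0 and contribute `pw n 0 = 0`, so sums over all labels may
be used as codes. -/
theorem sum_pw_eq (hg : ∀ r ∈ X, g r < s) (hs : 0 < s) :
    ∑ r ∈ X, pw n (g r) = ∑ t ∈ range (s - 1), #{r ∈ X | g r = t + 1} * n ^ t := by
  rw [← sum_fiberwise_of_maps_to (g := g) (t := range s) (fun r hr => mem_range.2 (hg r hr))]
  obtain ⟨s, rfl⟩ := Nat.exists_eq_succ_of_ne_zero hs.ne'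
  have h : ∀ t, ∑ r ∈ X with g r = t, pw n (g r) = #{r ∈ X | g r = t} * pw n t := by
    intro t
    rw [sum_congr rfl fun r hr => by rw [(mem_filter.1 hr).2], sum_const, smul_eq_mul]
  simp only [h]
  rw [sum_range_succ']
  simp [pw_succ]

theorem sum_pw_lt (hg : ∀ r ∈ X, g r < s) (hs : 0 < s) (hc : ∀ t, 0 < t → #{r ∈ X | g r = t} < n) :
    ∑ r ∈ X, pw n (g r) < n ^ (s - 1) := by
  rw [sum_pw_eq hg hs]
  exact digits_lt (a := fun t => #{r ∈ X | g r = t + 1}) (fun t => hc _ (by omega)) _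

theorem sum_pw_div_mod (hg : ∀ r ∈ X, g r < s) (hc : ∀ t, 0 < t → #{r ∈ X | g r = t} < n)
    {y : ℕ} (hy : 0 < y) (hys : y < s) :
    (∑ r ∈ X, pw n (g r)) / pw n y % n = #{r ∈ X | g r = y} := by
  rw [sum_pw_eq hg (by omega)]
  obtain ⟨y, rfl⟩ := Nat.exists_eq_succ_of_ne_zero hy.ne'
  exact digits_div_mod (a := fun t => #{r ∈ X | g r = t + 1}) (fun t => hc _ (by omega))
    (by omega)

end Digits

/-- Gluing two pieces increases the number that encodes the multiset of pieces. -/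
theorem lt_glue {n M x y : ℕ} (hn : 2 ≤ n) (hx : M / pw n x % n ≠ 0)
    (hy : (M - pw n x) / pw n y % n ≠ 0) :
    0 < x ∧ 0 < y ∧ pw n x + pw n y ≤ M ∧ M < M + pw n (x + y) - pw n x - pw n y := by
  -- For `x = 0` the test reads `M / 0 % n = 0`, so pieces of weight 0 exclude themselves.
  have hx0 : 0 < x := Nat.pos_of_ne_zero (by rintro rfl; simp at hx)
  have hy0 : 0 < y := Nat.pos_of_ne_zero (by rintro rfl; simp at hy)
  have h1 : pw n x ≤ M := by
    by_contra h
    rw [Nat.div_eq_of_lt (by omega)] at hx; simp at hx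
  have h2 : pw n y ≤ M - pw n x := by
    by_contra h
    rw [Nat.div_eq_of_lt (by omega)] at hy; simp at hy
  have key : pw n x + pw n y < pw n (x + y) := by
    obtain ⟨x, rfl⟩ := Nat.exists_eq_succ_of_ne_zero hx0.ne'
    obtain ⟨y, rfl⟩ := Nat.exists_eq_succ_of_ne_zero hy0.ne'
    have h3 : pw n (x.succ + y.succ) = n * (n ^ x * n ^ y) := by
      rw [show x.succ + y.succ = (x + y + 1) + 1 by omega, pw_succ]; ring
    rw [h3]
    change M / n ^ x % n ≠ 0 at hx
    change (M - n ^ x) / n ^ y % n ≠ 0 at hy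
    change n ^ x + n ^ y < _
    have ha : 1 ≤ n ^ x := Nat.one_le_pow _ _ (by omega)
    have hb : 1 ≤ n ^ y := Nat.one_le_pow _ _ (by omega)
    -- The product exceeds the sum except for `n = 2` and two pieces of weight 1, where both are 2.
    -- In this case the digit tests ask both `M` and `M - 1` to be odd.
    by_cases h4 : n = 2 ∧ n ^ x = 1 ∧ n ^ y = 1
    · obtain ⟨rfl, h5, h6⟩ := h4
      rw [h5] at hx hy
      rw [h6] at hy
      omega
    · have h5 : n ^ x + n ^ y ≤ 1 + n ^ x * n ^ y := by nlinarith
      have h6 : 1 ≤ n ^ x * n ^ y := Nat.mul_pos ha hb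
      by_cases h7 : n = 2
      · subst h7
        have h8 : 1 < 2 ^ x * 2 ^ y := by
          by_contra h9
          have h10 : 2 ^ x ≤ 2 ^ x * 2 ^ y := Nat.le_mul_of_pos_right _ hb
          have h11 : 2 ^ y ≤ 2 ^ x * 2 ^ y := Nat.le_mul_of_pos_left _ ha
          exact h4 ⟨rfl, by omega, by omega⟩
        omega
      · have : 3 * (n ^ x * n ^ y) ≤ n * (n ^ x * n ^ y) := Nat.mul_le_mul_right _ (by omega)
        omega
  omega

/-! ### Gluing pieces -/

/-- Replace `a` by `b`. -/
def rl {α : Type*} [DecidableEq α] (a b x : α) : α := if x = a then b else x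

/-- Instances of the packing problem: vertices with weights, to be packed into `m` sets of weight
`s - 1`. -/
structure Inst {n : ℕ} (s m : ℕ) (ρ : Fin n → ℕ) : Prop where
  pos : ∀ u, 0 < ρ u
  ne : ∃ u v, ρ u ≠ ρ v
  sum : ∑ u, ρ u = m * (s - 1)
  m_lt : m < n
  two_le : 2 ≤ s

section Glue

variable {n s m : ℕ} {ρ : Fin n → ℕ}

theorem Inst.two_le_n (h : Inst s m ρ) : 2 ≤ n := by
  obtain ⟨u, v, huv⟩ := h.ne
  have : u ≠ v := fun e => huv (by rw [e])
  have := u.2; have := v.2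
  have : (u : ℕ) ≠ v := fun e => ‹u ≠ v› (Fin.ext e)
  omega

/-- Number that encodes the multiset of the weights of all pieces. -/
def codeM (ρ : Fin n → ℕ) (f : Fin n → Fin n) : ℕ := ∑ r, pw n (pieceW ρ f r)

/-- There are only `n` labels. If all of them had the same positive weight `t`, then `f` would be
surjective, hence injective, and all vertices would weigh `t`, against `Inst.ne`. Therefore base `n`
suffices and no digit overflows. -/
theorem card_pieceW_lt (h : Inst s m ρ) (f : Fin n → Fin n) (X : Finset (Fin n)) {t : ℕ}
    (ht : 0 < t) : #{r ∈ X | pieceW ρ f r = t} < n := by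
  have hle : #{r ∈ X | pieceW ρ f r = t} ≤ #{r | pieceW ρ f r = t} :=
    card_le_card (filter_subset_filter _ (subset_univ X))
  refine lt_of_le_of_lt hle (lt_of_le_of_ne ?_ ?_)
  · exact (card_le_univ _).trans (by simp)
  · intro he
    have hall : ∀ r, pieceW ρ f r = t := by
      have : ({r | pieceW ρ f r = t} : Finset (Fin n)) = univ := by
        rw [← card_eq_iff_eq_univ, he]; simp
      intro r
      have := this ▸ mem_univ r
      simpa using this
    have hsurj : Function.Surjective f := by
      intro r
      by_contra hr
      push Not at hr
      have h1 := hall r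
      rw [pieceW, filter_false_of_mem (fun x _ => hr x)] at h1
      simp at h1
      omega
    have hinj := Finite.injective_iff_surjective.2 hsurj
    have hρ : ∀ u, ρ u = t := by
      intro u
      rw [← hall (f u), pieceW]
      have : ({x | f x = f u} : Finset (Fin n)) = {u} := by
        ext x; simp [hinj.eq_iff]
      rw [this, sum_singleton]
    obtain ⟨u, v, huv⟩ := h.ne
    exact huv (by rw [hρ, hρ])

theorem pieceW_pos (h : Inst s m ρ) (f : Fin n → Fin n) (u : Fin n) : 0 < pieceW ρ f (f u) :=
  sum_pos (fun x _ => h.pos x) ⟨u, by simp⟩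

theorem exists_of_pieceW_pos {f : Fin n → Fin n} {r : Fin n} (h : 0 < pieceW ρ f r) :
    ∃ u, f u = r := by
  by_contra hc
  push Not at hc
  rw [pieceW, filter_false_of_mem (fun x _ => hc x)] at h
  simp at h

variable (ρ) in
theorem pieceW_rl_right (f : Fin n → Fin n) {a b : Fin n} (hab : a ≠ b) :
    pieceW ρ (fun u => rl a b (f u)) b = pieceW ρ f a + pieceW ρ f b := by
  unfold pieceW
  rw [← sum_union]
  · congr 1
    ext x
    simp only [mem_filter, mem_univ, true_and, mem_union]
    unfold rl
    split <;> simp_all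
  · rw [disjoint_filter]
    rintro x - h1 h2
    exact hab (h1.symm.trans h2)

variable (ρ) in
theorem pieceW_rl_left (f : Fin n → Fin n) {a b : Fin n} (hab : a ≠ b) :
    pieceW ρ (fun u => rl a b (f u)) a = 0 := by
  unfold pieceW
  rw [filter_false_of_mem, sum_empty]
  intro x _
  change rl a b (f x) ≠ a
  unfold rl
  split <;> simp_all [Ne.symm]

variable (ρ) in
theorem pieceW_rl_of_ne (f : Fin n → Fin n) {a b r : Fin n} (ha : r ≠ a) (hb : r ≠ b) :
    pieceW ρ (fun u => rl a b (f u)) r = pieceW ρ f r := by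
  unfold pieceW
  congr 1
  ext x
  simp only [mem_filter, mem_univ, true_and]
  unfold rl
  split
  · rename_i h
    simp [h, hb.symm, ha.symm]
  · rfl

theorem codeM_rl (f : Fin n → Fin n) {a b : Fin n} (hab : a ≠ b) :
    codeM ρ (fun u => rl a b (f u)) + pw n (pieceW ρ f a) + pw n (pieceW ρ f b)
      = codeM ρ f + pw n (pieceW ρ f a + pieceW ρ f b) := by
  unfold codeM
  have hb : b ∈ univ.erase a := by simp [hab.symm]
  rw [← add_sum_erase univ _ (mem_univ a), ← add_sum_erase univ (fun r => pw n (pieceW ρ f r))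
    (mem_univ a), ← add_sum_erase _ _ hb, ← add_sum_erase _ (fun r => pw n (pieceW ρ f r)) hb,
    pieceW_rl_left ρ f hab, pieceW_rl_right ρ f hab,
    sum_congr rfl fun r hr => by
      rw [pieceW_rl_of_ne ρ f (ne_of_mem_erase (mem_of_mem_erase hr)) (ne_of_mem_erase hr)]]
  simp only [pw_zero]
  omega

theorem pieceW_lt_rl {f : Fin n → Fin n} (hf : ∀ r, pieceW ρ f r < s) {a b : Fin n} (hab : a ≠ b)
    (h : pieceW ρ f a + pieceW ρ f b < s) (r : Fin n) :
    pieceW ρ (fun u => rl a b (f u)) r < s := by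
  by_cases ha : r = a
  · subst ha; rw [pieceW_rl_left ρ f hab]; omega
  · by_cases hb : r = b
    · subst hb; rwa [pieceW_rl_right ρ f hab]
    · rw [pieceW_rl_of_ne ρ f ha hb]; exact hf r

/-- `f` is finer than `g`. -/
def Finer (f g : Fin n → Fin n) : Prop := ∀ u v, f u = f v → g u = g v

theorem Finer.trans {f g h : Fin n → Fin n} (h1 : Finer f g) (h2 : Finer g h) : Finer f h :=
  fun u v huv => h2 u v (h1 u v huv)

theorem finer_rl (f : Fin n → Fin n) (a b : Fin n) : Finer f fun u => rl a b (f u) :=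
  fun u v h => by simp only [h]

theorem finer_rl_of {f g : Fin n → Fin n} (h : Finer f g) {u v : Fin n} (huv : g u = g v) :
    Finer (fun x => rl (f u) (f v) (f x)) g := by
  have key : ∀ x, ∃ y, rl (f u) (f v) (f x) = f y ∧ g x = g y := by
    intro x
    unfold rl
    split
    · rename_i hx
      exact ⟨v, rfl, (h x u hx).trans huv⟩
    · exact ⟨x, rfl, rfl⟩
  intro x y hxy
  obtain ⟨x', hx1, hx2⟩ := key x
  obtain ⟨y', hy1, hy2⟩ := key y
  rw [hx2, hy2]
  exact h _ _ (hx1.symm.trans (hxy.trans hy1))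

theorem pieceW_le_of_finer {f g : Fin n → Fin n} (h : Finer f g) (u : Fin n) :
    pieceW ρ f (f u) ≤ pieceW ρ g (g u) :=
  sum_le_sum_of_subset fun x hx => by
    simp only [mem_filter, mem_univ, true_and] at hx ⊢
    exact h _ _ hx

theorem pieceW_lt_of_finer (hI : Inst s m ρ) {f g : Fin n → Fin n} (h : Finer f g)
    (hg : IsFinal ρ (s - 1) g) (r : Fin n) : pieceW ρ f r < s := by
  have hs := hI.two_le
  rcases Nat.eq_zero_or_pos (pieceW ρ f r) with h0 | h0
  · omega
  · obtain ⟨u, rfl⟩ := exists_of_pieceW_pos h0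
    have := pieceW_le_of_finer (ρ := ρ) h u
    rw [hg u] at this
    omega

/-- `R` decides which multisets of weights can be glued to pieces of weight `s - 1`, by
recursion. -/
structure GlueTable (n s m : ℕ) (R : ℕ → Prop) : Prop where
  iff : ∀ M, M < n ^ (s - 1) → (R M ↔ M = m * pw n (s - 1) ∨ ∃ x y, x + y < s ∧
    M / pw n x % n ≠ 0 ∧ (M - pw n x) / pw n y % n ≠ 0 ∧ R (M + pw n (x + y) - pw n x - pw n y))

theorem codeM_lt (hI : Inst s m ρ) {f : Fin n → Fin n} (hf : ∀ r, pieceW ρ f r < s) :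
    codeM ρ f < n ^ (s - 1) :=
  sum_pw_lt (fun r _ => hf r) (by have := hI.two_le; omega) fun _ ht => card_pieceW_lt hI f _ ht

/-- The code `m * n ^ (s - 2)` has the digit 0 at all lower places, so no piece of positive weight
below `s - 1` exists. -/
theorem isFinal_of_codeM (hI : Inst s m ρ) {f : Fin n → Fin n} (hf : ∀ r, pieceW ρ f r < s)
    (h : codeM ρ f = m * pw n (s - 1)) : IsFinal ρ (s - 1) f := by
  intro u
  by_contra hne
  have hpos := pieceW_pos hI f u
  have hlt := hf (f u)
  have hn := hI.two_le_n
  have h1 := sum_pw_div_mod (n := n) (X := univ) (fun r _ => hf r)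
    (fun _ ht => card_pieceW_lt hI f _ ht) hpos hlt
  have h2 : 0 < #{r | pieceW ρ f r = pieceW ρ f (f u)} := card_pos.2 ⟨f u, by simp⟩
  unfold codeM at h
  rw [h] at h1
  obtain ⟨t, ht⟩ := Nat.exists_eq_succ_of_ne_zero hpos.ne'
  obtain ⟨j, hj⟩ : ∃ j, s - 1 = t + 1 + j + 1 := ⟨s - 1 - t - 2, by omega⟩
  rw [ht, hj] at h1
  have h3 : m * pw n (t + 1 + j + 1) = n ^ t * (n * (m * n ^ j)) := by
    rw [pw_succ]; ring
  rw [h3, show t.succ = t + 1 from rfl, pw_succ, Nat.mul_div_cancel_left _ (pow_pos (by omega) _),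
    Nat.mul_mod_right] at h1
  rw [ht] at h2
  change 0 < #{r | pieceW ρ f r = t + 1} at h2
  omega

theorem codeM_of_isFinal (hI : Inst s m ρ) {f : Fin n → Fin n} (h : IsFinal ρ (s - 1) f) :
    codeM ρ f = m * pw n (s - 1) := by
  have h1 := sum_pieceW_image ρ f
  have hr : ∀ r ∈ univ.image f, pieceW ρ f r = s - 1 := by
    intro r hr
    obtain ⟨x, -, rfl⟩ := mem_image.1 hr
    exact h x
  rw [hI.sum, sum_congr rfl hr, sum_const, smul_eq_mul] at h1
  have h2 := Nat.eq_of_mul_eq_mul_right (by have := hI.two_le; omega) h1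
  unfold codeM
  rw [← h2, ← smul_eq_mul, ← sum_const]
  rw [← sum_subset (subset_univ (univ.image f))]
  · exact sum_congr rfl fun r hr' => by rw [hr r hr']
  · intro r _ hr'
    have : pieceW ρ f r = 0 := by
      by_contra h0
      obtain ⟨u, rfl⟩ := exists_of_pieceW_pos (Nat.pos_of_ne_zero h0)
      exact hr' (mem_image_of_mem f (mem_univ u))
    rw [this, pw_zero]

/-- Soundness of the table. Non-zero digits yield actual pieces `a` and `b'` of the weights `x` and
`y`; the second digit is read after removal of the first piece, so the two are different even if `x
= y`. Gluing them raises the code, which stays below `n ^ (s - 1)`, and the recursion ends. -/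
theorem GlueTable.exists_isFinal {R : ℕ → Prop} (hR : GlueTable n s m R) (hI : Inst s m ρ)
    {f : Fin n → Fin n} (hf : ∀ r, pieceW ρ f r < s) (h : R (codeM ρ f)) :
    ∃ g, IsFinal ρ (s - 1) g ∧ Finer f g := by
  induction hb : n ^ (s - 1) - codeM ρ f using Nat.strong_induction_on generalizing f with
  | _ b ih =>
    have hlt := codeM_lt hI hf
    rcases (hR.iff _ hlt).1 h with h1 | ⟨x, y, hxy, hx, hy, hRxy⟩
    · exact ⟨f, isFinal_of_codeM hI hf h1, fun _ _ h => h⟩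
    · obtain ⟨hx0, hy0, hle, hgt⟩ := lt_glue hI.two_le_n hx hy
      have e1 : codeM ρ f / pw n x % n = #{r | pieceW ρ f r = x} :=
        sum_pw_div_mod (n := n) (X := univ) (fun r _ => hf r)
          (fun _ ht => card_pieceW_lt hI f _ ht) hx0 (by omega)
      obtain ⟨a, ha⟩ := card_pos.1 (Nat.pos_of_ne_zero (e1 ▸ hx))
      have hax : pieceW ρ f a = x := by simpa using ha
      have e2 : codeM ρ f - pw n x = ∑ r ∈ univ.erase a, pw n (pieceW ρ f r) := by
        unfold codeM
        rw [← add_sum_erase univ _ (mem_univ a), hax, Nat.add_sub_cancel_left]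
      have e3 := sum_pw_div_mod (n := n) (X := univ.erase a) (fun r _ => hf r)
          (fun _ ht => card_pieceW_lt hI f _ ht) hy0 (by omega : y < s)
      rw [← e2] at e3
      obtain ⟨b', hb'⟩ := card_pos.1 (Nat.pos_of_ne_zero (e3 ▸ hy))
      simp only [mem_filter, mem_erase, mem_univ, and_true] at hb'
      obtain ⟨hba, hby⟩ := hb'
      have e4 := codeM_rl (ρ := ρ) f hba.symm
      rw [hax, hby] at e4
      have e5 : codeM ρ (fun u => rl a b' (f u))
          = codeM ρ f + pw n (x + y) - pw n x - pw n y := by omega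
      have hf' := pieceW_lt_rl hf hba.symm (by rw [hax, hby]; exact hxy)
      have hlt' := codeM_lt hI hf'
      obtain ⟨g, hg1, hg2⟩ := ih _ (by omega) hf' (by rw [e5]; exact hRxy) rfl
      exact ⟨g, hg1, (finer_rl f a b').trans hg2⟩

/-- Completeness of the table. If `f` is not final, some set of `g` contains two pieces of `f`;
gluing them gives a labelling that is still finer than `g` and has a larger code. -/
theorem GlueTable.of_isFinal {R : ℕ → Prop} (hR : GlueTable n s m R) (hI : Inst s m ρ)
    {f g : Fin n → Fin n} (hg : IsFinal ρ (s - 1) g) (hfg : Finer f g) : R (codeM ρ f) := by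
  have hf := pieceW_lt_of_finer hI hfg hg
  induction hb : n ^ (s - 1) - codeM ρ f using Nat.strong_induction_on generalizing f with
  | _ b ih =>
    have hlt := codeM_lt hI hf
    rw [hR.iff _ hlt]
    by_cases hfin : IsFinal ρ (s - 1) f
    · exact .inl (codeM_of_isFinal hI hfin)
    · right
      unfold IsFinal at hfin
      push Not at hfin
      obtain ⟨u, hu⟩ := hfin
      obtain ⟨v, hv1, hv2⟩ : ∃ v, g v = g u ∧ f v ≠ f u := by
        by_contra hc
        push Not at hc
        apply hu
        rw [← hg u]
        unfold pieceW
        congr 1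
        ext x
        simp only [mem_filter, mem_univ, true_and]
        exact ⟨fun h => hfg _ _ h, fun h => hc x h⟩
      have hfin' := finer_rl_of hfg hv1
      have hf' := pieceW_lt_of_finer hI hfin' hg
      have hxy := hf' (f u)
      rw [pieceW_rl_right ρ f hv2] at hxy
      have hx0 := pieceW_pos hI f v
      have hy0 := pieceW_pos hI f u
      have e1 : codeM ρ f / pw n (pieceW ρ f (f v)) % n = #{r | pieceW ρ f r = pieceW ρ f (f v)} :=
        sum_pw_div_mod (n := n) (X := univ) (fun r _ => hf r)
          (fun _ ht => card_pieceW_lt hI f _ ht) hx0 (by omega)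
      have e2 : codeM ρ f - pw n (pieceW ρ f (f v))
          = ∑ r ∈ univ.erase (f v), pw n (pieceW ρ f r) := by
        unfold codeM
        rw [← add_sum_erase univ _ (mem_univ (f v)), Nat.add_sub_cancel_left]
      have e3 := sum_pw_div_mod (n := n) (X := univ.erase (f v)) (fun r _ => hf r)
          (fun _ ht => card_pieceW_lt hI f _ ht) hy0 (by omega)
      rw [← e2] at e3
      have hx : codeM ρ f / pw n (pieceW ρ f (f v)) % n ≠ 0 := by
        rw [e1]
        exact (card_pos.2 ⟨f v, by simp⟩).ne'
      have hy : (codeM ρ f - pw n (pieceW ρ f (f v))) / pw n (pieceW ρ f (f u)) % n ≠ 0 := by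
        rw [e3]
        exact (card_pos.2 ⟨f u, by simp [hv2.symm]⟩).ne'
      obtain ⟨-, -, hle, hgt⟩ := lt_glue hI.two_le_n hx hy
      have e4 := codeM_rl (ρ := ρ) f hv2
      have e5 : codeM ρ (fun x => rl (f v) (f u) (f x)) = codeM ρ f +
          pw n (pieceW ρ f (f v) + pieceW ρ f (f u)) - pw n (pieceW ρ f (f v))
          - pw n (pieceW ρ f (f u)) := by omega
      have hlt' := codeM_lt hI hf'
      refine ⟨_, _, hxy, hx, hy, ?_⟩
      rw [← e5]
      exact ih _ (by omega) hfin' hf' rfl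

end Glue

/-! ### The dynamic program -/

section Blob

variable {n s m : ℕ} {ρ : Fin n → ℕ} {G : SimpleGraph (Fin n)}

/-- Twice the number of edges inside the pieces of the blob of `w`. -/
noncomputable def gainB (G : SimpleGraph (Fin n)) (β f : Fin n → Fin n) (w : Fin n) : ℕ :=
  ∑ x, ∑ y, if β x = w ∧ f x = f y then adj01 G x y else 0

/-- Multiset of the weights of the pieces of the blob of `w` that do not contain `w`. -/
def closedM (ρ : Fin n → ℕ) (β f : Fin n → Fin n) (w : Fin n) : ℕ :=
  ∑ r, if β r = w ∧ r ≠ w then pw n (pieceW ρ f r) else 0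

/-- Code of the configuration `f` on the blob of `w`. -/
noncomputable def blobCode (G : SimpleGraph (Fin n)) (s : ℕ) (ρ : Fin n → ℕ) (β f : Fin n → Fin n)
    (w : Fin n) : ℕ :=
  gainB G β f w + 2 * n * (pieceW ρ f w + s * closedM ρ β f w)

/-- `f` describes pieces that respect the blobs `β`. -/
structure Conf (s : ℕ) (ρ : Fin n → ℕ) (β f : Fin n → Fin n) : Prop where
  lab : ∀ u, β (f u) = β u
  root : ∀ w, β w = w → f w = w
  lt : ∀ r, pieceW ρ f r < s

/-- Edges between different blobs join representatives. -/
def Crossing (G : SimpleGraph (Fin n)) (β : Fin n → Fin n) : Prop :=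
  ∀ x y, G.Adj x y → β x ≠ β y → β x = x ∧ β y = y

/-- The blob of `v` can be merged into the blob of `p`. -/
structure Elim (G : SimpleGraph (Fin n)) (β : Fin n → Fin n) (v p : Fin n) : Prop where
  left : β v = v
  right : β p = p
  ne : v ≠ p
  adj : ∀ w, β w = w → w ≠ p → ¬ G.Adj v w

/-- Code of the configuration in which the root piece with code `a` is closed. -/
def cutCode (n s a b : ℕ) : ℕ :=
  a + b + 2 * n * (s * pw n (a / (2 * n) % s)) - 2 * n * (a / (2 * n) % s)

/-- Twice the number of edges of the forest is at most `2 * n - 2`, so the gain is a digit in base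
`2 * n`. -/
theorem gainB_lt (hI : Inst s m ρ) (hG : G.IsAcyclic) (β f : Fin n → Fin n) (w : Fin n) :
    gainB G β f w < 2 * n := by
  have hn := hI.two_le_n
  have h := e2_self_le hG (X := univ) ⟨⟨0, by omega⟩, mem_univ _⟩
  have h2 : gainB G β f w ≤ e2 G univ univ :=
    sum_le_sum fun x _ => sum_le_sum fun y _ => by split <;> simp
  simp only [card_univ, Fintype.card_fin] at h
  omega

theorem closedM_lt (hI : Inst s m ρ) {β f : Fin n → Fin n} (hf : ∀ r, pieceW ρ f r < s)
    (w : Fin n) : closedM ρ β f w < n ^ (s - 1) :=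
  lt_of_le_of_lt (sum_le_sum fun r _ => by split <;> simp) (codeM_lt hI hf)

theorem decode_lt {n s N g h M : ℕ} (hg : g < 2 * n) (hh : h < s) (hM : M < N) :
    g + 2 * n * (h + s * M) < 2 * n * s * N := by
  have h1 : h + s * M < s * N := by
    have := Nat.mul_le_mul_left s (show M + 1 ≤ N from hM)
    have h3 : s * (M + 1) = s * M + s := by ring
    omega
  have h2 := Nat.mul_le_mul_left (2 * n) (show h + s * M + 1 ≤ s * N from h1)
  have h3 : 2 * n * (h + s * M + 1) = 2 * n * (h + s * M) + 2 * n := by ring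
  have h4 : 2 * n * s * N = 2 * n * (s * N) := by ring
  omega

theorem decode_mod {n s g h M : ℕ} (hg : g < 2 * n) : (g + 2 * n * (h + s * M)) % (2 * n) = g := by
  rw [Nat.add_mul_mod_self_left, Nat.mod_eq_of_lt hg]

theorem decode_div {n s g h M : ℕ} (hg : g < 2 * n) :
    (g + 2 * n * (h + s * M)) / (2 * n) = h + s * M := by
  rw [Nat.add_mul_div_left _ _ (by omega), Nat.div_eq_of_lt hg, zero_add]

theorem decode_div_mod {n s g h M : ℕ} (hg : g < 2 * n) (hh : h < s) :
    (g + 2 * n * (h + s * M)) / (2 * n) % s = h := by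
  rw [decode_div hg, Nat.add_mul_mod_self_left, Nat.mod_eq_of_lt hh]

theorem decode_div_div {n s g h M : ℕ} (hg : g < 2 * n) (hh : h < s) :
    (g + 2 * n * (h + s * M)) / (2 * n) / s = M := by
  rw [decode_div hg, Nat.add_mul_div_left _ _ (by omega), Nat.div_eq_of_lt hh, zero_add]

theorem blobCode_lt (hI : Inst s m ρ) (hG : G.IsAcyclic) {β f : Fin n → Fin n}
    (hf : ∀ r, pieceW ρ f r < s) (w : Fin n) :
    blobCode G s ρ β f w < 2 * n * s * n ^ (s - 1) :=
  decode_lt (gainB_lt hI hG _ _ _) (hf _) (closedM_lt hI hf _)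

theorem blobCode_weight (hI : Inst s m ρ) (hG : G.IsAcyclic) {β f : Fin n → Fin n}
    (hf : ∀ r, pieceW ρ f r < s) (w : Fin n) :
    blobCode G s ρ β f w / (2 * n) % s = pieceW ρ f w :=
  decode_div_mod (gainB_lt hI hG _ _ _) (hf _)

/-- The weight `h` is removed from its place and enters the multiset as `pw n h`. The subtraction
comes last and hence is not truncated. -/
theorem cutCode_eq {n s g h M b : ℕ} (hg : g < 2 * n) (hh : h < s) :
    cutCode n s (g + 2 * n * (h + s * M)) b = g + b + 2 * n * (s * (M + pw n h)) := by
  unfold cutCode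
  rw [decode_div_mod hg hh]
  rw [Nat.sub_eq_of_eq_add]
  ring

/-! ### The effect of one merge on configurations and codes -/

section Merge

variable {β : Fin n → Fin n} {v p : Fin n}

/-- Only `v` stops being a representative, so only edges at `v` matter. Those that leave its blob
end in representatives, hence in `p` by `Elim.adj`, and lie inside the merged blob. -/
theorem Crossing.merge (hc : Crossing G β) (he : Elim G β v p) :
    Crossing G fun u => rl v p (β u) := by
  have key : ∀ x y, G.Adj x y → rl v p (β x) ≠ rl v p (β y) → rl v p (β x) = x := by
    intro x y hxy hne
    have h1 : β x ≠ β y := fun h => hne (by rw [h])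
    obtain ⟨hx, hy⟩ := hc x y hxy h1
    rw [hx]
    unfold rl
    rw [if_neg]
    rintro rfl
    by_cases hyp : y = p
    · subst hyp
      rw [hx, he.right] at hne
      apply hne
      simp [rl, he.ne.symm]
    · exact he.adj y hy hyp hxy
  intro x y hxy hne
  exact ⟨key x y hxy hne, key y x hxy.symm hne.symm⟩

theorem merge_alive (he : Elim G β v p) {w : Fin n} :
    rl v p (β w) = w ↔ β w = w ∧ w ≠ v := by
  unfold rl
  split
  · rename_i h
    constructor
    · rintro rfl
      exact absurd (h.symm.trans he.right) he.ne
    · rintro ⟨h1, h2⟩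
      exact absurd (h1.symm.trans h) h2
  · rename_i h
    exact ⟨fun h1 => ⟨h1, fun h2 => h (h1.trans h2)⟩, fun h1 => h1.1⟩

theorem merge_eq_right {x : Fin n} : rl v p (β x) = p ↔ β x = v ∨ β x = p := by
  unfold rl; split <;> simp_all

theorem merge_eq_of_ne {x w : Fin n} (hv : w ≠ v) (hp : w ≠ p) :
    rl v p (β x) = w ↔ β x = w := by
  unfold rl; split <;> simp_all [Ne.symm]

theorem Conf.cut {f : Fin n → Fin n} (hf : Conf s ρ β f) (he : Elim G β v p) :
    Conf s ρ (fun u => rl v p (β u)) f :=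
  ⟨fun u => by simp only [hf.lab], fun w hw => hf.root w ((merge_alive he).1 hw).1, hf.lt⟩

theorem Conf.keep {f : Fin n → Fin n} (hf : Conf s ρ β f) (he : Elim G β v p)
    (h : pieceW ρ f v + pieceW ρ f p < s) :
    Conf s ρ (fun u => rl v p (β u)) (fun u => rl v p (f u)) := by
  refine ⟨fun u => ?_, fun w hw => ?_, pieceW_lt_rl hf.lt he.ne h⟩
  · rw [← hf.lab u]
    have : ∀ z, rl v p (β (rl v p z)) = rl v p (β z) := by
      intro z
      by_cases hz : z = v
      · subst hz
        simp [rl, he.left, he.right]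
      · simp [rl, hz]
    exact this _
  · obtain ⟨h1, h2⟩ := (merge_alive he).1 hw
    simp [hf.root w h1, rl, h2]

/-- No piece changes. The gains and the closed pieces of both blobs are collected at `p`, and the
piece of `v` becomes a closed piece since `v` is no longer a representative. -/
theorem blobCode_cut_right (hI : Inst s m ρ) (hG : G.IsAcyclic) {f : Fin n → Fin n}
    (hf : Conf s ρ β f) (he : Elim G β v p) :
    blobCode G s ρ (fun u => rl v p (β u)) f p
      = cutCode n s (blobCode G s ρ β f v) (blobCode G s ρ β f p) := by
  have h1 : gainB G (fun u => rl v p (β u)) f p = gainB G β f v + gainB G β f p := by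
    unfold gainB
    rw [← sum_add_distrib]
    refine sum_congr rfl fun x _ => ?_
    rw [← sum_add_distrib]
    refine sum_congr rfl fun y _ => ?_
    simp only [merge_eq_right]
    by_cases h1 : β x = v
    · simp [h1, he.ne]
    · simp [h1]
  have h2 : closedM ρ (fun u => rl v p (β u)) f p
      = closedM ρ β f v + pw n (pieceW ρ f v) + closedM ρ β f p := by
    have h3 : pw n (pieceW ρ f v) = ∑ r, if r = v then pw n (pieceW ρ f r) else 0 := by simp
    unfold closedM
    rw [h3, ← sum_add_distrib, ← sum_add_distrib]
    refine sum_congr rfl fun r _ => ?_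
    simp only [merge_eq_right]
    by_cases h1 : r = v
    · subst h1
      simp [he.left, he.ne]
    · by_cases h2 : r = p
      · subst h2
        simp [he.right, he.ne.symm]
      · by_cases h4 : β r = v
        · simp [h4, he.ne, h1, h2]
        · simp [h4, h1, h2]
  unfold blobCode
  rw [cutCode_eq (gainB_lt hI hG _ _ _) (hf.lt v), h1, h2]
  ring

theorem blobCode_cut_of_ne {f : Fin n → Fin n} {w : Fin n} (hv : w ≠ v) (hp : w ≠ p) :
    blobCode G s ρ (fun u => rl v p (β u)) f w = blobCode G s ρ β f w := by
  simp only [blobCode, gainB, closedM, merge_eq_of_ne hv hp]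

theorem blobCode_keep_of_ne {f : Fin n → Fin n} (hf : Conf s ρ β f) (he : Elim G β v p)
    {w : Fin n} (hv : w ≠ v) (hp : w ≠ p) :
    blobCode G s ρ (fun u => rl v p (β u)) (fun u => rl v p (f u)) w = blobCode G s ρ β f w := by
  have h1 : gainB G (fun u => rl v p (β u)) (fun u => rl v p (f u)) w = gainB G β f w := by
    unfold gainB
    simp only [merge_eq_of_ne hv hp]
    refine sum_congr rfl fun x _ => sum_congr rfl fun y _ => ?_
    by_cases hx : β x = w
    · have hxv : f x ≠ v := fun h => hv (by rw [← hx, ← hf.lab x, h, he.left])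
      have hxp : f x ≠ p := fun h => hp (by rw [← hx, ← hf.lab x, h, he.right])
      have : rl v p (f x) = rl v p (f y) ↔ f x = f y := by
        rw [eq_comm, rl, rl, if_neg hxv]
        split
        · rename_i h
          simp [h, hxv, hxp.symm]
        · exact eq_comm
      simp only [this]
    · simp [hx]
  have h2 : closedM ρ (fun u => rl v p (β u)) (fun u => rl v p (f u)) w = closedM ρ β f w := by
    unfold closedM
    simp only [merge_eq_of_ne hv hp]
    refine sum_congr rfl fun r _ => ?_
    by_cases hr : β r = w
    · have hrv : r ≠ v := fun h => hv (by rw [← hr, h, he.left])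
      have hrp : r ≠ p := fun h => hp (by rw [← hr, h, he.right])
      rw [pieceW_rl_of_ne ρ f hrv hrp]
    · simp [hr]
  unfold blobCode
  rw [h1, h2, pieceW_rl_of_ne ρ f hv hp]

/-- An edge between the pieces of `v` and `p` joins different blobs, hence two representatives, so
it can only be the edge `v p`; it counts as two ordered pairs. The weights of the two pieces add,
the closed pieces are united, and so the codes themselves add. If `v` and `p` are not adjacent the
union is allowed too and gains nothing. -/
theorem blobCode_keep_right {f : Fin n → Fin n} (hc : Crossing G β)
    (hf : Conf s ρ β f) (he : Elim G β v p) :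
    blobCode G s ρ (fun u => rl v p (β u)) (fun u => rl v p (f u)) p
      = blobCode G s ρ β f v + blobCode G s ρ β f p + 2 * adj01 G v p := by
  have h1 : gainB G (fun u => rl v p (β u)) (fun u => rl v p (f u)) p
      = gainB G β f v + gainB G β f p + 2 * adj01 G v p := by
    have h2 : 2 * adj01 G v p = ∑ x, ∑ y,
        ((if x = v then if y = p then adj01 G x y else 0 else 0) +
        (if x = p then if y = v then adj01 G x y else 0 else 0)) := by
      have e : ∀ a b : Fin n, ∑ x, ∑ y, (if x = a then if y = b then adj01 G x y else 0 else 0)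
          = adj01 G a b := by
        intro a b
        have : ∀ x, ∑ y, (if x = a then if y = b then adj01 G x y else 0 else 0)
            = if x = a then adj01 G x b else 0 := by
          intro x
          split <;> simp
        simp [this]
      simp only [sum_add_distrib, e, adj01_comm G p v]
      ring
    unfold gainB
    rw [h2, ← sum_add_distrib, ← sum_add_distrib]
    refine sum_congr rfl fun x _ => ?_
    rw [← sum_add_distrib, ← sum_add_distrib]
    refine sum_congr rfl fun y _ => ?_
    simp only [merge_eq_right]
    by_cases hxy : G.Adj x y
    swap
    · have : adj01 G x y = 0 := adj01_eq_zero.2 hxy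
      simp [this]
    have hv := hf.root v he.left
    have hp := hf.root p he.right
    have hne := he.ne
    by_cases hl : f x = f y
    · have e1 : ¬ (x = v ∧ y = p) := by
        rintro ⟨rfl, rfl⟩; exact hne (by rw [← hv, hl, hp])
      have e2 : ¬ (x = p ∧ y = v) := by
        rintro ⟨rfl, rfl⟩; exact hne (by rw [← hv, ← hl, hp])
      have e3 : (if x = v then if y = p then adj01 G x y else 0 else 0) = 0 := by
        split
        · rw [if_neg fun h => e1 ⟨‹_›, h⟩]
        · rfl
      have e4 : (if x = p then if y = v then adj01 G x y else 0 else 0) = 0 := by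
        split
        · rw [if_neg fun h => e2 ⟨‹_›, h⟩]
        · rfl
      rw [e3, e4]
      simp only [hl, and_true, add_zero]
      by_cases h3 : β x = v
      · simp [h3, hne]
      · simp [h3]
    · have hside : ∀ a b : Fin n, (f a = v ∧ f b = p) → G.Adj a b → a = v ∧ b = p := by
        rintro a b ⟨ha, hb⟩ hab
        have h3 : β a = v := by rw [← hf.lab a, ha, he.left]
        have h4 : β b = p := by rw [← hf.lab b, hb, he.right]
        obtain ⟨h5, h6⟩ := hc a b hab (by rw [h3, h4]; exact hne)
        exact ⟨h5.symm.trans h3, h6.symm.trans h4⟩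
      have e1 : rl v p (f x) = rl v p (f y) ↔ (x = v ∧ y = p) ∨ (x = p ∧ y = v) := by
        constructor
        · intro h
          unfold rl at h
          split at h <;> split at h
          · rename_i h3 h4; exact absurd (h3.trans h4.symm) hl
          · rename_i h3 h4
            exact .inl (hside x y ⟨h3, h.symm⟩ hxy)
          · rename_i h3 h4
            exact .inr (hside y x ⟨h4, h⟩ hxy.symm).symm
          · exact absurd h hl
        · rintro (⟨rfl, rfl⟩ | ⟨rfl, rfl⟩) <;> simp [rl, hv, hp]
      simp only [e1, hl, and_false, if_false, zero_add]
      by_cases h3 : x = v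
      · subst h3
        simp [he.left, hne]
      · by_cases h4 : x = p
        · subst h4
          simp [he.right, h3]
        · simp [h3, h4]
  have h2 : closedM ρ (fun u => rl v p (β u)) (fun u => rl v p (f u)) p
      = closedM ρ β f v + closedM ρ β f p := by
    unfold closedM
    rw [← sum_add_distrib]
    refine sum_congr rfl fun r _ => ?_
    simp only [merge_eq_right]
    by_cases h1 : r = v
    · subst h1
      simp [he.left, he.ne, pieceW_rl_left ρ f he.ne]
    · by_cases h2 : r = p
      · subst h2
        simp [he.right, he.ne.symm]
      · rw [pieceW_rl_of_ne ρ f h1 h2]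
        by_cases h4 : β r = v
        · simp [h4, he.ne, h1, h2]
        · simp [h4, h1, h2]
  unfold blobCode
  rw [h1, h2, pieceW_rl_right ρ f he.ne]
  ring

end Merge

/-- Specification of the table `T` for the merge of blobs with tables `Ta` and `Tb`. Non-zero
entries point to the entries from which they arise. -/
structure Merged (n s L e : ℕ) (Ta Tb T : ℕ → ℕ) : Prop where
  sound : ∀ x < L, T x ≠ 0 → ∃ a < L, ∃ b < L, Ta a ≠ 0 ∧ Tb b ≠ 0 ∧
    ((T x = 1 + 2 * (a * L + b) ∧ a / (2 * n) % s + b / (2 * n) % s < s ∧ x = a + b + 2 * e) ∨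
      (T x = 2 + 2 * (a * L + b) ∧ x = cutCode n s a b))
  keep : ∀ a < L, ∀ b < L, Ta a ≠ 0 → Tb b ≠ 0 → a / (2 * n) % s + b / (2 * n) % s < s →
    a + b + 2 * e < L → T (a + b + 2 * e) ≠ 0
  cut : ∀ a < L, ∀ b < L, Ta a ≠ 0 → Tb b ≠ 0 → cutCode n s a b < L → T (cutCode n s a b) ≠ 0

/-- Blob representatives after `i` merges. -/
def blob (vs ps : ℕ → Fin n) : ℕ → Fin n → Fin n
  | 0, u => u
  | i + 1, u => rl (vs i) (ps i) (blob vs ps i u)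

/-- Number of the table of a blob after `i` merges. -/
def cur (ps : ℕ → Fin n) : ℕ → Fin n → ℕ
  | 0, u => u
  | i + 1, u => if u = ps i then n + i else cur ps i u

/-- Specification of the tables `TB 0, TB 1, …` after `k` merges. -/
structure Tables (G : SimpleGraph (Fin n)) (s : ℕ) (ρ : Fin n → ℕ) (vs ps : ℕ → Fin n)
    (TB : ℕ → ℕ → ℕ) (k : ℕ) : Prop where
  init : ∀ v : Fin n, ∀ x < 2 * n * s * n ^ (s - 1), TB v x ≠ 0 ↔ x = 2 * n * ρ v
  elim : ∀ i < k, Elim G (blob vs ps i) (vs i) (ps i)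
  merged : ∀ i < k, Merged n s (2 * n * s * n ^ (s - 1)) (adj01 G (vs i) (ps i))
    (TB (cur ps i (vs i))) (TB (cur ps i (ps i))) (TB (n + i))

/-! ### Completeness of the tables and soundness of the traceback -/

section Tables

variable {vs ps : ℕ → Fin n} {TB : ℕ → ℕ → ℕ} {k : ℕ}

theorem crossing_blob (h : ∀ i < k, Elim G (blob vs ps i) (vs i) (ps i)) {i : ℕ} (hi : i ≤ k) :
    Crossing G (blob vs ps i) := by
  induction i with
  | zero => exact fun x y _ _ => ⟨rfl, rfl⟩
  | succ i ih => exact (ih (by omega)).merge (h i (by omega))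

theorem card_alive (h : ∀ i < k, Elim G (blob vs ps i) (vs i) (ps i)) {i : ℕ} (hi : i ≤ k) :
    #{w | blob vs ps i w = w} + i = n := by
  induction i with
  | zero => simp [blob]
  | succ i ih =>
    have he := h i (by omega)
    have h1 : ({w | blob vs ps (i + 1) w = w} : Finset (Fin n))
        = ({w | blob vs ps i w = w} : Finset (Fin n)).erase (vs i) := by
      ext w
      simp only [mem_filter, mem_univ, true_and, mem_erase, blob, merge_alive he]
      tauto
    rw [h1, card_erase_of_mem (by simp [he.left])]
    have h2 : 0 < #{w | blob vs ps i w = w} := card_pos.2 ⟨vs i, by simp [he.left]⟩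
    have := ih (by omega)
    omega

theorem blob_idem (h : ∀ i < k, Elim G (blob vs ps i) (vs i) (ps i)) {i : ℕ} (hi : i ≤ k)
    (u : Fin n) : blob vs ps i (blob vs ps i u) = blob vs ps i u := by
  induction i with
  | zero => rfl
  | succ i ih =>
    have he := h i (by omega)
    simp only [blob]
    have h1 := ih (by omega)
    by_cases h2 : blob vs ps i u = vs i
    · simp [h2, rl, he.right, he.ne.symm]
    · simp [rl, h2, h1]

/-- After `n - 1` merges, a single blob is left. -/
theorem blob_last (h : ∀ i < n - 1, Elim G (blob vs ps i) (vs i) (ps i)) (hn : 2 ≤ n)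
    (u : Fin n) : blob vs ps (n - 1) u = ps (n - 2) := by
  have h1 := card_alive h le_rfl
  have h2 : #{w | blob vs ps (n - 1) w = w} = 1 := by omega
  rw [card_eq_one] at h2
  obtain ⟨r, hr⟩ := h2
  have h3 : ∀ w, blob vs ps (n - 1) w = w → w = r := by
    intro w hw
    have : w ∈ ({w | blob vs ps (n - 1) w = w} : Finset (Fin n)) := by simp [hw]
    rw [hr] at this
    simpa using this
  have he := h (n - 2) (by omega)
  have h4 : blob vs ps (n - 1) (ps (n - 2)) = ps (n - 2) := by
    rw [show n - 1 = n - 2 + 1 by omega, blob, he.right]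
    simp [rl, he.ne.symm]
  rw [h3 _ (blob_idem h le_rfl u), h3 _ h4]

theorem conf_id (hρ : ∀ u, ρ u < s) : Conf s ρ (blob vs ps 0) id := by
  refine ⟨fun _ => rfl, fun _ _ => rfl, fun r => ?_⟩
  have : pieceW ρ id r = ρ r := by
    unfold pieceW
    simp [filter_eq']
  rw [this]; exact hρ r

theorem blobCode_id (w : Fin n) : blobCode G s ρ (blob vs ps 0) id w = 2 * n * ρ w := by
  have h1 : gainB G (blob vs ps 0) id w = 0 :=
    sum_eq_zero fun x _ => sum_eq_zero fun y _ => by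
      split
      · rename_i h
        obtain rfl : x = y := h.2
        exact adj01_self G x
      · rfl
  have h2 : closedM ρ (blob vs ps 0) id w = 0 :=
    sum_eq_zero fun r _ => by
      rw [if_neg]
      rintro ⟨h3, h4⟩
      exact h4 h3
  have h3 : pieceW ρ id w = ρ w := by
    unfold pieceW
    simp [filter_eq']
  rw [blobCode, h1, h2, h3]; ring

/-- Follow `g` through the merges: join the pieces of `v` and `p` if `g v = g p`, and close the
piece of `v` otherwise. Then `f` stays finer than `g`, which bounds its piece weights, and the third
clause says that no edge inside a set of `g` is lost once both ends are in one blob. In the last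
blob the gain of `f` is therefore at least that of `g`, and `g` witnesses that the pieces of `f` can
be glued. -/
theorem Tables.complete (hT : Tables G s ρ vs ps TB k) (hI : Inst s m ρ) (hG : G.IsAcyclic)
    (hρ : ∀ u, ρ u < s) {g : Fin n → Fin n} (hg : IsFinal ρ (s - 1) g) {i : ℕ} (hi : i ≤ k) :
    ∃ f, Conf s ρ (blob vs ps i) f ∧ Finer f g ∧
      (∀ x y, G.Adj x y → blob vs ps i x = blob vs ps i y → g x = g y → f x = f y) ∧
      ∀ w, blob vs ps i w = w → TB (cur ps i w) (blobCode G s ρ (blob vs ps i) f w) ≠ 0 := by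
  induction i with
  | zero =>
    refine ⟨id, conf_id hρ, fun u v h => by rw [show u = v from h],
      fun x y _ h _ => h, fun w _ => ?_⟩
    have h1 := blobCode_lt hI hG (β := blob vs ps 0) (f := id) (conf_id (vs := vs) (ps := ps) hρ).lt w
    exact (hT.init w _ h1).2 (blobCode_id w)
  | succ i ih =>
    obtain ⟨f, hf, hfg, hadj, hTB⟩ := ih (by omega)
    have he := hT.elim i (by omega)
    have hm := hT.merged i (by omega)
    have hc := crossing_blob hT.elim (show i ≤ k by omega)
    have hlt := fun w => blobCode_lt hI hG (β := blob vs ps i) hf.lt w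
    have hother : ∀ w, blob vs ps (i + 1) w = w → w ≠ ps i →
        w ≠ vs i ∧ TB (cur ps (i + 1) w) (blobCode G s ρ (blob vs ps i) f w) ≠ 0 := by
      intro w hw hp
      obtain ⟨h1, h2⟩ := (merge_alive he).1 hw
      refine ⟨h2, ?_⟩
      rw [cur, if_neg hp]
      exact hTB w h1
    have hcrossadj : ∀ x y, G.Adj x y → blob vs ps (i + 1) x = blob vs ps (i + 1) y →
        blob vs ps i x ≠ blob vs ps i y → (x = vs i ∧ y = ps i) ∨ (x = ps i ∧ y = vs i) := by
      intro x y hxy h1 h2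
      obtain ⟨hx, hy⟩ := hc x y hxy h2
      simp only [blob, rl, hx, hy] at h1
      split at h1 <;> split at h1
      · exact absurd (by simp_all) h2
      · exact .inl ⟨‹_›, h1.symm⟩
      · exact .inr ⟨h1, ‹_›⟩
      · exact absurd (by rw [hx, hy, h1]) h2
    by_cases hgl : g (vs i) = g (ps i)
    · have hfv := hf.root _ he.left
      have hfp := hf.root _ he.right
      have hfin := finer_rl_of hfg hgl
      rw [hfv, hfp] at hfin
      have hlt2 := pieceW_lt_of_finer hI hfin hg (ps i)
      rw [pieceW_rl_right ρ f he.ne] at hlt2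
      have hk := hf.keep he hlt2
      refine ⟨_, hk, hfin, ?_, fun w hw => ?_⟩
      · intro x y hxy h1 h2
        by_cases h3 : blob vs ps i x = blob vs ps i y
        · simp only [hadj x y hxy h3 h2]
        · rcases hcrossadj x y hxy h1 h3 with ⟨rfl, rfl⟩ | ⟨rfl, rfl⟩ <;> simp [hfv, hfp, rl]
      · by_cases hp : w = ps i
        · subst hp
          have h4 := blobCode_lt hI hG (β := blob vs ps (i + 1)) hk.lt (ps i)
          have h5 := blobCode_keep_right hc hf he
          change blobCode G s ρ (blob vs ps (i + 1)) _ _ = _ at h5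
          rw [h5] at h4 ⊢
          rw [cur, if_pos rfl]
          exact hm.keep _ (hlt _) _ (hlt _) (hTB _ he.left) (hTB _ he.right)
            (by rw [blobCode_weight hI hG hf.lt, blobCode_weight hI hG hf.lt]; exact hlt2) h4
        · obtain ⟨h1, h2⟩ := hother w hw hp
          have h5 := blobCode_keep_of_ne hf he h1 hp
          change blobCode G s ρ (blob vs ps (i + 1)) _ _ = _ at h5
          rwa [h5]
    · have hk := hf.cut he
      refine ⟨f, hk, hfg, ?_, fun w hw => ?_⟩
      · intro x y hxy h1 h2
        by_cases h3 : blob vs ps i x = blob vs ps i y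
        · exact hadj x y hxy h3 h2
        · rcases hcrossadj x y hxy h1 h3 with ⟨rfl, rfl⟩ | ⟨rfl, rfl⟩
          · exact absurd h2 hgl
          · exact absurd h2.symm hgl
      · by_cases hp : w = ps i
        · subst hp
          have h4 := blobCode_lt hI hG (β := blob vs ps (i + 1)) hk.lt (ps i)
          have h5 := blobCode_cut_right hI hG hf he
          change blobCode G s ρ (blob vs ps (i + 1)) _ _ = _ at h5
          rw [h5] at h4 ⊢
          rw [cur, if_pos rfl]
          exact hm.cut _ (hlt _) _ (hlt _) (hTB _ he.left) (hTB _ he.right) h4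
        · obtain ⟨h1, h2⟩ := hother w hw hp
          have h5 : blobCode G s ρ (blob vs ps (i + 1)) f w = _ := blobCode_cut_of_ne h1 hp
          rwa [h5]

/-- Invariant of the traceback: any configuration after `i` merges with the codes `goal` leads to
a configuration after all `k` merges, with code `X` at `r`. -/
structure Trace (G : SimpleGraph (Fin n)) (s : ℕ) (ρ : Fin n → ℕ) (vs ps : ℕ → Fin n)
    (TB : ℕ → ℕ → ℕ) (k : ℕ) (r : Fin n) (X : ℕ) (i : ℕ) (goal : Fin n → ℕ)
    (lab : Fin n → Fin n) : Prop where
  entry : ∀ w, blob vs ps i w = w →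
    goal w < 2 * n * s * n ^ (s - 1) ∧ TB (cur ps i w) (goal w) ≠ 0
  dead : ∀ w, blob vs ps i w ≠ w → lab w = w
  conf : ∀ f, Conf s ρ (blob vs ps i) f →
    (∀ w, blob vs ps i w = w → blobCode G s ρ (blob vs ps i) f w = goal w) →
    Conf s ρ (blob vs ps k) (fun u => lab (f u)) ∧
      blobCode G s ρ (blob vs ps k) (fun u => lab (f u)) r = X

/-- The entry at `ps i` names the entries `a` and `b` it arose from, which become the goals of the
two blobs before the merge. If the pieces were joined, label `vs i` has to share the fate of `ps i`.
If not, `vs i` remains a label; since it is dead after the merge, `lab` fixed it already. -/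
theorem Trace.step (hT : Tables G s ρ vs ps TB k) (hI : Inst s m ρ) (hG : G.IsAcyclic)
    {r : Fin n} {X i : ℕ} (hi : i < k) {goal : Fin n → ℕ} {lab : Fin n → Fin n} {z : ℕ}
    (h : Trace G s ρ vs ps TB k r X (i + 1) goal lab)
    (hz : TB (n + i) (goal (ps i)) = z) :
    Trace G s ρ vs ps TB k r X i
      (fun u => if u = vs i then (z - 1) / 2 / (2 * n * s * n ^ (s - 1))
        else if u = ps i then (z - 1) / 2 % (2 * n * s * n ^ (s - 1)) else goal u)
      (fun u => if u = vs i then if (z - 1) % 2 = 0 then lab (ps i) else vs i else lab u) ∧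
      z ≠ 0 := by
  have he := hT.elim i hi
  have hm := hT.merged i hi
  have hc := crossing_blob hT.elim hi.le
  have halive : ∀ w, blob vs ps (i + 1) w = w ↔ blob vs ps i w = w ∧ w ≠ vs i :=
    fun w => merge_alive he
  obtain ⟨h1, h2⟩ := h.entry (ps i) ((halive _).2 ⟨he.right, he.ne.symm⟩)
  rw [cur, if_pos rfl] at h2
  obtain ⟨a, ha, b, hb, hTa, hTb, hab⟩ := hm.sound _ h1 h2
  rw [hz] at hab h2
  refine ⟨?_, h2⟩
  -- An entry minus one is `2 * (a * L + b)`, plus one in the case of a cut: its parity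
  -- distinguishes the cases, and half of it, divided by `L` with remainder, returns `a` and `b`.
  have e1 : (z - 1) / 2 / (2 * n * s * n ^ (s - 1)) = a ∧
      (z - 1) / 2 % (2 * n * s * n ^ (s - 1)) = b := by
    have : (z - 1) / 2 = b + 2 * n * s * n ^ (s - 1) * a := by
      rw [mul_comm _ a]
      rcases hab with ⟨h3, -⟩ | ⟨h3, -⟩ <;> omega
    rw [this, Nat.add_mul_div_left _ _ (by omega), Nat.add_mul_mod_self_left,
      Nat.div_eq_of_lt hb, Nat.mod_eq_of_lt hb]
    simp
  rw [e1.1, e1.2]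
  have hvdead : blob vs ps (i + 1) (vs i) ≠ vs i := fun h => ((halive _).1 h).2 rfl
  refine ⟨fun w hw => ?_, fun w hw => ?_, fun f hf hcode => ?_⟩
  · split
    · rename_i hwv
      subst hwv
      exact ⟨ha, hTa⟩
    · split
      · rename_i hwp
        subst hwp
        exact ⟨hb, hTb⟩
      · rename_i hwv hwp
        have := h.entry w ((halive _).2 ⟨hw, hwv⟩)
        rwa [cur, if_neg hwp] at this
  · have hwv : w ≠ vs i := by rintro rfl; exact hw he.left
    rw [if_neg hwv]
    exact h.dead w fun h => hw ((halive _).1 h).1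
  · have hcv := hcode _ he.left
    have hcp := hcode _ he.right
    rw [if_pos rfl] at hcv
    rw [if_neg he.ne.symm, if_pos rfl] at hcp
    rcases hab with ⟨h3, h4, h5⟩ | ⟨h3, h5⟩
    · have hpar : (z - 1) % 2 = 0 := by omega
      simp only [hpar, if_true]
      rw [← hcv, ← hcp, blobCode_weight hI hG hf.lt, blobCode_weight hI hG hf.lt] at h4
      have hk := hf.keep he h4
      have h6 := h.conf _ hk fun w hw => ?_
      · have h7 : ∀ u, (if f u = vs i then lab (ps i) else lab (f u)) = lab (rl (vs i) (ps i) (f u)) := by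
          intro u
          unfold rl
          split <;> rfl
        simp only [h7]
        exact h6
      · obtain ⟨h8, h9⟩ := (halive _).1 hw
        by_cases hp : w = ps i
        · subst hp
          have h10 := blobCode_keep_right hc hf he
          rw [hcv, hcp, ← h5] at h10
          exact h10
        · have h10 := blobCode_keep_of_ne hf he h9 hp
          rw [hcode w h8, if_neg h9, if_neg hp] at h10
          exact h10
    · have hpar : (z - 1) % 2 ≠ 0 := by omega
      simp only [hpar, if_false]
      have hk := hf.cut he
      have h6 := h.conf _ hk fun w hw => ?_
      · have h7 : ∀ u, (if f u = vs i then vs i else lab (f u)) = lab (f u) := by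
          intro u
          split
          · rename_i h8
            rw [h8, h.dead _ hvdead]
          · rfl
        simp only [h7]
        exact h6
      · obtain ⟨h8, h9⟩ := (halive _).1 hw
        by_cases hp : w = ps i
        · subst hp
          have h10 := blobCode_cut_right hI hG hf he
          rw [hcv, hcp, ← h5] at h10
          exact h10
        · have h10 : blobCode G s ρ (blob vs ps (i + 1)) f w = _ := blobCode_cut_of_ne h9 hp
          rw [hcode w h8, if_neg h9, if_neg hp] at h10
          exact h10

theorem Trace.last {r : Fin n} {X : ℕ} (hr : ∀ u, blob vs ps k u = r)
    {goal : Fin n → ℕ} (hg : goal r = X)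
    (hX : X < 2 * n * s * n ^ (s - 1)) (hTB : TB (cur ps k r) X ≠ 0) :
    Trace G s ρ vs ps TB k r X k goal id := by
  refine ⟨fun w hw => ?_, fun _ _ => rfl, fun f hf hc => ⟨hf, ?_⟩⟩
  · obtain rfl : r = w := (hr w).symm.trans hw
    rw [hg]; exact ⟨hX, hTB⟩
  · exact (hc r (hr r)).trans hg

/-- Before the first merge the identity is a configuration, and the initial tables force the goals
to be its codes. So `Trace.conf` applies to the identity and returns `lab` itself. -/
theorem Trace.first {r : Fin n} {X : ℕ} (hT : Tables G s ρ vs ps TB k)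
    (hρ : ∀ u, ρ u < s) {goal : Fin n → ℕ}
    {lab : Fin n → Fin n} (h : Trace G s ρ vs ps TB k r X 0 goal lab) :
    Conf s ρ (blob vs ps k) lab ∧ blobCode G s ρ (blob vs ps k) lab r = X := by
  refine h.conf id (conf_id hρ) fun w hw => ?_
  obtain ⟨h1, h2⟩ := h.entry w hw
  rw [blobCode_id]
  exact ((hT.init w _ h1).1 h2).symm

theorem gainB_last {β f : Fin n → Fin n} {r : Fin n} (hr : ∀ u, β u = r) :
    gainB G β f r = gain2 G f := by
  simp [gainB, gain2, hr]

theorem closedM_last {β f : Fin n → Fin n} {r : Fin n} (hr : ∀ u, β u = r) :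
    closedM ρ β f r + pw n (pieceW ρ f r) = codeM ρ f := by
  unfold closedM codeM
  rw [← sum_erase_add univ _ (mem_univ r)]
  simp only [hr, true_and]
  rw [← sum_erase_add univ _ (mem_univ r)]
  simp only [ne_eq, not_true_eq_false, if_false, add_zero]
  congr 1
  exact sum_congr rfl fun x hx => by rw [if_pos (ne_of_mem_erase hx)]

/-- The information contained in the code of the last blob. -/
theorem blobCode_last (hI : Inst s m ρ) (hG : G.IsAcyclic) {β f : Fin n → Fin n} {r : Fin n}
    (hr : ∀ u, β u = r) (hf : ∀ r, pieceW ρ f r < s) {X : ℕ} (hX : blobCode G s ρ β f r = X) :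
    X % (2 * n) = gain2 G f ∧
      X / (2 * n) / s + pw n (X / (2 * n) % s) = codeM ρ f := by
  have hg := gainB_lt hI hG β f r
  subst hX
  unfold blobCode
  rw [decode_mod hg, decode_div_div hg (hf r), decode_div_mod hg (hf r), gainB_last hr,
    closedM_last hr]
  exact ⟨rfl, rfl⟩

end Tables

end Blob

/-! ### The preprocessing -/

/-- Partial sums. -/
def psum {n : ℕ} (g : Fin n → ℕ) (j : ℕ) : ℕ := ∑ v : Fin n, if (v : ℕ) < j then g v else 0

@[simp] theorem psum_zero {n : ℕ} (g : Fin n → ℕ) : psum g 0 = 0 := by simp [psum]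

theorem psum_succ {n : ℕ} (g : Fin n → ℕ) {j : ℕ} (hj : j < n) :
    psum g (j + 1) = psum g j + g ⟨j, hj⟩ := by
  have h : g ⟨j, hj⟩ = ∑ v : Fin n, if v = ⟨j, hj⟩ then g v else 0 := by simp
  rw [psum, psum, h, ← sum_add_distrib]
  refine sum_congr rfl fun v _ => ?_
  simp only [Fin.ext_iff]
  rcases lt_trichotomy (v : ℕ) j with h | h | h
  · rw [if_pos (by omega), if_pos h, if_neg (by omega)]; rfl
  · rw [if_pos (by omega), if_neg (by omega), if_pos h, zero_add]
  · rw [if_neg (by omega), if_neg (by omega), if_neg (by omega)]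

theorem psum_self {n : ℕ} (g : Fin n → ℕ) : psum g n = ∑ v, g v :=
  sum_congr rfl fun v _ => if_pos v.2

theorem psum_le {n : ℕ} (g : Fin n → ℕ) (j : ℕ) : psum g j ≤ ∑ v, g v :=
  sum_le_sum fun v _ => by split <;> simp

/-- Count the vertices of each color in array 0. -/
def countProg : Prog :=
  forLoop 10 0 (put 0 (load (reg 10)) (rd 0 (load (reg 10)) + const 1))

theorem wp_countProg {W n k τ Z : ℕ} {s : State} {col : Fin n → Fin k} (hn : s.reg 0 = n)
    (hZ : s.reg 2 = Z) (hnZ : n ≤ Z) (hk : k ≤ n) (hW : Z + 16 * n + 16 ≤ W)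
    (hcol : ∀ v : Fin n, s.mem v = col v) (h0 : ∀ i, s.mem (cell Z 0 i) = 0) :
    wp W countProg (fun s' τ' => Frame Z [10] [0] s s' ∧
      (∀ i : Fin k, s'.mem (cell Z 0 i) = #(colorClass col i)) ∧ τ' ≤ τ + 100 * n + 6) s τ := by
  refine wp_forLoop (Z := Z) [] [0] (fun j s' => ∀ i : Fin k,
    s'.mem (cell Z 0 i) = psum (fun v => if col v = i then 1 else 0) j) 40 n hn (by omega) hZ
    (by decide) (by decide) (by decide) (by decide) (by decide) (by decide) (fun j s' v h => h)
    (by simp [h0]) ?_ ?_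
  · intro j s' τ' hj hF hij hI
    have h2 : s'.reg 2 = Z := (hF.reg 2 rfl).trans hZ
    have hc : s'.mem j = col ⟨j, hj⟩ := (hF.inp j (by omega)).trans (hcol ⟨j, hj⟩)
    have hck := (col ⟨j, hj⟩).2
    have hcnt : psum (fun v => if col v = col ⟨j, hj⟩ then 1 else 0) j ≤ n :=
      (psum_le _ _).trans (by rw [← card_filter]; exact (card_le_univ _).trans (by simp))
    have hI' := hI (col ⟨j, hj⟩)
    refine wp_put (fun hB => ?_) ?_
    · simp only [fits_load, fits_reg, fits_add, fits_rd, fits_const, eval_load, eval_reg, eval_rd,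
        eval_const, hB.reg, hB.mem, hij, h2, hc, hI', true_and]
      simp only [cell]
      omega
    · refine ⟨by simp, fun i => ?_⟩
      simp only [eval_load, eval_reg, eval_add, eval_rd, eval_const, hij, h2, hc, hI',
        State.write_mem, cell_inj (show 0 < 16 by omega) (show 0 < 16 by omega), psum_succ _ hj]
      by_cases hi : i = col ⟨j, hj⟩
      · simp [hi]
      · have : (i : ℕ) ≠ col ⟨j, hj⟩ := fun h => hi (Fin.ext h)
        simp [this, Ne.symm hi, hI]
  · intro s' τ' hF hI hτ
    refine ⟨hF, fun i => ?_, by omega⟩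
    rw [hI, colorClass, psum_self, card_filter]

/-- The greatest common divisor of the numbers in array 0, by trial. -/
def gcdProg : Prog :=
  forLoop 10 0 (.assign 11 (reg 10 + const 1) ;; .assign 12 (const 1) ;;
    forLoop 13 1 (.cond (rd 0 (reg 13) % reg 11) (.assign 12 (const 0)) .skip) ;;
    .cond (reg 12) (.assign 3 (reg 11)) .skip)

/-- Since the `c i` are coprime, the common divisors of the numbers `m * c i` are the divisors of
`m`. The last successful trial divisor among `1, …, n` is thus `m`, and the invariant claims nothing
before `m` has been tried. -/
theorem wp_gcdProg {W n k τ Z m : ℕ} {s : State} {c : Fin k → ℕ} (hn : s.reg 0 = n)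
    (hk : s.reg 1 = k) (hkn : k ≤ n) (hm : 0 < m) (hmn : m ≤ n) (hg : univ.gcd c = 1)
    (hZ : s.reg 2 = Z) (hW : Z + 16 * n + 16 ≤ W)
    (hcnt : ∀ i : Fin k, s.mem (cell Z 0 i) = m * c i) :
    wp W gcdProg (fun s' τ' => Frame Z [10, 11, 12, 13, 3] [] s s' ∧
      s'.reg 3 = m ∧ τ' ≤ τ + 200 * (n * n) + 6) s τ := by
  have hdvd : ∀ g, (∀ i : Fin k, g ∣ m * c i) ↔ g ∣ m := by
    intro g
    constructor
    · intro h
      have : g ∣ univ.gcd fun i => m * c i := dvd_gcd fun i _ => h i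
      rwa [Finset.gcd_mul_left, hg, mul_one, normalize_eq] at this
    · exact fun h i => Dvd.dvd.mul_right h _
  have hnn : n ≤ n * n := Nat.le_mul_self n
  have hkk : n * k ≤ n * n := Nat.mul_le_mul_left _ hkn
  refine wp_forLoop (Z := Z) [11, 12, 13, 3] [] (fun j s' => m ≤ j → s'.reg 3 = m)
    (k * 40 + 40) n hn (by omega) hZ
    (by decide) (by decide) (by decide) (by decide) (by decide) (by decide)
    (fun j s' v h => by simpa [State.set_reg] using h)
    (by intro h; omega) ?_ ?_
  · intro j s' τ' hj hF hij hI
    have h2 : s'.reg 2 = Z := (hF.reg 2 rfl).trans hZ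
    have h1 : s'.reg 1 = k := (hF.reg 1 rfl).trans hk
    have hc : ∀ i : Fin k, s'.mem (cell Z 0 i) = m * c i := fun i =>
      (hF.arr 0 i rfl (by omega)).trans (hcnt i)
    refine wp_seq (wp_assign (fun hB => ?_) ?_)
    · simp [hij, hB.reg]; omega
    refine wp_seq (wp_assign (fun hB => by simp; omega) ?_)
    simp only [eval_add, eval_reg, eval_const, hij]
    refine wp_seq (wp_forLoop (Z := Z) [12] [] (i := 13) (b := 1) (fun l s'' => s''.reg 12 ≠ 0 ↔
      ∀ i : Fin k, (i : ℕ) < l → (j + 1) ∣ m * c i) 32 k (by simp [State.set_reg, h1])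
      (by omega) (by simp [State.set_reg, h2])
      (by decide) (by decide) (by decide) (by decide) (by decide) (by decide)
      (fun j s' v h => by simpa [State.set_reg] using h) (by simp [State.set_reg]) ?_ ?_)
    · intro l s1 τ1 hl hF1 hil hI1
      have e2 : s1.reg 2 = Z := (hF1.reg 2 rfl).trans (by simp [State.set_reg, h2])
      have e11 : s1.reg 11 = j + 1 := (hF1.reg 11 rfl).trans (by simp [State.set_reg])
      have ec : s1.mem (cell Z 0 l) = m * c ⟨l, hl⟩ :=
        (hF1.arr 0 l rfl (by omega)).trans (hc ⟨l, hl⟩)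
      have hsucc : (∀ i : Fin k, (i : ℕ) < l + 1 → (j + 1) ∣ m * c i) ↔
          (∀ i : Fin k, (i : ℕ) < l → (j + 1) ∣ m * c i) ∧ (j + 1) ∣ m * c ⟨l, hl⟩ := by
        constructor
        · exact fun h => ⟨fun i hi => h i (by omega), h _ (by simp)⟩
        · rintro ⟨h, h'⟩ i hi
          rcases Nat.lt_succ_iff_lt_or_eq.1 hi with h3 | h3
          · exact h i h3
          · convert h'
      refine wp_cond (fun hB => ?_) (fun hb => wp_assign (fun hB => ?_) ?_) (fun hb => wp_skip ?_)
      · simp [hB.reg, hB.mem, hil, e2, cell]; omega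
      · simp
      · simp [hil, e2, e11, ec] at hb
        refine ⟨by simp, ?_⟩
        rw [hsucc]
        simp only [State.set_reg_self, eval_const, ne_eq, not_true_eq_false, false_iff]
        exact fun h => hb (Nat.mod_eq_zero_of_dvd h.2)
      · simp [hil, e2, e11, ec] at hb
        refine ⟨by simp, ?_⟩
        rw [hI1, hsucc, and_iff_left (Nat.dvd_of_mod_eq_zero hb)]
    · intro s1 τ1 hF1 hI1 hτ1
      have e11 : s1.reg 11 = j + 1 := (hF1.reg 11 rfl).trans (by simp [State.set_reg])
      have e3 : s1.reg 3 = s'.reg 3 := (hF1.reg 3 rfl).trans (by simp [State.set_reg])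
      have hall : (∀ i : Fin k, (i : ℕ) < k → (j + 1) ∣ m * c i) ↔ (j + 1) ∣ m := by
        rw [← hdvd]
        exact ⟨fun h i => h i i.2, fun h i _ => h i⟩
      rw [hall] at hI1
      refine wp_cond (fun hB => by simp [hB.reg]) (fun hb => wp_assign (fun hB => by simp [hB.reg]) ?_)
        (fun hb => wp_skip ?_)
      · simp at hτ1
        refine ⟨by simp; omega, fun hmj => ?_⟩
        rw [eval_reg, hI1] at hb
        have := Nat.le_of_dvd hm hb
        simp [State.set_reg, e11]
        omega
      · simp at hτ1
        refine ⟨by simp; omega, fun hmj => ?_⟩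
        rw [eval_reg, ← not_not (a := s1.reg 12 = 0), ← ne_eq, hI1] at hb
        rw [e3]
        apply hI
        rcases Nat.lt_or_ge j m with h | h
        · obtain rfl : m = j + 1 := by omega
          exact absurd dvd_rfl hb
        · exact h
  · intro s' τ' hF hI hτ
    refine ⟨hF, hI hmn, ?_⟩
    have : n * (k * 40 + 40 + 8) = 40 * (n * k) + 48 * n := by ring
    omega

/-- Conjunction of tests. -/
def Term.andT (x y : Term) : Term := ltT (const 0) x * ltT (const 0) y

@[simp] theorem Term.eval_andT (s : State) (x y : Term) :
    (andT x y).eval s = if x.eval s ≠ 0 ∧ y.eval s ≠ 0 then 1 else 0 := by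
  simp only [andT, eval_mul, eval_ltT, eval_const, Nat.pos_iff_ne_zero]
  split <;> split <;> simp_all

@[simp] theorem Term.steps_andT (x y : Term) : (andT x y).steps = x.steps + y.steps + 5 := by
  simp [andT]; omega

theorem Term.fits_ltT' {W : ℕ} (hW : 1 ≤ W) (s : State) (x y : Term) :
    (ltT x y).Fits W s ↔ x.Fits W s ∧ y.Fits W s := by
  rw [fits_ltT]
  have : (if x.eval s < y.eval s then 1 else 0) ≤ W := by split <;> omega
  tauto

theorem Term.fits_eqT' {W : ℕ} (hW : 1 ≤ W) (s : State) (x y : Term) :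
    (eqT x y).Fits W s ↔ x.Fits W s ∧ y.Fits W s := by
  rw [fits_eqT]
  have : (if x.eval s = y.eval s then 1 else 0) ≤ W := by split <;> omega
  tauto

/-- Both tests are always evaluated. Addresses in the second one have to fit even when the first one
fails, so the address estimates below may not rely on it. -/
theorem Term.fits_andT {W : ℕ} (hW : 1 ≤ W) (s : State) (x y : Term) :
    (andT x y).Fits W s ↔ x.Fits W s ∧ y.Fits W s := by
  have : ((ltT (const 0) x).eval s * (ltT (const 0) y).eval s) ≤ W := by
    simp only [eval_ltT]
    split <;> split <;> (simp; try omega)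
  rw [andT, fits_mul, fits_ltT' hW, fits_ltT' hW]
  simp only [fits_const, Nat.zero_le, true_and]
  tauto

/-- Compute the place values in array 1 and their product in register 4. -/
def radProg : Prog :=
  .assign 4 (const 1) ;; forLoop 10 1 (put 1 (reg 10) (reg 4) ;;
    .assign 4 (reg 4 * (rd 0 (reg 10) / reg 3 + const 1)))

/-- The counts are `m * c i`, so division by register 3 returns `c i`. -/
theorem wp_radProg {W n k τ Z m : ℕ} {s : State} {c : Fin k → ℕ}
    (hk : s.reg 1 = k) (hkn : k ≤ n) (h3 : s.reg 3 = m) (hm : 0 < m)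
    (hZ : s.reg 2 = Z) (hW : Z + 16 * n + 16 ≤ W) (hsW : setvars c ≤ W)
    (hcnt : ∀ i : Fin k, s.mem (cell Z 0 i) = m * c i) :
    wp W radProg (fun s' τ' => Frame Z [10, 4] [1] s s' ∧
      s'.reg 4 = setvars c ∧ (∀ i < k, s'.mem (cell Z 1 i) = rad (ext0 c) i) ∧
      τ' ≤ τ + 100 * n + 10) s τ := by
  refine wp_seq (wp_assign (fun hB => by simp; omega) ?_)
  simp only [eval_const, steps_const]
  refine wp_forLoop (Z := Z) [4] [1] (fun j s' => s'.reg 4 = rad (ext0 c) j ∧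
    ∀ i < j, s'.mem (cell Z 1 i) = rad (ext0 c) i)
    40 k (by simp [State.set_reg, hk]) (by omega) (by simp [State.set_reg, hZ])
    (by decide) (by decide) (by decide) (by decide) (by decide) (by decide)
    (fun j s' v h => by simpa [State.set_reg] using h)
    (by simp [State.set_reg, rad]) ?_ ?_
  · rintro j s' τ' hj hF hij ⟨hI4, hI1⟩
    have e2 : s'.reg 2 = Z := (hF.reg 2 rfl).trans (by simp [State.set_reg, hZ])
    have e3 : s'.reg 3 = m := (hF.reg 3 rfl).trans (by simp [State.set_reg, h3])
    have ec : s'.mem (cell Z 0 j) = m * ext0 c j := by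
      rw [hF.arr 0 j rfl (by omega), State.set_mem]
      simpa [ext0, hj] using hcnt ⟨j, hj⟩
    have hr : rad (ext0 c) j * (ext0 c j + 1) ≤ W := by
      rw [← rad_succ]
      exact (rad_mono _ hj).trans (by rwa [rad_ext0])
    have hr2 : rad (ext0 c) j ≤ W := le_trans (Nat.le_mul_of_pos_right _ (by omega)) hr
    have hr' : ext0 c j + 1 ≤ W := le_trans (Nat.le_mul_of_pos_left _ (rad_pos _ _)) hr
    refine wp_bounded fun hB' => ?_
    have hB0 := hB'.mem (cell Z 0 j)
    have hB3 := hB'.reg 3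
    rw [ec] at hB0
    refine wp_seq (wp_put (fun hB => ?_) (wp_assign (fun hB => ?_) ?_))
    · simp [hB.reg, hij, e2, cell]; omega
    · simp only [fits_mul, fits_reg, fits_add, fits_div, fits_rd, fits_const, eval_reg, eval_add,
        eval_div, eval_rd, eval_const, hB.reg, hB.mem, true_and, and_true, State.write_reg, e2, e3,
        hij, hI4, State.write_mem, cell_inj (show 0 < 16 by omega) (show 1 < 16 by omega),
        zero_ne_one, false_and, if_false, ec, Nat.mul_div_cancel_left _ hm]
      simp only [cell]
      omega
    · refine ⟨by simp, ?_, ?_⟩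
      · simp [e2, e3, hij, hI4, State.write_mem, cell_inj, ec, Nat.mul_div_cancel_left _ hm,
          rad_succ]
      · intro i hi
        simp only [eval_reg, e2, hij, hI4, State.set_mem, State.write_mem,
          cell_inj (show 1 < 16 by omega) (show 1 < 16 by omega), true_and]
        split
        · rename_i h; rw [h]
        · exact hI1 i (by omega)
  · rintro s' τ' hF ⟨hI4, hI1⟩ hτ
    refine ⟨((Frame.refl Z [10, 4] [1] s).set (r := 4) (by decide)).trans hF, ?_, hI1, by omega⟩
    rw [hI4, rad_ext0]

/-- Compute the weights of the vertices in array 11. -/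
def rhoProg : Prog := forLoop 10 0 (put 11 (reg 10) (rd 1 (load (reg 10))))

theorem wp_rhoProg {W n k τ Z : ℕ} {s : State} {c : Fin k → ℕ} {col : Fin n → Fin k}
    (hn : s.reg 0 = n) (hkn : k ≤ n) (hZ : s.reg 2 = Z) (hnZ : n ≤ Z) (hW : Z + 16 * n + 16 ≤ W)
    (hcol : ∀ v : Fin n, s.mem v = col v)
    (hrad : ∀ i < k, s.mem (cell Z 1 i) = rad (ext0 c) i) :
    wp W rhoProg (fun s' τ' => Frame Z [10] [11] s s' ∧
      (∀ v : Fin n, s'.mem (cell Z 11 v) = rho c col v) ∧ τ' ≤ τ + 100 * n + 10) s τ := by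
  refine wp_forLoop (Z := Z) [] [11] (fun j s' => ∀ v : Fin n, (v : ℕ) < j →
    s'.mem (cell Z 11 v) = rho c col v) 40 n hn (by omega) hZ
    (by decide) (by decide) (by decide) (by decide) (by decide) (by decide) (fun j s' v h => h)
    (by simp) ?_ ?_
  · intro j s' τ' hj hF hij hI
    have e2 : s'.reg 2 = Z := (hF.reg 2 rfl).trans hZ
    have hc : s'.mem j = col ⟨j, hj⟩ := (hF.inp j (by omega)).trans (hcol ⟨j, hj⟩)
    have hck := (col ⟨j, hj⟩).2
    have hr : s'.mem (cell Z 1 (col ⟨j, hj⟩)) = rho c col ⟨j, hj⟩ :=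
      (hF.arr 1 _ rfl (by omega)).trans (hrad _ hck)
    refine wp_put (fun hB => ?_) ?_
    · simp [hB.reg, hB.mem, hij, e2, hc, cell]; omega
    · refine ⟨by simp, fun v hv => ?_⟩
      simp only [eval_reg, eval_rd, eval_load, e2, hij, hc, hr, State.write_mem,
        cell_inj (show 11 < 16 by omega) (show 11 < 16 by omega), true_and]
      split
      · rename_i h
        congr 1
        exact Fin.ext h.symm
      · exact hI v (by omega)
  · intro s' τ' hF hI hτ
    exact ⟨hF, fun v => hI v v.2, by omega⟩

/-- Compute the codes of single pieces in array 2. -/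
def pwProg : Prog :=
  .assign 11 (reg 4 - const 1) ;; .assign 5 (const 1) ;;
    forLoop 10 11 (put 2 (reg 10 + const 1) (reg 5) ;; .assign 5 (reg 5 * reg 0))

/-- Cell 0 is never written: the value `pw n 0 = 0` is supplied by the empty memory. -/
theorem wp_pwProg {W n s τ Z : ℕ} {σ : State}
    (hn : σ.reg 0 = n) (hn0 : 0 < n) (h4 : σ.reg 4 = s) (hs : 1 ≤ s) (hZ : σ.reg 2 = Z)
    (hW : Z + 16 * s + 16 ≤ W) (hNW : n ^ (s - 1) ≤ W) (h0 : σ.mem (cell Z 2 0) = 0) :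
    wp W pwProg (fun σ' τ' => Frame Z [10, 11, 5] [2] σ σ' ∧
      σ'.reg 5 = n ^ (s - 1) ∧ (∀ t < s, σ'.mem (cell Z 2 t) = pw n t) ∧
      τ' ≤ τ + 100 * s + 20) σ τ := by
  refine wp_seq (wp_assign (fun hB => by simp [hB.reg]; omega) ?_)
  refine wp_seq (wp_assign (fun hB => by simp; omega) ?_)
  simp only [eval_const, steps_const, eval_sub, eval_reg, steps_sub, steps_reg, h4]
  refine wp_forLoop (Z := Z) [5] [2] (fun j s' => s'.reg 5 = n ^ j ∧
    ∀ t < j + 1, s'.mem (cell Z 2 t) = pw n t)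
    40 (s - 1) (by simp [State.set_reg]) (by omega) (by simp [State.set_reg, hZ])
    (by decide) (by decide) (by decide) (by decide) (by decide) (by decide)
    (fun j s' v h => by simpa [State.set_reg] using h)
    (by simp [State.set_reg, h0]) ?_ ?_
  · rintro j s' τ' hj hF hij ⟨hI5, hI2⟩
    have e2 : s'.reg 2 = Z := (hF.reg 2 rfl).trans (by simp [State.set_reg, hZ])
    have e0 : s'.reg 0 = n := (hF.reg 0 rfl).trans (by simp [State.set_reg, hn])
    have hp : n ^ j * n ≤ W := by
      rw [← pow_succ]
      exact (Nat.pow_le_pow_right hn0 (by omega)).trans hNW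
    refine wp_seq (wp_put (fun hB => ?_) (wp_assign (fun hB => ?_) ?_))
    · simp [hB.reg, hij, e2, cell]; omega
    · simp only [fits_mul, fits_reg, eval_reg, hB.reg, true_and, State.write_reg, hI5, e0]
      exact ⟨le_trans (Nat.le_mul_of_pos_right _ hn0) hp,
        le_trans (Nat.le_mul_of_pos_left _ (pow_pos hn0 _)) hp, hp⟩
    · refine ⟨by simp, ?_, ?_⟩
      · simp [hI5, e0, pow_succ]
      · intro t ht
        simp only [eval_reg, eval_add, eval_const, e2, hij, hI5, State.set_mem, State.write_mem,
          cell_inj (show 2 < 16 by omega) (show 2 < 16 by omega), true_and]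
        split
        · rename_i h; rw [h, pw_succ]
        · exact hI2 t (by omega)
  · rintro s' τ' hF ⟨hI5, hI2⟩ hτ
    refine ⟨(((Frame.refl Z [10, 11, 5] [2] σ).set (r := 11) (by decide)).set (r := 5)
      (by decide)).trans (hF.mono (by simp) (by simp)), hI5, fun t ht => hI2 t (by omega), by omega⟩

/-- Relations between the sizes of the instance, the tables and the words. -/
structure Size (n s N L W : ℕ) : Prop where
  two_le_n : 2 ≤ n
  two_le_s : 2 ≤ s
  N_eq : N = n ^ (s - 1)
  L_eq : L = 2 * n * s * N
  W_ge : 1000 * (L * L) ≤ W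

/-- The estimates behind all bounds on words and times, with products such as `n * L` and `L * L` as
atoms for linear arithmetic. The largest numbers in the run are the entries, up to about `2 * L *
L`, and the addresses in array 4, up to about `16 * (2 * n * L)`; both are far below `1000 * (L *
L)`. -/
theorem Size.facts {n s N L W : ℕ} (h : Size n s N L W) :
    n * n ≤ L ∧ n ≤ n * n ∧ s ≤ L ∧ N ≤ L ∧ n ≤ N ∧ L ≤ n * L ∧ n * L ≤ L * L ∧ 16 ≤ L ∧
      1000 * (L * L) ≤ W ∧ 2 * n ≤ L := by
  obtain ⟨h1, h2, h3, h4, h5⟩ := h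
  have hN : n ≤ N := by
    rw [h3]
    calc n = n ^ 1 := (pow_one n).symm
      _ ≤ n ^ (s - 1) := Nat.pow_le_pow_right (by omega) (by omega)
  have e1 : n * n ≤ n * N := Nat.mul_le_mul_left _ hN
  have e2 : 2 * (2 * (n * N)) ≤ L := by
    rw [h4, show 2 * n * s * N = 2 * (s * (n * N)) by ring]
    exact Nat.mul_le_mul_left _ (Nat.mul_le_mul_right _ h2)
  have e3 : 2 * n ≤ n * n := Nat.mul_le_mul_right n h1
  have e4 : s ≤ L := by
    rw [h4, show 2 * n * s * N = s * (2 * (n * N)) by ring]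
    exact Nat.le_mul_of_pos_right _ (by omega)
  have e5 : 2 * N ≤ n * N := Nat.mul_le_mul_right _ h1
  have e6 : 2 * L ≤ n * L := Nat.mul_le_mul_right _ h1
  have e7 : n * L ≤ L * L := Nat.mul_le_mul_right _ (by omega)
  refine ⟨?_, ?_, e4, ?_, hN, ?_, e7, ?_, h5, ?_⟩ <;> omega

/-- Compute the constants in registers 6 to 9. -/
def constProg : Prog :=
  .assign 7 (const 2 * reg 0) ;; .assign 6 (reg 7 * reg 4 * reg 5) ;;
    .assign 8 (reg 0 - const 1) ;; .assign 9 (reg 3 * rd 2 (reg 4 - const 1))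

theorem mul_pw_lt {n s m : ℕ} (hs : 2 ≤ s) (hm : m < n) : m * pw n (s - 1) < n ^ (s - 1) := by
  obtain ⟨t, rfl⟩ := Nat.exists_eq_add_of_le hs
  rw [show 2 + t - 1 = t + 1 by omega, pw_succ, pow_succ']
  exact Nat.mul_lt_mul_of_pos_right hm (pow_pos (by omega) _)

/-- The data that are available after the preprocessing. -/
structure Env (n s N L m : ℕ) (G : SimpleGraph (Fin n)) (ρ : Fin n → ℕ) (σ : State) : Prop where
  r0 : σ.reg 0 = n
  r2 : σ.reg 2 = n + n * n
  r4 : σ.reg 4 = s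
  r5 : σ.reg 5 = N
  r6 : σ.reg 6 = L
  r7 : σ.reg 7 = 2 * n
  r8 : σ.reg 8 = n - 1
  r9 : σ.reg 9 = m * pw n (s - 1)
  adj : ∀ u v : Fin n, σ.mem (n + u * n + v) = adj01 G u v
  pw : ∀ t < s, σ.mem (cell (n + n * n) 2 t) = pw n t
  rho : ∀ v : Fin n, σ.mem (cell (n + n * n) 11 v) = ρ v

theorem index_lt {n : ℕ} (u v : Fin n) : n + u * n + v < n + n * n := by
  have h1 : (u + 1 : ℕ) * n ≤ n * n := Nat.mul_le_mul_right n u.2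
  have h2 := v.2
  have h3 : (u + 1 : ℕ) * n = u * n + n := by ring
  omega

theorem Env.frame {n s N L m : ℕ} {G : SimpleGraph (Fin n)} {ρ : Fin n → ℕ} {σ σ' : State}
    (h : Env n s N L m G ρ σ) {R J : List ℕ} (hF : Frame (n + n * n) R J σ σ')
    (hR : ((List.range 10).all fun r => !R.contains r) = true)
    (hJ : (!J.contains 2 && !J.contains 11) = true) : Env n s N L m G ρ σ' := by
  have hr : ∀ r < 10, σ'.reg r = σ.reg r := by
    intro r hr
    apply hF.reg
    have := List.all_eq_true.1 hR r (List.mem_range.2 hr)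
    simpa using this
  rw [Bool.and_eq_true, Bool.not_eq_true', Bool.not_eq_true'] at hJ
  exact ⟨(hr 0 (by omega)).trans h.r0, (hr 2 (by omega)).trans h.r2, (hr 4 (by omega)).trans h.r4,
    (hr 5 (by omega)).trans h.r5, (hr 6 (by omega)).trans h.r6, (hr 7 (by omega)).trans h.r7,
    (hr 8 (by omega)).trans h.r8, (hr 9 (by omega)).trans h.r9,
    fun u v => (hF.inp _ (index_lt u v)).trans (h.adj u v),
    fun t ht => (hF.arr 2 t hJ.1 (by omega)).trans (h.pw t ht),
    fun v => (hF.arr 11 v hJ.2 (by omega)).trans (h.rho v)⟩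

theorem wp_constProg {W n s N L m τ : ℕ} {σ : State} {G : SimpleGraph (Fin n)} {ρ : Fin n → ℕ}
    (hS : Size n s N L W) (hm : m < n) (h0 : σ.reg 0 = n) (h2 : σ.reg 2 = n + n * n)
    (h3 : σ.reg 3 = m) (h4 : σ.reg 4 = s) (h5 : σ.reg 5 = N)
    (hadj : ∀ u v : Fin n, σ.mem (n + u * n + v) = adj01 G u v)
    (hpw : ∀ t < s, σ.mem (cell (n + n * n) 2 t) = pw n t)
    (hrho : ∀ v : Fin n, σ.mem (cell (n + n * n) 11 v) = ρ v) :
    wp W constProg (fun σ' τ' => Frame (n + n * n) [6, 7, 8, 9] [] σ σ' ∧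
      Env n s N L m G ρ σ' ∧ τ' ≤ τ + 100) σ τ := by
  obtain ⟨f1, f2, f3, f4, f5, f6, f7, f8, f9, f10⟩ := hS.facts
  have hs := hS.two_le_s
  have hn := hS.two_le_n
  have hfin := mul_pw_lt hs hm
  rw [← hS.N_eq] at hfin
  have hL : 2 * n * s * N ≤ W := by rw [← hS.L_eq]; omega
  have hL2 : 2 * n * s ≤ W := le_trans (Nat.le_mul_of_pos_right _ (by omega)) hL
  have e4 : σ.mem (cell (n + n * n) 2 (s - 1)) = pw n (s - 1) := hpw _ (by omega)
  refine wp_bounded fun hB' => ?_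
  have hB0 := hB'.mem (cell (n + n * n) 2 (s - 1))
  rw [e4] at hB0
  refine wp_seq (wp_assign (fun hB => ?_) (wp_seq (wp_assign (fun hB => ?_)
    (wp_seq (wp_assign (fun hB => ?_) (wp_assign (fun hB => ?_) ?_))))))
  · simp [hB.reg, h0]; omega
  · simp only [fits_mul, fits_reg, hB.reg, true_and, eval_reg, eval_mul, eval_const,
      State.set_reg, h0]
    simp [h4, h5]
    exact ⟨⟨by omega, by omega, hL2⟩, by omega, hL⟩
  · simp only [fits_sub, fits_reg, hB.reg, true_and, fits_const]; omega
  · simp only [fits_mul, fits_reg, fits_rd, fits_sub, hB.reg, hB.mem, true_and, eval_reg, eval_mul,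
      eval_sub, eval_rd, eval_const, fits_const, State.set_reg, State.set_mem, and_true]
    simp [h2, h3, h4, e4]
    simp only [cell]
    omega
  · refine ⟨((((Frame.refl _ _ _ _).set (by decide)).set (by decide)).set (by decide)).set
      (by decide), ?_, by simp⟩
    constructor <;> simp [State.set_reg, h0, h2, h3, h4, h5, e4]
    · exact hS.L_eq.symm
    · exact hadj
    · exact hpw
    · exact hrho

/-! ### The table of gluable multisets -/

/-- Gluing pieces of weights `x` and `y` leads from the code `M` to a code in the table `r`. -/
def GlueStep (n s : ℕ) (r : ℕ → ℕ) (M x y : ℕ) : Prop :=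
  x + y < s ∧ M / pw n x % n ≠ 0 ∧ (M - pw n x) / pw n y % n ≠ 0 ∧
    r (M + pw n (x + y) - pw n x - pw n y) ≠ 0

/-- Try to glue pieces of the weights in registers 12 and 13. -/
def glueBody : Prog :=
  .cond (ltT (reg 12 + reg 13) (reg 4))
    (.cond (andT (reg 11 / rd 2 (reg 12) % reg 0)
        (andT ((reg 11 - rd 2 (reg 12)) / rd 2 (reg 13) % reg 0)
          (rd 3 (reg 11 + rd 2 (reg 12 + reg 13) - rd 2 (reg 12) - rd 2 (reg 13)))))
      (put 3 (reg 11) (const 1)) .skip) .skip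

theorem pw_le {n s N L W t : ℕ} (hS : Size n s N L W) (ht : t < s) : pw n t ≤ N := by
  have := hS.two_le_n
  rw [hS.N_eq]
  obtain - | t := t
  · simp
  · rw [pw_succ]
    exact Nat.pow_le_pow_right (by omega) (by omega)

section glue

variable {W n s N L m τ : ℕ} {σ : State} {G : SimpleGraph (Fin n)} {ρ : Fin n → ℕ} {M x y : ℕ}
  {r : ℕ → ℕ}

/-- By `lt_glue` the code that is looked up exceeds `M`, so the answer comes from the fixed part `r`
of the table and not from the cell that is being determined. -/
theorem wp_glueBody (hS : Size n s N L W) (hE : Env n s N L m G ρ σ) (h11 : σ.reg 11 = M)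
    (hM : M < N) (h12 : σ.reg 12 = x) (h13 : σ.reg 13 = y)
    (hr : ∀ M' ≠ M, σ.mem (cell (n + n * n) 3 M') = r M') {P : Prop}
    (hP : σ.mem (cell (n + n * n) 3 M) ≠ 0 ↔ P) (hx : x < s) (hy : y < s) :
    wp W glueBody (fun σ' τ' => τ' ≤ τ + 100 ∧ (∀ M' ≠ M, σ'.mem (cell (n + n * n) 3 M') = r M') ∧
      (σ'.mem (cell (n + n * n) 3 M) ≠ 0 ↔ P ∨ GlueStep n s r M x y)) σ τ := by
  obtain ⟨f1, f2, f3, f4, f5, f6, f7, f8, f9, f10⟩ := hS.facts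
  have hn := hS.two_le_n
  have ex := hE.pw x hx
  have ey := hE.pw y hy
  refine wp_cond (fun hB => ?_) (fun hb => ?_) (fun hb => ?_)
  · simp only [fits_ltT' (show 1 ≤ W by omega), fits_add, fits_reg, hB.reg, true_and, eval_reg,
      h12, h13, hE.r4, and_true]
    omega
  · have hxy : x + y < s := by
      simpa [h12, h13, hE.r4] using hb
    have exy := hE.pw _ hxy
    have l1 := pw_le hS hxy
    have l2 := pw_le hS hx
    have l3 := pw_le hS hy
    refine wp_cond (fun hB => ?_) (fun hb => ?_) (fun hb => ?_)
    · simp only [fits_andT (show 1 ≤ W by omega), fits_add, fits_sub, fits_div, fits_mod, fits_rd,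
        fits_reg, hB.reg, hB.mem, true_and, eval_reg, eval_add, eval_rd, eval_sub, h11,
        h12, h13, hE.r4, hE.r2, and_true, ex, ey, exy]
      simp only [cell]
      omega
    · refine wp_put (fun hB => ?_) ⟨by simp, fun M' hM' => ?_, ?_⟩
      · simp only [fits_reg, hB.reg, fits_const, eval_reg, h11, hE.r2, cell, true_and]
        omega
      · simp only [State.write_mem, eval_reg, h11, hE.r2,
          cell_inj (show 3 < 16 by omega) (show 3 < 16 by omega), true_and]
        rw [if_neg hM', hr _ hM']
      · simp only [eval_andT, eval_mod, eval_div, eval_reg, eval_rd, eval_sub, eval_add, h11, h12,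
          h13, hE.r0, hE.r2, ex, ey, exy] at hb
        simp only [ne_eq, ite_eq_right_iff, one_ne_zero, imp_false, not_not, ite_eq_left_iff,
          not_and, not_forall] at hb
        obtain ⟨h1, h2, h3⟩ := hb
        have hlt := (lt_glue hn h1 h2).2.2.2
        simp only [State.write_mem, eval_reg, h11, hE.r2, if_true, eval_const, ne_eq, one_ne_zero,
          not_false_eq_true, true_iff]
        rw [hr _ (by omega)] at h3
        exact Or.inr ⟨hxy, h1, h2, h3⟩
    · refine wp_skip ⟨by simp, hr, ?_⟩
      rw [hP]
      refine ⟨Or.inl, ?_⟩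
      rintro (h | ⟨-, h1, h2, h3⟩)
      · exact h
      · exfalso
        have hlt := (lt_glue hn h1 h2).2.2.2
        simp only [eval_andT, eval_mod, eval_div, eval_reg, eval_rd, eval_sub, eval_add, h11, h12,
          h13, hE.r0, hE.r2, ex, ey, exy] at hb
        rw [hr _ (by omega)] at hb
        simp [h1, h2, h3] at hb
  · refine wp_skip ⟨by simp, hr, ?_⟩
    rw [hP]
    refine ⟨Or.inl, ?_⟩
    rintro (h | ⟨h, -⟩)
    · exact h
    · simp [h12, h13, hE.r4] at hb
      omega

/-- Try to glue a piece of the weight in register 12. -/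
def glueRow : Prog := forLoop 13 4 glueBody

theorem wp_glueRow (hS : Size n s N L W) (hE : Env n s N L m G ρ σ) (h11 : σ.reg 11 = M)
    (hM : M < N) (h12 : σ.reg 12 = x)
    (hr : ∀ M' ≠ M, σ.mem (cell (n + n * n) 3 M') = r M') {P : Prop}
    (hP : σ.mem (cell (n + n * n) 3 M) ≠ 0 ↔ P) (hx : x < s) :
    wp W glueRow (fun σ' τ' => τ' ≤ τ + (s * 108 + 6) ∧
      (∀ M' ≠ M, σ'.mem (cell (n + n * n) 3 M') = r M') ∧
      (σ'.mem (cell (n + n * n) 3 M) ≠ 0 ↔ P ∨ ∃ y, GlueStep n s r M x y)) σ τ := by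
  obtain ⟨f1, f2, f3, f4, f5, f6, f7, f8, f9, f10⟩ := hS.facts
  refine wp_forLoop (Z := n + n * n) [] [3]
    (fun j σ' => (∀ M' ≠ M, σ'.mem (cell (n + n * n) 3 M') = r M') ∧
      (σ'.mem (cell (n + n * n) 3 M) ≠ 0 ↔ P ∨ ∃ y < j, GlueStep n s r M x y))
    100 s hE.r4 (by omega) hE.r2 (by decide) (by decide) (by decide) (by decide) (by decide)
    (by decide) (fun j σ' v h => h) ⟨hr, by simpa using hP⟩ ?_ ?_
  · rintro j σ' τ' hj hF hij ⟨h1, h2⟩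
    refine wp_mono (wp_glueBody hS (hE.frame hF rfl rfl) ((hF.reg 11 rfl).trans h11) hM
      ((hF.reg 12 rfl).trans h12) hij h1 h2 hx hj) ?_
    rintro σ'' τ'' ⟨h3, h4, h5⟩
    refine ⟨h3, h4, h5.trans ?_⟩
    constructor
    · rintro ((h | ⟨y, h, h'⟩) | h)
      · exact Or.inl h
      · exact Or.inr ⟨y, by omega, h'⟩
      · exact Or.inr ⟨j, by omega, h⟩
    · rintro (h | ⟨y, h, h'⟩)
      · exact Or.inl (Or.inl h)
      · obtain h | rfl := Nat.lt_succ_iff_lt_or_eq.1 h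
        · exact Or.inl (Or.inr ⟨y, h, h'⟩)
        · exact Or.inr h'
  · rintro σ' τ' hF ⟨h1, h2⟩ hτ
    refine ⟨by omega, h1, h2.trans (or_congr_right ⟨fun ⟨y, _, h⟩ => ⟨y, h⟩, fun ⟨y, h⟩ => ⟨y, ?_, h⟩⟩)⟩
    have := h.1
    omega

/-- Decide whether the multiset with the code in register 11 is gluable. -/
def glueCell : Prog := forLoop 12 4 glueRow

theorem wp_glueCell (hS : Size n s N L W) (hE : Env n s N L m G ρ σ) (h11 : σ.reg 11 = M)
    (hM : M < N)
    (hr : ∀ M' ≠ M, σ.mem (cell (n + n * n) 3 M') = r M') {P : Prop}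
    (hP : σ.mem (cell (n + n * n) 3 M) ≠ 0 ↔ P) :
    wp W glueCell (fun σ' τ' => τ' ≤ τ + (s * (s * 108 + 14) + 6) ∧
      (∀ M' ≠ M, σ'.mem (cell (n + n * n) 3 M') = r M') ∧
      (σ'.mem (cell (n + n * n) 3 M) ≠ 0 ↔ P ∨ ∃ x y, GlueStep n s r M x y)) σ τ := by
  obtain ⟨f1, f2, f3, f4, f5, f6, f7, f8, f9, f10⟩ := hS.facts
  refine wp_forLoop (Z := n + n * n) [13] [3]
    (fun j σ' => (∀ M' ≠ M, σ'.mem (cell (n + n * n) 3 M') = r M') ∧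
      (σ'.mem (cell (n + n * n) 3 M) ≠ 0 ↔ P ∨ ∃ x < j, ∃ y, GlueStep n s r M x y))
    (s * 108 + 6) s hE.r4 (by omega) hE.r2 (by decide) (by decide) (by decide) (by decide)
    (by decide) (by decide) (fun j σ' v h => h) ⟨hr, by simpa using hP⟩ ?_ ?_
  · rintro j σ' τ' hj hF hij ⟨h1, h2⟩
    refine wp_mono (wp_glueRow hS (hE.frame hF rfl rfl) ((hF.reg 11 rfl).trans h11) hM
      hij h1 h2 hj) ?_
    rintro σ'' τ'' ⟨h3, h4, h5⟩
    refine ⟨h3, h4, h5.trans ?_⟩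
    constructor
    · rintro ((h | ⟨y, h, h'⟩) | h)
      · exact Or.inl h
      · exact Or.inr ⟨y, by omega, h'⟩
      · exact Or.inr ⟨j, by omega, h⟩
    · rintro (h | ⟨y, h, h'⟩)
      · exact Or.inl (Or.inl h)
      · obtain h | rfl := Nat.lt_succ_iff_lt_or_eq.1 h
        · exact Or.inl (Or.inr ⟨y, h, h'⟩)
        · exact Or.inr h'
  · rintro σ' τ' hF ⟨h1, h2⟩ hτ
    refine ⟨by omega, h1, h2.trans (or_congr_right ⟨fun ⟨x, _, h⟩ => ⟨x, h⟩,
      fun ⟨x, y, h⟩ => ⟨x, ?_, y, h⟩⟩)⟩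
    have := h.1
    omega

/-- Compute the table of gluable multisets in array 3. -/
def glueProg : Prog :=
  put 3 (reg 9) (const 1) ;;
    forLoop 10 5 (.assign 11 (reg 5 - const 1 - reg 10) ;; glueCell)

/-- The codes are treated from `N - 1` downwards. After `j` rounds the codes from `N - j` on satisfy
the recursion, and those below carry only the mark of the final multiset; later writes do not
disturb the former, as they concern smaller codes. -/
theorem wp_glueProg (hS : Size n s N L W) (hm : m < n) (hE : Env n s N L m G ρ σ)
    (h0 : ∀ M, σ.mem (cell (n + n * n) 3 M) = 0) :
    wp W glueProg (fun σ' τ' => Frame (n + n * n) [10, 11, 12, 13] [3] σ σ' ∧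
      GlueTable n s m (fun M => σ'.mem (cell (n + n * n) 3 M) ≠ 0) ∧
      τ' ≤ τ + 200 * (L * L)) σ τ := by
  obtain ⟨f1, f2, f3, f4, f5, f6, f7, f8, f9, f10⟩ := hS.facts
  have hn := hS.two_le_n
  have hs := hS.two_le_s
  have hfin := mul_pw_lt hs hm
  rw [← hS.N_eq] at hfin
  have hsN : N * (s * (s * 108 + 14) + 22) ≤ 160 * (L * L) := by
    have e1 : N * s ≤ L := by
      rw [hS.L_eq, show 2 * n * s * N = 2 * n * (N * s) by ring]
      exact Nat.le_mul_of_pos_left _ (by omega)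
    have e2 : N * s * s ≤ L * L := Nat.mul_le_mul e1 f3
    have e3 : N * (s * (s * 108 + 14) + 22) = N * s * s * 108 + N * s * 14 + N * 22 := by ring
    omega
  refine wp_mono (wp_frame hE.r2 (R := [10, 11, 12, 13]) (J := [3]) (by decide) (by decide)
    (wp_seq (wp_put (fun hB => ?_) (wp_forLoop (Z := n + n * n)
      (Q := fun σ' τ' => GlueTable n s m (fun M => σ'.mem (cell (n + n * n) 3 M) ≠ 0) ∧
        τ' ≤ τ + 200 * (L * L)) [11, 12, 13] [3]
    (fun j σ' => (∀ M, M < N - j → (σ'.mem (cell (n + n * n) 3 M) ≠ 0 ↔ M = m * pw n (s - 1))) ∧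
      (∀ M, M < N → N - j ≤ M → (σ'.mem (cell (n + n * n) 3 M) ≠ 0 ↔ M = m * pw n (s - 1) ∨
        ∃ x y, GlueStep n s (fun M => σ'.mem (cell (n + n * n) 3 M)) M x y)))
    (s * (s * 108 + 14) + 14) N hE.r5 (by omega) hE.r2 (by decide) (by decide) (by decide)
    (by decide) (by decide) (by decide) (fun j σ' v h => h) ?_ ?_ ?_)))) fun σ' τ' h => h
  · simp only [fits_reg, hB.reg, fits_const, eval_reg, hE.r9, hE.r2, cell, true_and]
    omega
  · have hmem : ∀ M, (σ.write (cell (n + n * n) 3 (m * pw n (s - 1))) 1).mem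
        (cell (n + n * n) 3 M) ≠ 0 ↔ M = m * pw n (s - 1) := by
      intro M
      simp only [State.write_mem, cell_inj (show 3 < 16 by omega) (show 3 < 16 by omega),
        true_and, h0]
      simp
    simp only [eval_reg, hE.r2, hE.r9, eval_const]
    exact ⟨fun M _ => hmem M, fun M h1 h2 => by omega⟩
  · rintro j σ' τ' hj hF hij ⟨h2, h3⟩
    have hE' : Env n s N L m G ρ (σ'.set 11 (N - 1 - j)) := by
      have : Env n s N L m G ρ (σ.write (cell (σ.reg 2) 3 ((reg 9).eval σ)) ((const 1).eval σ)) :=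
        hE.frame (R := []) (J := [3]) ⟨fun _ _ => rfl, fun j i h1 h2 => by
          simp only [State.write_mem, hE.r2, cell_inj h2 (show 3 < 16 by omega)]
          rw [if_neg]
          rintro ⟨rfl, -⟩
          simp at h1, fun a ha => by
          simp only [State.write_mem, hE.r2]
          rw [if_neg]
          unfold cell
          omega⟩ rfl rfl
      exact this.frame (hF.set (by decide)) rfl rfl
    have e5 : σ'.reg 5 = N := by
      have := hE'.r5
      rwa [State.set_reg, if_neg (by decide)] at this
    refine wp_seq (wp_assign (fun hB => by simp [hB.reg]; omega) ?_)
    simp only [eval_sub, eval_reg, eval_const, e5, hij]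
    refine wp_mono (wp_glueCell (M := N - 1 - j)
      (r := fun M => σ'.mem (cell (n + n * n) 3 M)) hS hE' (by simp) (by omega)
      (fun _ _ => rfl) (h2 (N - 1 - j) (by omega))) ?_
    rintro σ'' τ'' ⟨h4, h5, h6⟩
    have hstep : ∀ M x y, N - 1 - j ≤ M →
        (GlueStep n s (fun M => σ''.mem (cell (n + n * n) 3 M)) M x y ↔
          GlueStep n s (fun M => σ'.mem (cell (n + n * n) 3 M)) M x y) := by
      intro M x y hM
      unfold GlueStep
      refine and_congr_right fun _ => and_congr_right fun g1 => and_congr_right fun g2 => ?_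
      have := (lt_glue hn g1 g2).2.2.2
      show σ''.mem _ ≠ 0 ↔ _
      rw [h5 _ (by omega)]
    refine ⟨?_, fun M hM => ?_, fun M hM hM' => ?_⟩
    · simp at h4 ⊢; omega
    · rw [h5 M (by omega)]
      exact h2 M (by omega)
    · simp only [hstep M _ _ (show N - 1 - j ≤ M by omega)]
      by_cases hMj : M = N - 1 - j
      · rw [hMj]
        exact h6
      · rw [h5 M hMj]
        exact h3 M hM (by omega)
  · rintro σ' τ' hF ⟨h2, h3⟩ hτ
    refine ⟨⟨fun M h => ?_⟩, ?_⟩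
    · rw [← hS.N_eq] at h
      exact h3 M h (by omega)
    · rw [show s * (s * 108 + 14) + 14 + 8 = s * (s * 108 + 14) + 22 by ring] at hτ
      simp at hτ
      have : L ≤ L * L := by omega
      omega

end glue

/-! ### Merging two tables -/

theorem State.write_cell {σ : State} {Z j i v i' : ℕ} (hj : j < 16) :
    (σ.write (cell Z j i) v).mem (cell Z j i') = if i' = i then v else σ.mem (cell Z j i') := by
  simp only [State.write_mem, cell_inj hj hj, true_and]

theorem State.write_cell_ne {σ : State} {Z j i v i' j' : ℕ} (hj : j < 16) (hj' : j' < 16)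
    (h : j' ≠ j) : (σ.write (cell Z j i) v).mem (cell Z j' i') = σ.mem (cell Z j' i') := by
  simp only [State.write_mem, cell_inj hj' hj, h, false_and, if_false]

/-- The pair of entries `a`, `b` justifies the entry `z` at `x`. -/
def Justified (n s L e : ℕ) (a b x z : ℕ) : Prop :=
  (z = 1 + 2 * (a * L + b) ∧ a / (2 * n) % s + b / (2 * n) % s < s ∧ x = a + b + 2 * e) ∨
    (z = 2 + 2 * (a * L + b) ∧ x = cutCode n s a b)

/-- The table `T` arises by merging the pairs of entries that satisfy `P`. -/
structure MergedOn (n s L e : ℕ) (Ta Tb : ℕ → ℕ) (P : ℕ → ℕ → Prop) (T : ℕ → ℕ) : Prop where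
  sound : ∀ x < L, T x ≠ 0 → ∃ a < L, ∃ b < L, Ta a ≠ 0 ∧ Tb b ≠ 0 ∧ Justified n s L e a b x (T x)
  keep : ∀ a < L, ∀ b < L, P a b → Ta a ≠ 0 → Tb b ≠ 0 →
    a / (2 * n) % s + b / (2 * n) % s < s → a + b + 2 * e < L → T (a + b + 2 * e) ≠ 0
  cut : ∀ a < L, ∀ b < L, P a b → Ta a ≠ 0 → Tb b ≠ 0 → cutCode n s a b < L →
    T (cutCode n s a b) ≠ 0

section MergedOn

variable {n s L e : ℕ} {Ta Tb : ℕ → ℕ} {P Q : ℕ → ℕ → Prop} {T T' : ℕ → ℕ}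

theorem MergedOn.merged (h : MergedOn n s L e Ta Tb P T) (hP : ∀ a < L, ∀ b < L, P a b) :
    Merged n s L e Ta Tb T :=
  ⟨h.sound, fun a ha b hb => h.keep a ha b hb (hP a ha b hb),
    fun a ha b hb => h.cut a ha b hb (hP a ha b hb)⟩

theorem MergedOn.congr (h : MergedOn n s L e Ta Tb P T) (hPQ : ∀ a b, Q a b → P a b) :
    MergedOn n s L e Ta Tb Q T :=
  ⟨h.sound, fun a ha b hb hq => h.keep a ha b hb (hPQ a b hq),
    fun a ha b hb hq => h.cut a ha b hb (hPQ a b hq)⟩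

/-- An entry may be overwritten by another justified one: soundness asks for one valid pointer,
completeness only for a non-zero value. -/
theorem MergedOn.step (h : MergedOn n s L e Ta Tb P T) {x a b z : ℕ} (ha : a < L) (hb : b < L)
    (hTa : Ta a ≠ 0) (hTb : Tb b ≠ 0) (hz : z ≠ 0) (hj : Justified n s L e a b x z)
    (hT : T' x = z) (hT' : ∀ y, y ≠ x → T' y = T y) :
    MergedOn n s L e Ta Tb P T' := by
  have hne : ∀ y, T y ≠ 0 → T' y ≠ 0 := by
    intro y hy
    by_cases hyx : y = x
    · rw [hyx, hT]; exact hz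
    · rwa [hT' y hyx]
  refine ⟨fun y hy hy' => ?_, fun a ha b hb hp h1 h2 h3 h4 => hne _ (h.keep a ha b hb hp h1 h2 h3 h4),
    fun a ha b hb hp h1 h2 h3 => hne _ (h.cut a ha b hb hp h1 h2 h3)⟩
  by_cases hyx : y = x
  · subst hyx
    rw [hT]
    exact ⟨a, ha, b, hb, hTa, hTb, hj⟩
  · rw [hT' y hyx] at hy' ⊢
    exact h.sound y hy hy'

theorem MergedOn.add (h : MergedOn n s L e Ta Tb P T) {a b : ℕ}
    (h1 : Ta a ≠ 0 → Tb b ≠ 0 → a / (2 * n) % s + b / (2 * n) % s < s → a + b + 2 * e < L →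
      T (a + b + 2 * e) ≠ 0)
    (h2 : Ta a ≠ 0 → Tb b ≠ 0 → cutCode n s a b < L → T (cutCode n s a b) ≠ 0) :
    MergedOn n s L e Ta Tb (fun a' b' => P a' b' ∨ (a' = a ∧ b' = b)) T := by
  refine ⟨h.sound, ?_, ?_⟩
  · rintro a' ha b' hb (hp | ⟨rfl, rfl⟩)
    · exact h.keep a' ha b' hb hp
    · exact h1
  · rintro a' ha b' hb (hp | ⟨rfl, rfl⟩)
    · exact h.cut a' ha b' hb hp
    · exact h2

end MergedOn

/-- Enter `z` at position `x` of the current table if `b` holds. -/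
def guardPut (b x z : Term) : Prog := .cond b (put 4 (reg 20 + x) z) .skip

theorem wp_guardPut {W τ Z t X v : ℕ} {σ : State} {b x z : Term} {P : Prop}
    (hb : Bounded W σ → b.Fits W σ) (hP : b.eval σ ≠ 0 ↔ P) (h2 : σ.reg 2 = Z)
    (h20 : σ.reg 20 = t) (hx : x.eval σ = X) (hz : z.eval σ = v)
    (hfit : P → Bounded W σ → x.Fits W σ ∧ z.Fits W σ ∧ t + X ≤ W ∧
      cell Z 4 (t + X) ≤ W ∧ 16 ≤ W) :
    wp W (guardPut b x z) (fun σ' τ' => τ' ≤ τ + b.steps + x.steps + z.steps + 20 ∧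
      ((P ∧ σ' = σ.write (cell Z 4 (t + X)) v) ∨ (¬ P ∧ σ' = σ))) σ τ := by
  refine wp_cond hb (fun h => ?_) (fun h => ?_)
  · have hp := hP.1 h
    refine wp_put (fun hB => ?_) ⟨?_, ?_⟩
    · obtain ⟨g1, g2, g3, g4, g5⟩ := hfit hp hB
      simp only [fits_add, fits_reg, hB.reg, eval_add, eval_reg, h2, h20, hx]
      exact ⟨⟨by omega, g1, g3⟩, g2, g4, g5⟩
    · simp; omega
    · left
      simp [hp, h2, h20, hx, hz]
  · exact wp_skip ⟨by omega, Or.inr ⟨fun hp => hP.2 hp h, rfl⟩⟩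

/-- Merge the entries in registers 21 and 23. -/
def mergeBody : Prog :=
  .cond (andT (rd 4 (reg 18 + reg 21)) (rd 4 (reg 19 + reg 23)))
    (.assign 25 (const 2 * (reg 21 * reg 6 + reg 23)) ;;
      guardPut (andT (ltT (reg 22 + reg 23 / reg 7 % reg 4) (reg 4))
        (ltT (reg 21 + reg 23 + reg 17) (reg 6))) (reg 21 + reg 23 + reg 17)
        (const 1 + reg 25) ;;
      guardPut (ltT (reg 21 + reg 23 + reg 24 - reg 26) (reg 6))
        (reg 21 + reg 23 + reg 24 - reg 26) (const 2 + reg 25)) .skip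

/-- The two tables at `A` and `B` are merged to a table at `t`. -/
structure MergeEnv (L e A B t : ℕ) (σ : State) : Prop where
  r17 : σ.reg 17 = 2 * e
  r18 : σ.reg 18 = A
  r19 : σ.reg 19 = B
  r20 : σ.reg 20 = t

/-- The states agree on the tables before and after the table at `t`. -/
def SameTables (Z L t : ℕ) (σ σ' : State) : Prop :=
  ∀ y, (y < t ∨ t + L ≤ y) → σ'.mem (cell Z 4 y) = σ.mem (cell Z 4 y)

section merge

variable {W n s N L m τ e A B t a b : ℕ} {σ₀ σ : State} {G : SimpleGraph (Fin n)} {ρ : Fin n → ℕ}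

theorem MergeEnv.frame {σ' : State} (h : MergeEnv L e A B t σ) {Z : ℕ} {R J : List ℕ}
    (hF : Frame Z R J σ σ')
    (hR : (!R.contains 17 && !R.contains 18 && !R.contains 19 && !R.contains 20) = true) :
    MergeEnv L e A B t σ' := by
  simp only [Bool.and_eq_true, Bool.not_eq_true'] at hR
  obtain ⟨⟨⟨h1, h2⟩, h3⟩, h4⟩ := hR
  exact ⟨(hF.reg _ h1).trans h.r17, (hF.reg _ h2).trans h.r18, (hF.reg _ h3).trans h.r19,
    (hF.reg _ h4).trans h.r20⟩

theorem SameTables.write {Z X v : ℕ} (h : SameTables Z L t σ₀ σ) (hX : X < L) :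
    SameTables Z L t σ₀ (σ.write (cell Z 4 (t + X)) v) := by
  intro y hy
  rw [State.write_cell (by omega), if_neg (by omega), h y hy]

theorem write_table {Z X v : ℕ} (x : ℕ) : (σ.write (cell Z 4 (t + X)) v).mem (cell Z 4 (t + x)) =
    if x = X then v else σ.mem (cell Z 4 (t + x)) := by
  rw [State.write_cell (by omega)]
  simp only [Nat.add_left_cancel_iff]

theorem wp_mergeBody (hS : Size n s N L W) (hE : Env n s N L m G ρ σ)
    (hM : MergeEnv L e A B t σ) (he : e ≤ 1) (hA : A + L ≤ t) (hB : B + L ≤ t)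
    (ht : t + L ≤ 2 * (n * L)) (ha : a < L) (hb : b < L) (h21 : σ.reg 21 = a) (h23 : σ.reg 23 = b)
    (h22 : σ.reg 22 = a / (2 * n) % s)
    (h24 : σ.reg 24 = 2 * n * (s * pw n (a / (2 * n) % s)))
    (h26 : σ.reg 26 = 2 * n * (a / (2 * n) % s)) (hs : SameTables (n + n * n) L t σ₀ σ)
    {P : ℕ → ℕ → Prop}
    (hP : MergedOn n s L e (fun x => σ₀.mem (cell (n + n * n) 4 (A + x)))
      (fun x => σ₀.mem (cell (n + n * n) 4 (B + x))) P
      (fun x => σ.mem (cell (n + n * n) 4 (t + x)))) :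
    wp W mergeBody (fun σ' τ' => τ' ≤ τ + 200 ∧ SameTables (n + n * n) L t σ₀ σ' ∧
      MergedOn n s L e (fun x => σ₀.mem (cell (n + n * n) 4 (A + x)))
        (fun x => σ₀.mem (cell (n + n * n) 4 (B + x))) (fun a' b' => P a' b' ∨ (a' = a ∧ b' = b))
        (fun x => σ'.mem (cell (n + n * n) 4 (t + x)))) σ τ := by
  obtain ⟨f1, f2, f3, f4, f5, f6, f7, f8, f9, f10⟩ := hS.facts
  have hn := hS.two_le_n
  have hs2 := hS.two_le_s
  have eA : σ.mem (cell (n + n * n) 4 (A + a)) = σ₀.mem (cell (n + n * n) 4 (A + a)) :=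
    hs _ (by omega)
  have eB : σ.mem (cell (n + n * n) 4 (B + b)) = σ₀.mem (cell (n + n * n) 4 (B + b)) :=
    hs _ (by omega)
  have l1 : a * L + b + 1 ≤ L * L := by
    have : (a + 1) * L ≤ L * L := Nat.mul_le_mul_right _ ha
    have e1 : (a + 1) * L = a * L + L := by ring
    omega
  have hh : a / (2 * n) % s < s := Nat.mod_lt _ (by omega)
  have hw : b / (2 * n) % s < s := Nat.mod_lt _ (by omega)
  have l2 : 2 * n * (s * pw n (a / (2 * n) % s)) ≤ L := by
    rw [hS.L_eq, mul_assoc (2 * n)]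
    exact Nat.mul_le_mul_left _ (Nat.mul_le_mul_left _ (pw_le hS hh))
  have l3 : L * L ≥ L := by omega
  have hN := pow_pos (show 0 < n by omega) (s - 1)
  rw [← hS.N_eq] at hN
  have l5 : 2 * n * (a / (2 * n) % s) ≤ L := by
    rw [hS.L_eq]
    exact le_trans (Nat.mul_le_mul_left _ hh.le) (Nat.le_mul_of_pos_right _ hN)
  have hcut : a + b + 2 * n * (s * pw n (a / (2 * n) % s)) - 2 * n * (a / (2 * n) % s)
      = cutCode n s a b := rfl
  refine wp_cond (fun hB => ?_) (fun h => ?_) (fun h => ?_)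
  · simp only [fits_andT (show 1 ≤ W by omega), fits_rd, fits_add, fits_reg, hB.reg, hB.mem,
      eval_add, eval_reg, hM.r18, hM.r19, h21, h23, hE.r2, true_and, and_true]
    simp only [cell]
    omega
  · simp only [eval_andT, eval_rd, eval_add, eval_reg, hE.r2, hM.r18, hM.r19, h21, h23, eA, eB,
      ne_eq, ite_eq_right_iff, one_ne_zero, imp_false, not_not] at h
    refine wp_seq (wp_assign (fun hB => ?_) ?_)
    · simp only [fits_mul, fits_const, fits_add, fits_reg, hB.reg, eval_const, eval_add, eval_mul,
        eval_reg, h21, h23, hE.r6, true_and]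
      omega
    simp only [eval_mul, eval_const, eval_add, eval_reg, h21, h23, hE.r6]
    set σ1 := σ.set 25 (2 * (a * L + b)) with hσ1
    have hF : Frame (n + n * n) [25] [] σ σ1 := (Frame.refl _ _ _ _).set (by decide)
    have g17 : σ1.reg 17 = 2 * e := (hF.reg 17 rfl).trans hM.r17
    have g20 : σ1.reg 20 = t := (hF.reg 20 rfl).trans hM.r20
    have g21 : σ1.reg 21 = a := (hF.reg 21 rfl).trans h21
    have g22 := (hF.reg 22 rfl).trans h22
    have g23 : σ1.reg 23 = b := (hF.reg 23 rfl).trans h23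
    have g24 := (hF.reg 24 rfl).trans h24
    have g26 := (hF.reg 26 rfl).trans h26
    have g2 : σ1.reg 2 = n + n * n := (hF.reg 2 rfl).trans hE.r2
    have g4 : σ1.reg 4 = s := (hF.reg 4 rfl).trans hE.r4
    have g6 : σ1.reg 6 = L := (hF.reg 6 rfl).trans hE.r6
    have g7 : σ1.reg 7 = 2 * n := (hF.reg 7 rfl).trans hE.r7
    have g25 : σ1.reg 25 = 2 * (a * L + b) := by simp [hσ1]
    have hs1 : SameTables (n + n * n) L t σ₀ σ1 := hs
    have hP1 : MergedOn n s L e (fun x => σ₀.mem (cell (n + n * n) 4 (A + x)))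
      (fun x => σ₀.mem (cell (n + n * n) 4 (B + x))) P
      (fun x => σ1.mem (cell (n + n * n) 4 (t + x))) := hP
    refine wp_seq (wp_mono (wp_guardPut (Z := n + n * n) (t := t) (X := a + b + 2 * e)
      (v := 1 + 2 * (a * L + b))
      (P := a / (2 * n) % s + b / (2 * n) % s < s ∧ a + b + 2 * e < L)
      (fun hB => ?_) ?_ g2 g20 ?_ ?_ (fun hp hB => ?_)) ?_)
    · simp only [fits_andT (show 1 ≤ W by omega), fits_ltT' (show 1 ≤ W by omega), fits_add,
        fits_mod, fits_div, fits_reg, hB.reg, eval_add, eval_mod, eval_div, eval_reg, g17, g21,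
        g22, g23, g4, g7, true_and, and_true]
      omega
    · simp [g17, g21, g22, g23, g4, g6, g7]
    · simp [g17, g21, g23]
    · simp [g25]
    · simp only [fits_add, fits_reg, fits_const, hB.reg, eval_add, eval_reg, eval_const, g17, g21,
        g23, g25, true_and, and_true, cell]
      omega
    rintro σ2 τ2 ⟨hτ2, hσ2⟩
    have r2 : σ2.reg = σ1.reg := by rcases hσ2 with ⟨-, rfl⟩ | ⟨-, rfl⟩ <;> rfl
    have hs2 : SameTables (n + n * n) L t σ₀ σ2 := by
      rcases hσ2 with ⟨hp, rfl⟩ | ⟨-, rfl⟩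
      · exact hs1.write hp.2
      · exact hs1
    have hP2 : MergedOn n s L e (fun x => σ₀.mem (cell (n + n * n) 4 (A + x)))
        (fun x => σ₀.mem (cell (n + n * n) 4 (B + x))) P
        (fun x => σ2.mem (cell (n + n * n) 4 (t + x))) := by
      rcases hσ2 with ⟨hp, rfl⟩ | ⟨-, rfl⟩
      · refine hP1.step (x := a + b + 2 * e) (z := 1 + 2 * (a * L + b)) ha hb h.1 h.2 (by omega)
          (Or.inl ⟨rfl, hp.1, rfl⟩) ?_ fun y hy => ?_
        · rw [write_table, if_pos rfl]
        · rw [write_table, if_neg hy]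
      · exact hP1
    have hk2 : a / (2 * n) % s + b / (2 * n) % s < s → a + b + 2 * e < L →
        σ2.mem (cell (n + n * n) 4 (t + (a + b + 2 * e))) ≠ 0 := by
      intro k1 k2
      rcases hσ2 with ⟨-, rfl⟩ | ⟨hp, -⟩
      · rw [write_table, if_pos rfl]
        omega
      · exact absurd ⟨k1, k2⟩ hp
    refine wp_mono (wp_guardPut (Z := n + n * n) (t := t) (X := cutCode n s a b)
      (v := 2 + 2 * (a * L + b)) (P := cutCode n s a b < L)
      (fun hB => ?_) ?_ (by rw [r2, g2]) (by rw [r2, g20]) ?_ ?_ (fun hp hB => ?_)) ?_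
    · simp only [fits_ltT' (show 1 ≤ W by omega), fits_add, fits_sub,
        fits_mod, fits_div, fits_reg, hB.reg, eval_add, eval_mod, eval_div, eval_reg, r2, g24, g21,
        g26, g23, g6, true_and, and_true]
      omega
    · simp [r2, g21, g23, g24, g26, g6, hcut]
    · simp [r2, g21, g23, g24, g26, hcut]
    · simp [r2, g25]
    · simp only [fits_add, fits_sub, fits_reg, fits_const, hB.reg, eval_add, eval_reg, eval_const,
        r2, g24, g21, g23, g25, true_and, and_true, cell]
      omega
    rintro σ3 τ3 ⟨hτ3, hσ3⟩
    refine ⟨?_, ?_, MergedOn.add ?_ ?_ ?_⟩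
    · simp at hτ2 hτ3 ⊢
      omega
    · rcases hσ3 with ⟨hp, rfl⟩ | ⟨-, rfl⟩
      · exact hs2.write hp
      · exact hs2
    · rcases hσ3 with ⟨hp, rfl⟩ | ⟨-, rfl⟩
      · refine hP2.step (x := cutCode n s a b) (z := 2 + 2 * (a * L + b)) ha hb h.1 h.2 (by omega)
          (Or.inr ⟨rfl, rfl⟩) ?_ fun y hy => ?_
        · rw [write_table, if_pos rfl]
        · rw [write_table, if_neg hy]
      · exact hP2
    · intro _ _ k1 k2
      rcases hσ3 with ⟨hp, rfl⟩ | ⟨-, rfl⟩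
      -- The entry for the cut may have replaced the one for the join at the same position; it is
      -- non-zero as well.
      · rw [write_table]
        split
        · omega
        · exact hk2 k1 k2
      · exact hk2 k1 k2
    · intro _ _ k1
      rcases hσ3 with ⟨hp, rfl⟩ | ⟨hp, -⟩
      · rw [write_table, if_pos rfl]
        omega
      · exact absurd k1 hp
  · refine wp_skip ⟨by simp, hs, hP.add (fun h1 h2 => ?_) fun h1 h2 => ?_⟩ <;>
    · exfalso
      simp [hE.r2, hM.r18, hM.r19, h21, h23, eA, eB] at h
      exact h2 (h h1)

/-- Merge the entry in register 21 with all entries of the second table. -/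
def mergeRow : Prog :=
  .assign 22 (reg 21 / reg 7 % reg 4) ;;
    .assign 24 (reg 7 * (reg 4 * rd 2 (reg 22))) ;; .assign 26 (reg 7 * reg 22) ;;
    forLoop 23 6 mergeBody

theorem wp_mergeRow (hS : Size n s N L W) (hE : Env n s N L m G ρ σ)
    (hM : MergeEnv L e A B t σ) (he : e ≤ 1) (hA : A + L ≤ t) (hB : B + L ≤ t)
    (ht : t + L ≤ 2 * (n * L)) (ha : a < L) (h21 : σ.reg 21 = a)
    (hs : SameTables (n + n * n) L t σ₀ σ)
    (hP : MergedOn n s L e (fun x => σ₀.mem (cell (n + n * n) 4 (A + x)))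
      (fun x => σ₀.mem (cell (n + n * n) 4 (B + x))) (fun a' _ => a' < a)
      (fun x => σ.mem (cell (n + n * n) 4 (t + x)))) :
    wp W mergeRow (fun σ' τ' => τ' ≤ τ + (L * 208 + 50) ∧ SameTables (n + n * n) L t σ₀ σ' ∧
      MergedOn n s L e (fun x => σ₀.mem (cell (n + n * n) 4 (A + x)))
        (fun x => σ₀.mem (cell (n + n * n) 4 (B + x))) (fun a' _ => a' < a + 1)
        (fun x => σ'.mem (cell (n + n * n) 4 (t + x)))) σ τ := by
  obtain ⟨f1, f2, f3, f4, f5, f6, f7, f8, f9, f10⟩ := hS.facts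
  have hn := hS.two_le_n
  have hs2 := hS.two_le_s
  have hh : a / (2 * n) % s < s := Nat.mod_lt _ (by omega)
  have ew := hE.pw _ hh
  have hL := hS.L_eq
  have hpw := pw_le hS hh
  have hN := pow_pos (show 0 < n by omega) (s - 1)
  rw [← hS.N_eq] at hN
  have l1 : s * pw n (a / (2 * n) % s) ≤ s * N := Nat.mul_le_mul_left _ hpw
  have l2 : 2 * n * (s * pw n (a / (2 * n) % s)) ≤ L := by
    rw [hS.L_eq, mul_assoc (2 * n)]
    exact Nat.mul_le_mul_left _ l1
  have l4 : s * N ≤ L := by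
    rw [hS.L_eq, mul_assoc (2 * n)]
    exact Nat.le_mul_of_pos_left _ (by omega)
  have l3 : 2 * n * (a / (2 * n) % s) ≤ L := by
    rw [hS.L_eq]
    exact le_trans (Nat.mul_le_mul_left _ hh.le) (Nat.le_mul_of_pos_right _ hN)
  refine wp_seq (wp_assign (fun hB => by simp [hB.reg]) (wp_seq (wp_assign (fun hB => ?_)
    (wp_seq (wp_assign (fun hB => ?_) ?_)))))
  · simp only [fits_mul, fits_reg, fits_rd, hB.reg, hB.mem, eval_mul, eval_rd, eval_reg, eval_mod,
      eval_div, State.set_reg, State.set_mem]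
    simp only [Nat.reduceEqDiff, if_true, if_false, hE.r2, hE.r4, hE.r7, h21,
      ew, true_and, and_true]
    simp only [cell]
    omega
  · simp only [fits_mul, fits_reg, hB.reg, eval_mul, eval_reg, eval_mod, eval_rd,
      eval_div, State.set_reg, State.set_mem]
    simp only [Nat.reduceEqDiff, if_true, if_false, hE.r2, hE.r4, hE.r7, h21,
      ew, true_and, and_true]
    omega
  simp only [eval_mod, eval_div, eval_reg, eval_mul, eval_rd, State.set_reg, State.set_mem,
    Nat.reduceEqDiff, if_true, if_false, hE.r2, hE.r4, hE.r7, h21, ew]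
  set σ1 := ((σ.set 22 (a / (2 * n) % s)).set 24 (2 * n * (s * pw n (a / (2 * n) % s)))).set 26
    (2 * n * (a / (2 * n) % s)) with hσ1
  have hF1 : Frame (n + n * n) [22, 24, 26] [] σ σ1 :=
    (((Frame.refl _ _ _ _).set (by decide)).set (by decide)).set (by decide)
  have hE1 := hE.frame hF1 rfl rfl
  have hM1 := hM.frame hF1 rfl
  have g21 := (hF1.reg 21 rfl).trans h21
  have g22 : σ1.reg 22 = a / (2 * n) % s := by simp [hσ1, State.set_reg]
  have g24 : σ1.reg 24 = 2 * n * (s * pw n (a / (2 * n) % s)) := by simp [hσ1, State.set_reg]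
  have g26 : σ1.reg 26 = 2 * n * (a / (2 * n) % s) := by simp [hσ1, State.set_reg]
  refine wp_forLoop (Z := n + n * n) [25] [4]
    (fun j σ' => SameTables (n + n * n) L t σ₀ σ' ∧
      MergedOn n s L e (fun x => σ₀.mem (cell (n + n * n) 4 (A + x)))
        (fun x => σ₀.mem (cell (n + n * n) 4 (B + x))) (fun a' b' => a' < a ∨ (a' = a ∧ b' < j))
        (fun x => σ'.mem (cell (n + n * n) 4 (t + x))))
    200 L hE1.r6 (by omega) hE1.r2 (by decide) (by decide) (by decide) (by decide) (by decide)
    (by decide) (fun j σ' v h => h) ⟨hs, hP.congr (by simp)⟩ ?_ ?_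
  · rintro j σ' τ' hj hF hij ⟨h1, h2⟩
    refine wp_mono (wp_mergeBody (σ₀ := σ₀) hS (hE1.frame hF rfl rfl) (hM1.frame hF rfl) he hA hB ht
      ha hj ((hF.reg 21 rfl).trans g21) hij ((hF.reg 22 rfl).trans g22)
      ((hF.reg 24 rfl).trans g24) ((hF.reg 26 rfl).trans g26) h1 h2) ?_
    rintro σ2 τ2 ⟨h3, h4, h5⟩
    exact ⟨h3, h4, h5.congr fun a' b' h => by omega⟩
  · rintro σ' τ' hF ⟨h1, h2⟩ hτ
    refine ⟨?_, h1, ⟨h2.sound, fun a' ha' b' hb' hp => h2.keep a' ha' b' hb' (by omega),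
      fun a' ha' b' hb' hp => h2.cut a' ha' b' hb' (by omega)⟩⟩
    simp at hτ
    omega

/-- Merge two tables. -/
def mergeProg : Prog := forLoop 21 6 mergeRow

theorem wp_mergeProg (hS : Size n s N L W) (hE : Env n s N L m G ρ σ)
    (hM : MergeEnv L e A B t σ) (he : e ≤ 1) (hA : A + L ≤ t) (hB : B + L ≤ t)
    (ht : t + L ≤ 2 * (n * L)) (h0 : ∀ x < L, σ.mem (cell (n + n * n) 4 (t + x)) = 0) :
    wp W mergeProg (fun σ' τ' => Frame (n + n * n) [21, 22, 23, 24, 25, 26] [4] σ σ' ∧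
      SameTables (n + n * n) L t σ σ' ∧
      Merged n s L e (fun x => σ.mem (cell (n + n * n) 4 (A + x)))
        (fun x => σ.mem (cell (n + n * n) 4 (B + x)))
        (fun x => σ'.mem (cell (n + n * n) 4 (t + x))) ∧ τ' ≤ τ + 300 * (L * L)) σ τ := by
  obtain ⟨f1, f2, f3, f4, f5, f6, f7, f8, f9, f10⟩ := hS.facts
  refine wp_forLoop (Z := n + n * n) [22, 23, 24, 25, 26] [4]
    (fun j σ' => SameTables (n + n * n) L t σ σ' ∧
      MergedOn n s L e (fun x => σ.mem (cell (n + n * n) 4 (A + x)))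
        (fun x => σ.mem (cell (n + n * n) 4 (B + x))) (fun a' _ => a' < j)
        (fun x => σ'.mem (cell (n + n * n) 4 (t + x))))
    (L * 208 + 50) L hE.r6 (by omega) hE.r2 (by decide) (by decide) (by decide) (by decide)
    (by decide) (by decide) (fun j σ' v h => h)
    ⟨fun _ _ => rfl, fun x hx h => absurd (h0 x hx) h, by simp, by simp⟩ ?_ ?_
  · rintro j σ' τ' hj hF hij ⟨h1, h2⟩
    exact wp_mergeRow hS (hE.frame hF rfl rfl) (hM.frame hF rfl) he hA hB ht hj hij h1 h2
  · rintro σ' τ' hF ⟨h1, h2⟩ hτ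
    refine ⟨hF.mono (by simp) (by simp), h1, h2.merged fun a ha b hb => ha, ?_⟩
    have e1 : L * (L * 208 + 50 + 8) = 208 * (L * L) + 58 * L := by ring
    have e2 : 16 * L ≤ L * L := Nat.mul_le_mul_right _ f8
    omega

end merge

/-! ### Search for a leaf -/

/-- Inequality test. -/
def Term.neT (x y : Term) : Term := eqT (eqT x y) (const 0)

@[simp] theorem Term.eval_neT (s : State) (x y : Term) :
    (neT x y).eval s = if x.eval s ≠ y.eval s then 1 else 0 := by
  simp only [neT, eval_eqT, eval_const]
  split <;> simp_all

@[simp] theorem Term.steps_neT (x y : Term) : (neT x y).steps = x.steps + y.steps + 3 := by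
  simp [neT]

theorem Term.fits_neT {W : ℕ} (hW : 1 ≤ W) (s : State) (x y : Term) :
    (neT x y).Fits W s ↔ x.Fits W s ∧ y.Fits W s := by
  rw [neT, fits_eqT' hW, fits_eqT' hW]
  simp

/-- Clear register 13 if the vertex in register 14 is an obstacle. -/
def leafTest : Prog :=
  .cond (andT (eqT (rd 6 (reg 14)) (const 0)) (andT (neT (reg 14) (reg 12))
    (load (reg 0 + reg 11 * reg 0 + reg 14)))) (.assign 13 (const 0)) .skip

/-- Test the vertices in registers 11 and 12. -/
def leafBody : Prog :=
  .assign 13 (andT (eqT (rd 6 (reg 11)) (const 0)) (andT (eqT (rd 6 (reg 12)) (const 0))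
    (neT (reg 11) (reg 12)))) ;;
    forLoop 14 0 leafTest ;;
    .cond (reg 13) (.assign 15 (reg 11) ;; .assign 16 (reg 12)) .skip

/-- Find two vertices that can be merged. -/
def leafProg : Prog := forLoop 11 0 (forLoop 12 0 leafBody)

theorem adj01_ne_zero {n : ℕ} {G : SimpleGraph (Fin n)} {u v : Fin n} :
    adj01 G u v ≠ 0 ↔ G.Adj u v := by
  unfold adj01
  split <;> simp_all

/-- The registers 15 and 16 hold vertices that can be merged. -/
def Found {n : ℕ} (G : SimpleGraph (Fin n)) (β : Fin n → Fin n) (σ : State) : Prop :=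
  ∃ v p : Fin n, σ.reg 15 = v ∧ σ.reg 16 = p ∧ Elim G β v p

section leaf

variable {W n s N L m τ : ℕ} {σ : State} {G : SimpleGraph (Fin n)} {ρ : Fin n → ℕ}
  {β : Fin n → Fin n}

theorem wp_leafBody (hS : Size n s N L W) (hE : Env n s N L m G ρ σ)
    (hd : ∀ w : Fin n, σ.mem (cell (n + n * n) 6 w) = 0 ↔ β w = w) {v p : Fin n}
    (h11 : σ.reg 11 = v) (h12 : σ.reg 12 = p) {P : Fin n → Fin n → Prop}
    (hP : Found G β σ ∨ ∀ v p, P v p → ¬ Elim G β v p) :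
    wp W leafBody (fun σ' τ' => τ' ≤ τ + (n * 108 + 100) ∧ (Found G β σ' ∨
      ∀ v' p', P v' p' ∨ (v' = v ∧ p' = p) → ¬ Elim G β v' p')) σ τ := by
  obtain ⟨f1, f2, f3, f4, f5, f6, f7, f8, f9, f10⟩ := hS.facts
  have hn := hS.two_le_n
  have hv := v.2
  have hp := p.2
  refine wp_seq (wp_assign (fun hB => ?_) (wp_seq ?_))
  · simp only [fits_andT (show 1 ≤ W by omega), fits_eqT' (show 1 ≤ W by omega),
      fits_neT (show 1 ≤ W by omega), fits_rd, fits_reg, fits_const, hB.reg, hB.mem, eval_reg,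
      hE.r2, h11, h12, true_and, and_true]
    simp only [cell]
    omega
  simp only [eval_andT, eval_eqT, eval_neT, eval_rd, eval_reg, eval_const, h11, h12, hE.r2]
  set σ1 := σ.set 13 (if (if σ.mem (cell (n + n * n) 6 v) = 0 then 1 else 0) ≠ 0 ∧
    (if (if σ.mem (cell (n + n * n) 6 p) = 0 then 1 else 0) ≠ 0 ∧
      (if (v : ℕ) ≠ p then 1 else 0) ≠ 0 then 1 else 0) ≠ 0 then 1 else 0) with hσ1
  have hF1 : Frame (n + n * n) [13] [] σ σ1 := (Frame.refl _ _ _ _).set (by decide)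
  have hE1 := hE.frame hF1 rfl rfl
  have g13 : σ1.reg 13 ≠ 0 ↔ β v = v ∧ β p = p ∧ v ≠ p := by
    rw [hσ1, State.set_reg_self]
    simp [hd, Fin.ext_iff]
  refine wp_forLoop (Z := n + n * n) [13] []
    (fun j σ' => σ'.reg 13 ≠ 0 ↔ (β v = v ∧ β p = p ∧ v ≠ p) ∧
      ∀ w : Fin n, (w : ℕ) < j → β w = w → w ≠ p → ¬ G.Adj v w)
    100 n hE1.r0 (by omega) hE1.r2 (by decide) (by decide) (by decide) (by decide) (by decide)
    (by decide) (fun j σ' v h => by simpa [State.set_reg] using h) (by rw [g13]; simp) ?_ ?_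
  · intro j σ' τ' hj hF hij hI
    have hE2 := hE1.frame hF rfl rfl
    have k11 : σ'.reg 11 = v := (hF.reg 11 rfl).trans ((hF1.reg 11 rfl).trans h11)
    have k12 : σ'.reg 12 = p := (hF.reg 12 rfl).trans ((hF1.reg 12 rfl).trans h12)
    have kd : σ'.mem (cell (n + n * n) 6 j) = 0 ↔ β ⟨j, hj⟩ = ⟨j, hj⟩ := by
      rw [hF.arr 6 j rfl (by omega), hF1.arr 6 j rfl (by omega)]
      exact hd ⟨j, hj⟩
    have ka := hE2.adj v ⟨j, hj⟩
    simp only at ka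
    have hvn : n + v * n + j < n + n * n := index_lt v ⟨j, hj⟩
    have hstep : (∀ w : Fin n, (w : ℕ) < j + 1 → β w = w → w ≠ p → ¬ G.Adj v w) ↔
        (∀ w : Fin n, (w : ℕ) < j → β w = w → w ≠ p → ¬ G.Adj v w) ∧
          ¬ (β ⟨j, hj⟩ = ⟨j, hj⟩ ∧ (⟨j, hj⟩ : Fin n) ≠ p ∧ G.Adj v ⟨j, hj⟩) := by
      constructor
      · exact fun h => ⟨fun w hw => h w (by omega), fun ⟨h1, h2, h3⟩ =>
          h ⟨j, hj⟩ (by simp) h1 h2 h3⟩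
      · rintro ⟨h1, h2⟩ w hw h3 h4 h5
        by_cases hwj : (w : ℕ) = j
        · obtain rfl : w = ⟨j, hj⟩ := Fin.ext hwj
          exact h2 ⟨h3, h4, h5⟩
        · exact h1 w (by omega) h3 h4 h5
    have hg : (andT (eqT (rd 6 (reg 14)) (const 0)) (andT (neT (reg 14) (reg 12))
        (load (reg 0 + reg 11 * reg 0 + reg 14)))).eval σ' ≠ 0 ↔
        β ⟨j, hj⟩ = ⟨j, hj⟩ ∧ (⟨j, hj⟩ : Fin n) ≠ p ∧ G.Adj v ⟨j, hj⟩ := by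
      simp only [eval_andT, eval_eqT, eval_neT, eval_rd, eval_load, eval_add, eval_mul, eval_reg,
        eval_const, k11, k12, hij, hE2.r2, hE2.r0, ka, kd]
      rw [← adj01_ne_zero]
      simp [Fin.ext_iff]
    refine wp_cond (fun hB => ?_) (fun h => ?_) (fun h => ?_)
    · simp only [fits_andT (show 1 ≤ W by omega), fits_eqT' (show 1 ≤ W by omega),
        fits_neT (show 1 ≤ W by omega), fits_rd, fits_load, fits_add, fits_mul, fits_reg,
        fits_const, hB.reg, hB.mem, eval_reg, eval_add, eval_mul, hE2.r2, hE2.r0, k11, k12, hij,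
        true_and, and_true]
      simp only [cell]
      omega
    · refine wp_assign (fun hB => by simp) ⟨by simp, ?_⟩
      have h' := hg.1 h
      rw [hstep]
      simp only [State.set_reg_self, eval_const, ne_eq, not_true_eq_false, false_iff]
      exact fun hc => hc.2.2 h'
    · refine wp_skip ⟨by simp, ?_⟩
      have h' := fun hc => hg.2 hc h
      rw [hstep, hI]
      exact ⟨fun hc => ⟨hc.1, hc.2, h'⟩, fun hc => ⟨hc.1, hc.2.1⟩⟩
  · intro σ' τ' hF hI hτ
    have hstep : σ'.reg 13 ≠ 0 ↔ Elim G β v p := by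
      rw [hI]
      exact ⟨fun ⟨⟨h1, h2, h3⟩, h4⟩ => ⟨h1, h2, h3, fun w => h4 w w.2⟩,
        fun h => ⟨⟨h.left, h.right, h.ne⟩, fun w _ => h.adj w⟩⟩
    have k11 : σ'.reg 11 = v := (hF.reg 11 rfl).trans ((hF1.reg 11 rfl).trans h11)
    have k12 : σ'.reg 12 = p := (hF.reg 12 rfl).trans ((hF1.reg 12 rfl).trans h12)
    have k15 : σ'.reg 15 = σ.reg 15 := (hF.reg 15 rfl).trans (hF1.reg 15 rfl)
    have k16 : σ'.reg 16 = σ.reg 16 := (hF.reg 16 rfl).trans (hF1.reg 16 rfl)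
    simp at hτ
    refine wp_cond (fun hB => by simp [hB.reg]) (fun h => ?_) (fun h => ?_)
    · refine wp_seq (wp_assign (fun hB => hB.reg _) (wp_assign (fun hB => hB.reg _) ⟨by simp; omega, Or.inl ⟨v, p, ?_, ?_, hstep.1 h⟩⟩))
      · simp [State.set_reg, k11]
      · simp [State.set_reg, k12]
    · refine wp_skip ⟨by simp; omega, ?_⟩
      rcases hP with ⟨v', p', h1, h2, h3⟩ | hP
      · exact Or.inl ⟨v', p', k15.trans h1, k16.trans h2, h3⟩
      · right
        rintro v' p' (h1 | ⟨rfl, rfl⟩)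
        · exact hP v' p' h1
        · exact fun h2 => hstep.2 h2 h

/-- Exhaustive search. Its cubic time is of the order of `n * L` because `n * n ≤ L`, and `hex`
excludes the case that nothing was found. -/
theorem wp_leafProg (hS : Size n s N L W) (hE : Env n s N L m G ρ σ)
    (hd : ∀ w : Fin n, σ.mem (cell (n + n * n) 6 w) = 0 ↔ β w = w)
    (hex : ∃ v p, Elim G β v p) :
    wp W leafProg (fun σ' τ' => Frame (n + n * n) [11, 12, 13, 14, 15, 16] [] σ σ' ∧
      Found G β σ' ∧ τ' ≤ τ + 200 * (n * L)) σ τ := by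
  obtain ⟨f1, f2, f3, f4, f5, f6, f7, f8, f9, f10⟩ := hS.facts
  have hn := hS.two_le_n
  refine wp_forLoop (Z := n + n * n) [12, 13, 14, 15, 16] []
    (fun j σ' => Found G β σ' ∨ ∀ v p : Fin n, (v : ℕ) < j → ¬ Elim G β v p)
    (n * (n * 108 + 108) + 6) n hE.r0 (by omega) hE.r2 (by decide) (by decide) (by decide)
    (by decide) (by decide) (by decide)
    (fun j σ' v h => by simpa [State.set_reg, Found] using h) (by simp) ?_ ?_
  · intro j σ' τ' hj hF hij hI
    have hE1 := hE.frame hF rfl rfl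
    refine wp_forLoop (Z := n + n * n) [13, 14, 15, 16] []
      (fun j' σ' => Found G β σ' ∨ ∀ v p : Fin n, ((v : ℕ) < j ∨ ((v : ℕ) = j ∧ (p : ℕ) < j')) →
        ¬ Elim G β v p)
      (n * 108 + 100) n hE1.r0 (by omega) hE1.r2 (by decide) (by decide) (by decide)
      (by decide) (by decide) (by decide)
      (fun j σ' v h => by simpa [State.set_reg, Found] using h) (by simpa using hI) ?_ ?_
    · intro j' σ2 τ2 hj' hF2 hij' hI2
      refine wp_mono (wp_leafBody hS (hE1.frame hF2 rfl rfl) (fun w => ?_) (v := ⟨j, hj⟩)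
        (p := ⟨j', hj'⟩) ((hF2.reg 11 rfl).trans hij) hij' hI2) ?_
      · rw [hF2.arr 6 w rfl (by omega), hF.arr 6 w rfl (by omega)]
        exact hd w
      · rintro σ3 τ3 ⟨h1, h2⟩
        refine ⟨h1, h2.imp_right fun h v p hvp => h v p ?_⟩
        simp only [Fin.ext_iff]
        omega
    · intro σ2 τ2 hF2 hI2 hτ2
      refine ⟨by rw [add_assoc] at hτ2; exact hτ2, hI2.imp_right fun h v p hv => h v p ?_⟩
      have := p.2
      omega
  · intro σ' τ' hF hI hτ
    refine ⟨hF, ?_, ?_⟩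
    · rcases hI with h | h
      · exact h
      · obtain ⟨v, p, hvp⟩ := hex
        exact absurd hvp (h v p v.2)
    · have e1 : n * (n * (n * 108 + 108) + 6 + 8) = 108 * (n * (n * n)) + 108 * (n * n) + 14 * n := by
        ring
      have e2 : n * (n * n) ≤ n * L := Nat.mul_le_mul_left _ f1
      have e3 : 2 * L ≤ n * L := Nat.mul_le_mul_right _ hn
      omega

end leaf

/-! ### Initial tables -/

theorem cur_lt {n : ℕ} (ps : ℕ → Fin n) (i : ℕ) (w : Fin n) : cur ps i w < n + i := by
  induction i with
  | zero => exact w.2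
  | succ i ih =>
    simp only [cur]
    split <;> omega

theorem blob_congr {n : ℕ} {vs ps vs' ps' : ℕ → Fin n} {i : ℕ}
    (h : ∀ j < i, vs j = vs' j ∧ ps j = ps' j) : blob vs ps i = blob vs' ps' i := by
  induction i with
  | zero => rfl
  | succ i ih =>
    funext u
    obtain ⟨h1, h2⟩ := h i (by omega)
    simp only [blob, ih fun j hj => h j (by omega), h1, h2]

theorem cur_congr {n : ℕ} {ps ps' : ℕ → Fin n} {i : ℕ} (h : ∀ j < i, ps j = ps' j) :
    cur ps i = cur ps' i := by
  induction i with
  | zero => rfl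
  | succ i ih =>
    funext u
    simp only [cur, ih fun j hj => h j (by omega), h i (by omega)]

theorem Merged.congr {n s L e : ℕ} {Ta Tb T Ta' Tb' T' : ℕ → ℕ} (h : Merged n s L e Ta Tb T)
    (ha : ∀ x < L, Ta' x = Ta x) (hb : ∀ x < L, Tb' x = Tb x) (ht : ∀ x < L, T' x = T x) :
    Merged n s L e Ta' Tb' T' := by
  refine ⟨fun x hx hx' => ?_, fun a h1 b h2 h3 h4 h5 h6 => ?_, fun a h1 b h2 h3 h4 h5 => ?_⟩
  · rw [ht x hx] at hx' ⊢
    obtain ⟨a, h1, b, h2, h3, h4, h5⟩ := h.sound x hx hx'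
    exact ⟨a, h1, b, h2, by rwa [ha a h1], by rwa [hb b h2], h5⟩
  · rw [ha a h1] at h3
    rw [hb b h2] at h4
    rw [ht _ h6]
    exact h.keep a h1 b h2 h3 h4 h5 h6
  · rw [ha a h1] at h3
    rw [hb b h2] at h4
    rw [ht _ h5]
    exact h.cut a h1 b h2 h3 h4 h5

/-- The sequences `vs` and `ps` are changed at `i` only. Stages up to `i` depend only on earlier
members and on tables with numbers below `n + i`, so they keep their specification. -/
theorem Tables.step {n s : ℕ} {G : SimpleGraph (Fin n)} {ρ : Fin n → ℕ} {vs ps : ℕ → Fin n}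
    {TB TB' : ℕ → ℕ → ℕ} {i : ℕ} {v p : Fin n} (h : Tables G s ρ vs ps TB i)
    (hE : Elim G (blob vs ps i) v p)
    (hTB : ∀ y < n + i, ∀ x < 2 * n * s * n ^ (s - 1), TB' y x = TB y x)
    (hm : Merged n s (2 * n * s * n ^ (s - 1)) (adj01 G v p) (TB (cur ps i v)) (TB (cur ps i p))
      (TB' (n + i))) :
    Tables G s ρ (Function.update vs i v) (Function.update ps i p) TB' (i + 1) := by
  have hu : ∀ f : ℕ → Fin n, ∀ a : Fin n, ∀ j < i, Function.update f i a j = f j := by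
    intro f a j hj
    rw [Function.update_of_ne (by omega)]
  have hbl : ∀ j ≤ i, blob (Function.update vs i v) (Function.update ps i p) j = blob vs ps j :=
    fun j hj => blob_congr fun l hl => ⟨hu _ _ l (by omega), hu _ _ l (by omega)⟩
  have hcu : ∀ j ≤ i, cur (Function.update ps i p) j = cur ps j :=
    fun j hj => cur_congr fun l hl => hu _ _ l (by omega)
  refine ⟨fun w x hx => ?_, fun j hj => ?_, fun j hj => ?_⟩
  · rw [hTB w (by omega) x hx]
    exact h.init w x hx
  · rw [hbl j (by omega)]
    obtain hj | rfl := Nat.lt_succ_iff_lt_or_eq.1 hj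
    · rw [hu _ _ j hj, hu _ _ j hj]
      exact h.elim j hj
    · rw [Function.update_self, Function.update_self]
      exact hE
  · rw [hcu j (by omega)]
    obtain hj | rfl := Nat.lt_succ_iff_lt_or_eq.1 hj
    · rw [hu _ _ j hj, hu _ _ j hj]
      refine (h.merged j hj).congr (hTB _ ?_) (hTB _ ?_) (hTB _ (by omega))
      · have := cur_lt ps j (vs j); omega
      · have := cur_lt ps j (ps j); omega
    · rw [Function.update_self, Function.update_self]
      refine hm.congr (hTB _ ?_) (hTB _ ?_) (fun _ _ => rfl)
      · have := cur_lt ps j v; omega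
      · have := cur_lt ps j p; omega

/-- The tables stored in array 4. -/
def tab (Z L : ℕ) (σ : State) (y x : ℕ) : ℕ := σ.mem (cell Z 4 (y * L + x))

/-- Memory contents after `i` merges. -/
structure Elimination (G : SimpleGraph (Fin n)) (s : ℕ) (ρ : Fin n → ℕ) (L : ℕ)
    (vs ps : ℕ → Fin n) (i : ℕ) (σ : State) : Prop where
  tables : Tables G s ρ vs ps (tab (n + n * n) L σ) i
  dead : ∀ w : Fin n, σ.mem (cell (n + n * n) 6 w) = 0 ↔ blob vs ps i w = w
  cur : ∀ w : Fin n, σ.mem (cell (n + n * n) 5 w) = cur ps i w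
  ord : ∀ j < i, σ.mem (cell (n + n * n) 7 j) = vs j
  par : ∀ j < i, σ.mem (cell (n + n * n) 8 j) = ps j
  zero : ∀ y, (n + i) * L ≤ y → σ.mem (cell (n + n * n) 4 y) = 0

/-- Set up the tables of the single vertices and the arrays 5 and 10. -/
def initProg : Prog :=
  forLoop 10 0 (put 4 (reg 10 * reg 6 + reg 7 * rd 11 (reg 10)) (const 1) ;;
    put 5 (reg 10) (reg 10) ;; put 10 (reg 10) (reg 10))

section init

variable {W n s N L m τ : ℕ} {σ : State} {G : SimpleGraph (Fin n)} {ρ : Fin n → ℕ}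

theorem Elimination.frame {vs ps : ℕ → Fin n} {i : ℕ} {σ' : State}
    (h : Elimination G s ρ L vs ps i σ) {R J : List ℕ} (hF : Frame (n + n * n) R J σ σ')
    (hJ : ([4, 5, 6, 7, 8].all fun j => !J.contains j) = true) :
    Elimination G s ρ L vs ps i σ' := by
  have hj : ∀ j i', j ∈ [4, 5, 6, 7, 8] →
      σ'.mem (cell (n + n * n) j i') = σ.mem (cell (n + n * n) j i') := by
    intro j i' h
    have h1 := List.all_eq_true.1 hJ j h
    refine hF.arr j i' (by simpa using h1) ?_
    simp at h
    omega
  have htab : tab (n + n * n) L σ' = tab (n + n * n) L σ := by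
    funext y x
    exact hj 4 _ (by simp)
  refine ⟨by rw [htab]; exact h.tables, fun w => ?_, fun w => ?_, fun j hi => ?_, fun j hi => ?_,
    fun y hy => ?_⟩
  · rw [hj 6 _ (by simp)]; exact h.dead w
  · rw [hj 5 _ (by simp)]; exact h.cur w
  · rw [hj 7 _ (by simp)]; exact h.ord j hi
  · rw [hj 8 _ (by simp)]; exact h.par j hi
  · rw [hj 4 _ (by simp)]; exact h.zero y hy

theorem wp_initProg (hS : Size n s N L W) (hE : Env n s N L m G ρ σ) (hρ : ∀ u, ρ u < s)
    (h4 : ∀ y, σ.mem (cell (n + n * n) 4 y) = 0) (h6 : ∀ y, σ.mem (cell (n + n * n) 6 y) = 0)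
    (vs ps : ℕ → Fin n) :
    wp W initProg (fun σ' τ' => Frame (n + n * n) [10] [4, 5, 10] σ σ' ∧
      Elimination G s ρ L vs ps 0 σ' ∧ (∀ v : Fin n, σ'.mem (cell (n + n * n) 10 v) = v) ∧
      τ' ≤ τ + 100 * (n * L)) σ τ := by
  obtain ⟨f1, f2, f3, f4, f5, f6, f7, f8, f9, f10⟩ := hS.facts
  have hn := hS.two_le_n
  have hN := pow_pos (show 0 < n by omega) (s - 1)
  have hlt : ∀ v : Fin n, 2 * n * ρ v < L := by
    intro v
    rw [hS.L_eq, hS.N_eq]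
    calc 2 * n * ρ v < 2 * n * s := Nat.mul_lt_mul_of_pos_left (hρ v) (by omega)
      _ ≤ 2 * n * s * n ^ (s - 1) := Nat.le_mul_of_pos_right _ hN
  refine wp_forLoop (Z := n + n * n) [] [4, 5, 10]
    (fun j σ' => (∀ y, σ'.mem (cell (n + n * n) 4 y) ≠ 0 ↔
        ∃ v : Fin n, (v : ℕ) < j ∧ y = v * L + 2 * n * ρ v) ∧
      (∀ v : Fin n, (v : ℕ) < j → σ'.mem (cell (n + n * n) 5 v) = v) ∧
      (∀ v : Fin n, (v : ℕ) < j → σ'.mem (cell (n + n * n) 10 v) = v))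
    60 n hE.r0 (by omega) hE.r2 (by decide) (by decide) (by decide)
    (by decide) (by decide) (by decide) (fun j σ' v h => h) (by simp [h4]) ?_ ?_
  · rintro j σ' τ' hj hF hij ⟨h1, h2, h3⟩
    have hE' := hE.frame hF rfl rfl
    have hr := hE'.rho ⟨j, hj⟩
    have hl := hlt ⟨j, hj⟩
    have hρj := hρ ⟨j, hj⟩
    have hjL : j * L + L ≤ n * L := by
      have : (j + 1) * L ≤ n * L := Nat.mul_le_mul_right _ hj
      rw [Nat.succ_mul] at this
      exact this
    simp only at hr
    refine wp_seq (wp_put (fun hB => ?_) (wp_seq (wp_put (fun hB => ?_) (wp_put (fun hB => ?_)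
      ⟨by simp, ?_⟩))))
    · simp only [fits_add, fits_mul, fits_reg, fits_rd, fits_const, eval_add, eval_mul, eval_reg,
        eval_rd, hB.reg, hB.mem, hij, hE'.r2, hE'.r6, hE'.r7, hr, true_and, and_true]
      simp only [cell]
      omega
    · simp only [fits_reg, hB.reg, eval_reg, State.write_reg, hij, hE'.r2, true_and]
      simp only [cell]
      omega
    · simp only [fits_reg, hB.reg, eval_reg, State.write_reg, hij, hE'.r2, true_and]
      simp only [cell]
      omega
    simp only [eval_add, eval_mul, eval_reg, eval_rd, eval_const, State.write_reg, hij, hE'.r2,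
      hE'.r6, hE'.r7, hr]
    refine ⟨fun y => ?_, fun v hv => ?_, fun v hv => ?_⟩
    · rw [State.write_cell_ne (by omega) (by omega) (by omega),
        State.write_cell_ne (by omega) (by omega) (by omega), State.write_cell (by omega)]
      constructor
      · intro h
        split at h
        · exact ⟨⟨j, hj⟩, by simp, by assumption⟩
        · obtain ⟨v, hv, hy⟩ := (h1 y).1 h
          exact ⟨v, by omega, hy⟩
      · rintro ⟨v, hv, hy⟩
        split
        · simp
        · rename_i hne
          refine (h1 y).2 ⟨v, ?_, hy⟩
          by_contra hc
          obtain rfl : v = ⟨j, hj⟩ := Fin.ext (by simp only; omega)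
          exact hne hy
    · rw [State.write_cell_ne (by omega) (by omega) (by omega), State.write_cell (by omega),
        State.write_cell_ne (by omega) (by omega) (by omega)]
      split
      · rename_i h; exact h.symm
      · exact h2 v (by omega)
    · rw [State.write_cell (by omega), State.write_cell_ne (by omega) (by omega) (by omega),
        State.write_cell_ne (by omega) (by omega) (by omega)]
      split
      · rename_i h; exact h.symm
      · exact h3 v (by omega)
  · rintro σ' τ' hF ⟨h1, h2, h3⟩ hτ
    refine ⟨hF, ⟨⟨fun v x hx => ?_, by simp, by simp⟩, fun w => ?_, fun w => h2 w w.2, by simp,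
      by simp, fun y hy => ?_⟩, fun v => h3 v v.2, by omega⟩
    · rw [← hS.N_eq, ← hS.L_eq] at hx
      refine (h1 _).trans ⟨?_, fun h => ⟨v, v.2, by rw [h]⟩⟩
      rintro ⟨u, hu, h⟩
      have hl := hlt u
      have hdm : ∀ {a x : ℕ}, x < L → (a * L + x) / L = a := by
        intro a x hx
        rw [mul_comm, Nat.mul_add_div (by omega), Nat.div_eq_of_lt hx, add_zero]
      have h5 : (v : ℕ) = u := by
        rw [← hdm hx (a := v), h, hdm hl]
      obtain rfl : v = u := Fin.ext h5
      omega
    · rw [hF.arr 6 w rfl (by omega), h6]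
      simp [blob]
    · by_contra h
      obtain ⟨v, -, h5⟩ := (h1 y).1 h
      have hl := hlt v
      have : (v + 1 : ℕ) * L ≤ n * L := Nat.mul_le_mul_right _ v.2
      rw [Nat.succ_mul] at this
      simp only [add_zero] at hy
      omega

/-! ### Elimination of the vertices -/

/-- Merge two blobs. -/
def elimBody : Prog :=
  leafProg ;;
    .assign 17 (const 2 * load (reg 0 + reg 15 * reg 0 + reg 16)) ;;
    .assign 18 (rd 5 (reg 15) * reg 6) ;; .assign 19 (rd 5 (reg 16) * reg 6) ;;
    .assign 20 ((reg 0 + reg 10) * reg 6) ;; mergeProg ;;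
    put 6 (reg 15) (const 1) ;; put 7 (reg 10) (reg 15) ;; put 8 (reg 10) (reg 16) ;;
    put 5 (reg 16) (reg 0 + reg 10)

theorem wp_elimBody (hS : Size n s N L W) (hE : Env n s N L m G ρ σ) (hG : G.IsAcyclic)
    {vs ps : ℕ → Fin n} {i : ℕ} (hi : i < n - 1) (h10 : σ.reg 10 = i)
    (h : Elimination G s ρ L vs ps i σ) :
    wp W elimBody (fun σ' τ' => τ' ≤ τ + 700 * (L * L) ∧
      ∃ vs ps, Elimination G s ρ L vs ps (i + 1) σ') σ τ := by
  obtain ⟨f1, f2, f3, f4, f5, f6, f7, f8, f9, f10⟩ := hS.facts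
  have hn := hS.two_le_n
  -- After `i < n - 1` merges `n - i ≥ 2` representatives are left, and the forest on them has a
  -- vertex with at most one neighbor.
  have hex : ∃ v p, Elim G (blob vs ps i) v p := by
    have hc := card_alive h.tables.elim le_rfl
    obtain ⟨v, hv, p, hp, h1, h2⟩ := exists_leaf hG
      (X := {w | blob vs ps i w = w}) (by omega)
    simp only [mem_filter, mem_univ, true_and] at hv hp h2
    exact ⟨v, p, hv, hp, h1, h2⟩
  refine wp_seq (wp_mono (wp_leafProg hS hE h.dead hex) ?_)
  rintro σ1 τ1 ⟨hF1, ⟨v, p, h15, h16, hvp⟩, hτ1⟩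
  have hE1 := hE.frame hF1 rfl rfl
  have hH1 := h.frame hF1 rfl
  have k10 := (hF1.reg 10 rfl).trans h10
  have hadj := hE1.adj v p
  have hcv := hH1.cur v
  have hcp := hH1.cur p
  have lv := cur_lt ps i v
  have lp := cur_lt ps i p
  have hv := v.2
  have hp := p.2
  have hi1 : (n + i + 1) * L ≤ 2 * (n * L) := by
    rw [← mul_assoc]
    exact Nat.mul_le_mul_right _ (by omega)
  have hA : (cur ps i v + 1) * L ≤ (n + i) * L := Nat.mul_le_mul_right _ lv
  have hB' : (cur ps i p + 1) * L ≤ (n + i) * L := Nat.mul_le_mul_right _ lp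
  rw [Nat.succ_mul] at hi1 hA hB'
  have hadj1 := adj01_le G v p
  have hix := index_lt v p
  refine wp_seq (wp_assign (fun hB => ?_) (wp_seq (wp_assign (fun hB => ?_)
    (wp_seq (wp_assign (fun hB => ?_) (wp_seq (wp_assign (fun hB => ?_) (wp_seq ?_))))))))
  · simp only [fits_mul, fits_const, fits_load, fits_add, fits_reg, hB.reg, hB.mem, eval_const,
      eval_load, eval_add, eval_mul, eval_reg, h15, h16, hE1.r0, hadj, true_and, and_true]
    omega
  · simp only [fits_mul, fits_rd, fits_reg, hB.reg, hB.mem, eval_rd, eval_reg, State.set_reg,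
      State.set_mem, Nat.reduceEqDiff, if_false, h15, hE1.r2, hE1.r6, hcv, true_and, and_true]
    simp only [cell]
    omega
  · simp only [fits_mul, fits_rd, fits_reg, hB.reg, hB.mem, eval_rd, eval_reg, State.set_reg,
      State.set_mem, Nat.reduceEqDiff, if_false, h16, hE1.r2, hE1.r6, hcp, true_and, and_true]
    simp only [cell]
    omega
  · simp only [fits_mul, fits_add, fits_reg, hB.reg, eval_add, eval_reg, State.set_reg,
      State.set_mem, Nat.reduceEqDiff, OfNat.zero_ne_ofNat, if_false, k10, hE1.r0, hE1.r6, true_and,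
      and_true]
    omega
  simp only [eval_mul, eval_const, eval_load, eval_add, eval_reg, eval_rd, State.set_reg,
    State.set_mem, Nat.reduceEqDiff, OfNat.zero_ne_ofNat, if_false, k10, h15, h16, hE1.r0,
    hE1.r2, hE1.r6, hadj, hcv, hcp]
  set σ2 := (((σ1.set 17 (2 * adj01 G v p)).set 18 (cur ps i v * L)).set 19 (cur ps i p * L)).set 20
    ((n + i) * L) with hσ2
  have hF2 : Frame (n + n * n) [17, 18, 19, 20] [] σ1 σ2 :=
    ((((Frame.refl _ _ _ _).set (by decide)).set (by decide)).set (by decide)).set (by decide)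
  have hE2 := hE1.frame hF2 rfl rfl
  have hH2 := hH1.frame hF2 rfl
  have hM2 : MergeEnv L (adj01 G v p) (cur ps i v * L) (cur ps i p * L) ((n + i) * L) σ2 := by
    constructor <;> simp [hσ2, State.set_reg]
  refine wp_mono (wp_mergeProg hS hE2 hM2 hadj1 hA hB' hi1
    (fun x hx => hH2.zero _ (by omega))) ?_
  rintro σ3 τ3 ⟨hF3, hT3, hm3, hτ3⟩
  have g10 : σ3.reg 10 = i := (hF3.reg 10 rfl).trans ((hF2.reg 10 rfl).trans k10)
  have g15 : σ3.reg 15 = v := (hF3.reg 15 rfl).trans ((hF2.reg 15 rfl).trans h15)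
  have g16 : σ3.reg 16 = p := (hF3.reg 16 rfl).trans ((hF2.reg 16 rfl).trans h16)
  have g2 : σ3.reg 2 = n + n * n := (hF3.reg 2 rfl).trans hE2.r2
  have g0 : σ3.reg 0 = n := (hF3.reg 0 rfl).trans hE2.r0
  refine wp_seq (wp_put (fun hB => ?_) (wp_seq (wp_put (fun hB => ?_) (wp_seq (wp_put (fun hB => ?_)
    (wp_put (fun hB => ?_) ?_))))))
  · simp only [fits_reg, fits_const, hB.reg, eval_reg, State.write_reg, g15, g2, cell, true_and]
    omega
  · simp only [fits_reg, fits_const, hB.reg, eval_reg, State.write_reg, g10, g2, cell, true_and]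
    omega
  · simp only [fits_reg, fits_const, hB.reg, eval_reg, State.write_reg, g10, g2, cell, true_and]
    omega
  · simp only [fits_reg, fits_add, fits_const, hB.reg, eval_reg, State.write_reg, g16, g10, g0, g2,
      cell, true_and]
    omega
  simp only [eval_reg, eval_add, eval_const, State.write_reg, g15, g2, g10, g16, g0]
  refine ⟨?_, Function.update vs i v, Function.update ps i p, ?_, fun w => ?_, fun w => ?_,
    fun j hj => ?_, fun j hj => ?_, fun y hy => ?_⟩
  · simp at hτ3 ⊢
    omega
  · have htab : ∀ y x, tab (n + n * n) L ((((σ3.write (cell (n + n * n) 6 v) 1).write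
        (cell (n + n * n) 7 i) v).write (cell (n + n * n) 8 i) p).write (cell (n + n * n) 5 p)
          (n + i)) y x = tab (n + n * n) L σ3 y x := by
      intro y x
      unfold tab
      rw [State.write_cell_ne (by omega) (by omega) (by omega),
        State.write_cell_ne (by omega) (by omega) (by omega),
        State.write_cell_ne (by omega) (by omega) (by omega),
        State.write_cell_ne (by omega) (by omega) (by omega)]
    refine hH2.tables.step hvp (fun y hy x hx => ?_) ?_
    · rw [htab]
      refine hT3 _ (Or.inl ?_)
      rw [← hS.N_eq, ← hS.L_eq] at hx
      have : (y + 1) * L ≤ (n + i) * L := Nat.mul_le_mul_right _ hy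
      rw [Nat.succ_mul] at this
      omega
    · rw [← hS.N_eq, ← hS.L_eq]
      refine hm3.congr (fun _ _ => rfl) (fun _ _ => rfl) (fun x _ => htab _ _)
  · rw [State.write_cell_ne (by omega) (by omega) (by omega),
      State.write_cell_ne (by omega) (by omega) (by omega),
      State.write_cell_ne (by omega) (by omega) (by omega), State.write_cell (by omega),
      hF3.arr 6 w rfl (by omega)]
    have hb : blob (Function.update vs i v) (Function.update ps i p) i = blob vs ps i :=
      blob_congr fun l hl => ⟨Function.update_of_ne (by omega) _ _,
        Function.update_of_ne (by omega) _ _⟩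
    simp only [blob, Function.update_self, hb, merge_alive hvp]
    split
    · rename_i hw
      simp [Fin.ext hw]
    · rename_i hw
      rw [hH2.dead w]
      exact ⟨fun h => ⟨h, fun hc => hw (by rw [hc])⟩, fun h => h.1⟩
  · rw [State.write_cell (by omega),
      State.write_cell_ne (by omega) (by omega) (by omega),
      State.write_cell_ne (by omega) (by omega) (by omega),
      State.write_cell_ne (by omega) (by omega) (by omega), hF3.arr 5 w rfl (by omega)]
    have hb : FairCC.cur (Function.update ps i p) i = FairCC.cur ps i :=
      cur_congr fun l hl => Function.update_of_ne (by omega) _ _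
    simp only [FairCC.cur, Function.update_self, hb, hH2.cur w, Fin.ext_iff]
  · rw [State.write_cell_ne (by omega) (by omega) (by omega),
      State.write_cell_ne (by omega) (by omega) (by omega), State.write_cell (by omega),
      State.write_cell_ne (by omega) (by omega) (by omega), hF3.arr 7 j rfl (by omega)]
    split
    · rename_i hji
      rw [hji, Function.update_self]
    · rename_i hji
      rw [Function.update_of_ne hji]
      exact hH2.ord j (by omega)
  · rw [State.write_cell_ne (by omega) (by omega) (by omega), State.write_cell (by omega),
      State.write_cell_ne (by omega) (by omega) (by omega),
      State.write_cell_ne (by omega) (by omega) (by omega), hF3.arr 8 j rfl (by omega)]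
    split
    · rename_i hji
      rw [hji, Function.update_self]
    · rename_i hji
      rw [Function.update_of_ne hji]
      exact hH2.par j (by omega)
  · rw [State.write_cell_ne (by omega) (by omega) (by omega),
      State.write_cell_ne (by omega) (by omega) (by omega),
      State.write_cell_ne (by omega) (by omega) (by omega),
      State.write_cell_ne (by omega) (by omega) (by omega)]
    rw [show n + (i + 1) = (n + i) + 1 by ring, Nat.succ_mul] at hy
    rw [hT3 y (by omega)]
    exact hH2.zero y (by omega)

/-- Merge all blobs. -/
def elimProg : Prog := forLoop 10 8 elimBody

theorem wp_elimProg (hS : Size n s N L W) (hE : Env n s N L m G ρ σ) (hG : G.IsAcyclic)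
    {vs ps : ℕ → Fin n} (h : Elimination G s ρ L vs ps 0 σ) :
    wp W elimProg (fun σ' τ' => Frame (n + n * n) [10, 11, 12, 13, 14, 15, 16, 17, 18, 19, 20, 21,
        22, 23, 24, 25, 26] [4, 5, 6, 7, 8] σ σ' ∧
      (∃ vs ps, Elimination G s ρ L vs ps (n - 1) σ') ∧ τ' ≤ τ + 800 * (n * (L * L))) σ τ := by
  obtain ⟨f1, f2, f3, f4, f5, f6, f7, f8, f9, f10⟩ := hS.facts
  have hn := hS.two_le_n
  refine wp_forLoop (Z := n + n * n) [11, 12, 13, 14, 15, 16, 17, 18, 19, 20, 21,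
      22, 23, 24, 25, 26] [4, 5, 6, 7, 8]
    (fun j σ' => ∃ vs ps, Elimination G s ρ L vs ps j σ')
    (700 * (L * L)) (n - 1) hE.r8 (by omega) hE.r2 (by decide) (by decide) (by decide)
    (by decide) (by decide) (by decide)
    (fun j σ' v ⟨vs, ps, h⟩ => ⟨vs, ps, h.frame (R := [10]) (J := [])
      ((Frame.refl _ _ _ _).set (by decide)) rfl⟩) ⟨vs, ps, h⟩ ?_ ?_
  · rintro j σ' τ' hj hF hij ⟨vs, ps, hI⟩
    exact wp_elimBody hS (hE.frame hF rfl rfl) hG hj hij hI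
  · rintro σ' τ' hF hI hτ
    refine ⟨hF, hI, ?_⟩
    have e1 : (n - 1) * (700 * (L * L) + 8) ≤ (n - 1) * (708 * (L * L)) :=
      Nat.mul_le_mul_left _ (by omega)
    have e2 : (n - 1) * (708 * (L * L)) ≤ n * (708 * (L * L)) := Nat.mul_le_mul_right _ (by omega)
    have e3 : n * (708 * (L * L)) = 708 * (n * (L * L)) := by ring
    have e4 : 2 * (L * L) ≤ n * (L * L) := Nat.mul_le_mul_right _ hn
    omega

end init

/-! ### The best entry of the last table -/

/-- Code of the multiset of piece weights that is encoded in an entry. -/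
def entryM (n s x : ℕ) : ℕ := x / (2 * n) / s + pw n (x / (2 * n) % s)

/-- Entries that are present and gluable. -/
def GoodEntry (n s : ℕ) (T r : ℕ → ℕ) (x : ℕ) : Prop := T x ≠ 0 ∧ r (entryM n s x) ≠ 0

/-- Compare the entry in register 10 with the best one so far. -/
def bestBody : Prog :=
  .cond (andT (rd 4 (reg 14 + reg 10))
    (andT (rd 3 (reg 10 / reg 7 / reg 4 + rd 2 (reg 10 / reg 7 % reg 4)))
      (ltT (reg 12) (reg 10 % reg 7 + const 1))))
    (.assign 12 (reg 10 % reg 7 + const 1) ;; .assign 13 (reg 10)) .skip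

/-- Find the best entry of the table of the last blob. -/
def bestProg : Prog :=
  .assign 14 (rd 5 (rd 8 (reg 8 - const 1)) * reg 6) ;; .assign 12 (const 0) ;;
    forLoop 10 6 bestBody

section best

variable {W n s N L m τ : ℕ} {σ : State} {G : SimpleGraph (Fin n)} {ρ : Fin n → ℕ}
  {vs ps : ℕ → Fin n}

theorem wp_bestProg (hS : Size n s N L W) (hE : Env n s N L m G ρ σ)
    (hH : Elimination G s ρ L vs ps (n - 1) σ)
    (hex : ∃ x < L, GoodEntry n s (tab (n + n * n) L σ (cur ps (n - 1) (ps (n - 2))))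
      (fun M => σ.mem (cell (n + n * n) 3 M)) x) :
    wp W bestProg (fun σ' τ' => Frame (n + n * n) [10, 12, 13, 14] [] σ σ' ∧
      (σ'.reg 13 < L ∧ GoodEntry n s (tab (n + n * n) L σ (cur ps (n - 1) (ps (n - 2))))
        (fun M => σ.mem (cell (n + n * n) 3 M)) (σ'.reg 13) ∧
        ∀ x < L, GoodEntry n s (tab (n + n * n) L σ (cur ps (n - 1) (ps (n - 2))))
          (fun M => σ.mem (cell (n + n * n) 3 M)) x → x % (2 * n) ≤ σ'.reg 13 % (2 * n)) ∧
      τ' ≤ τ + 200 * L) σ τ := by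
  obtain ⟨f1, f2, f3, f4, f5, f6, f7, f8, f9, f10⟩ := hS.facts
  have hn := hS.two_le_n
  have hs2 := hS.two_le_s
  have hpar := hH.par (n - 2) (by omega)
  have hcur := hH.cur (ps (n - 2))
  have hp := (ps (n - 2)).2
  set r := ps (n - 2) with hr
  set y := cur ps (n - 1) r with hy
  have lc : y < n + (n - 1) := cur_lt ps (n - 1) r
  have hA : (y + 1) * L ≤ 2 * (n * L) := by
    rw [← mul_assoc]
    exact Nat.mul_le_mul_right _ (by omega)
  rw [Nat.succ_mul] at hA
  have e8 : n - 1 - 1 = n - 2 := by omega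
  refine wp_seq (wp_assign (fun hB => ?_) (wp_seq (wp_assign (fun hB => by simp) ?_)))
  · simp only [fits_mul, fits_rd, fits_sub, fits_const, fits_reg, hB.reg, hB.mem, eval_rd, eval_sub,
      eval_const, eval_reg, hE.r2, hE.r6, hE.r8, e8, hpar, hcur, true_and, and_true]
    simp only [cell]
    omega
  simp only [eval_mul, eval_rd, eval_sub, eval_const, eval_reg, hE.r2, hE.r6, hE.r8, e8, hpar, hcur]
  set σ1 := (σ.set 14 (y * L)).set 12 0 with hσ1
  have hF1 : Frame (n + n * n) [14, 12] [] σ σ1 :=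
    ((Frame.refl _ _ _ _).set (by decide)).set (by decide)
  have hE1 := hE.frame hF1 rfl rfl
  have g14 : σ1.reg 14 = y * L := by simp [hσ1, State.set_reg]
  have g12 : σ1.reg 12 = 0 := by simp [hσ1, State.set_reg]
  set Q := GoodEntry n s (tab (n + n * n) L σ y) (fun M => σ.mem (cell (n + n * n) 3 M)) with hQ
  -- Register 12 holds the best gain plus one, so that 0 means that no good entry has been seen.
  refine wp_forLoop (Z := n + n * n) [12, 13] []
    (fun j σ' => (σ'.reg 12 = 0 ∧ ∀ x < j, ¬ Q x) ∨
      (σ'.reg 12 = σ'.reg 13 % (2 * n) + 1 ∧ σ'.reg 13 < j ∧ Q (σ'.reg 13) ∧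
        ∀ x < j, Q x → x % (2 * n) ≤ σ'.reg 13 % (2 * n)))
    100 L hE1.r6 (by omega) hE1.r2 (by decide) (by decide) (by decide)
    (by decide) (by decide) (by decide) (fun j σ' v h => by simpa [State.set_reg] using h)
    (by simp [g12]) ?_ ?_
  · intro j σ' τ' hj hF hij hI
    have hE2 := hE1.frame hF rfl rfl
    have k14 := (hF.reg 14 rfl).trans g14
    have hh : j / (2 * n) % s < s := Nat.mod_lt _ (by omega)
    have hpw := hE2.pw _ hh
    have hpl := pw_le hS hh
    have hd : j / (2 * n) / s ≤ j := (Nat.div_le_self _ _).trans (Nat.div_le_self _ _)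
    have hmod : j % (2 * n) ≤ j := Nat.mod_le _ _
    have hg : (andT (rd 4 (reg 14 + reg 10))
        (andT (rd 3 (reg 10 / reg 7 / reg 4 + rd 2 (reg 10 / reg 7 % reg 4)))
          (ltT (reg 12) (reg 10 % reg 7 + const 1)))).eval σ' ≠ 0 ↔
        Q j ∧ σ'.reg 12 < j % (2 * n) + 1 := by
      simp only [eval_andT, eval_rd, eval_add, eval_div, eval_mod, eval_ltT, eval_reg, eval_const,
        hE2.r2, hE2.r4, hE2.r7, hij, k14, hpw, hQ, GoodEntry, entryM, tab]
      rw [hF.arr 4 _ rfl (by omega), hF1.arr 4 _ rfl (by omega), hF.arr 3 _ rfl (by omega),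
        hF1.arr 3 _ rfl (by omega)]
      simp [and_assoc]
    refine wp_cond (fun hB => ?_) (fun h => ?_) (fun h => ?_)
    · simp only [fits_andT (show 1 ≤ W by omega), fits_ltT' (show 1 ≤ W by omega), fits_rd,
        fits_add, fits_div, fits_mod, fits_reg, fits_const, hB.reg, hB.mem, eval_rd, eval_add,
        eval_div, eval_mod, eval_reg, eval_const, hE2.r2, hE2.r4, hE2.r7, hij, k14, hpw, true_and,
        and_true]
      simp only [cell]
      omega
    · obtain ⟨h1, h2⟩ := hg.1 h
      refine wp_seq (wp_assign (fun hB => ?_) (wp_assign (fun hB => hB.reg _) ⟨by simp, ?_⟩))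
      · simp only [fits_add, fits_mod, fits_reg, fits_const, hB.reg, eval_mod, eval_reg, eval_const,
          hE2.r7, hij, true_and]
        omega
      · simp only [State.set_reg, Nat.reduceEqDiff, if_true, if_false, eval_add, eval_mod, eval_reg,
          eval_const, hE2.r7, hij]
        refine Or.inr ⟨trivial, by omega, h1, fun x hx hx' => ?_⟩
        obtain hx | rfl := Nat.lt_succ_iff_lt_or_eq.1 hx
        · rcases hI with ⟨-, h4⟩ | ⟨h3, -, -, h4⟩
          · exact absurd hx' (h4 x hx)
          · have := h4 x hx hx'
            omega
        · exact le_rfl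
    · refine wp_skip ⟨by simp, ?_⟩
      have h' := fun hc => hg.2 hc h
      rcases hI with ⟨h3, h4⟩ | ⟨h3, h4, h5, h6⟩
      · refine Or.inl ⟨h3, fun x hx hx' => ?_⟩
        obtain hx | rfl := Nat.lt_succ_iff_lt_or_eq.1 hx
        · exact h4 x hx hx'
        · exact h' ⟨hx', by omega⟩
      · refine Or.inr ⟨h3, by omega, h5, fun x hx hx' => ?_⟩
        obtain hx | rfl := Nat.lt_succ_iff_lt_or_eq.1 hx
        · exact h6 x hx hx'
        · by_contra hc
          exact h' ⟨hx', by omega⟩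
  · intro σ' τ' hF hI hτ
    refine ⟨(hF1.mono (by simp) (by simp)).trans (hF.mono (by simp) (by simp)), ?_, ?_⟩
    · rcases hI with ⟨-, h4⟩ | ⟨-, h4, h5, h6⟩
      · obtain ⟨x, hx, hx'⟩ := hex
        exact absurd hx' (h4 x hx)
      · exact ⟨h4, h5, h6⟩
    · simp at hτ
      omega

/-! ### Traceback -/

/-- Undo one merge. -/
def traceBody : Prog :=
  .assign 11 (reg 8 - const 1 - reg 10) ;; .assign 15 (rd 7 (reg 11)) ;;
    .assign 16 (rd 8 (reg 11)) ;;
    .assign 14 (rd 4 ((reg 0 + reg 11) * reg 6 + rd 9 (reg 16)) - const 1) ;;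
    put 9 (reg 15) (reg 14 / const 2 / reg 6) ;; put 9 (reg 16) (reg 14 / const 2 % reg 6) ;;
    .cond (reg 14 % const 2) (put 10 (reg 15) (reg 15)) (put 10 (reg 15) (rd 10 (reg 16)))

/-- Find the pieces that lead to the entry in register 13. -/
def traceProg : Prog :=
  put 9 (rd 8 (reg 8 - const 1)) (reg 13) ;; forLoop 10 8 traceBody

theorem wp_traceBody {r : Fin n} {X i j : ℕ} {goal : Fin n → ℕ} {lab : Fin n → Fin n}
    (hS : Size n s N L W) (hE : Env n s N L m G ρ σ)
    (hI : Inst s m ρ) (hG : G.IsAcyclic) (hH : Elimination G s ρ L vs ps (n - 1) σ)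
    (h10 : σ.reg 10 = j) (hij : i + j + 1 = n - 1)
    (hT : Trace G s ρ vs ps (tab (n + n * n) L σ) (n - 1) r X (i + 1) goal lab)
    (hg : ∀ w : Fin n, σ.mem (cell (n + n * n) 9 w) = goal w)
    (hl : ∀ w : Fin n, σ.mem (cell (n + n * n) 10 w) = lab w) :
    wp W traceBody (fun σ' τ' => τ' ≤ τ + 200 ∧ ∃ (goal : Fin n → ℕ) (lab : Fin n → Fin n),
      Trace G s ρ vs ps (tab (n + n * n) L σ) (n - 1) r X i goal lab ∧
      (∀ w : Fin n, σ'.mem (cell (n + n * n) 9 w) = goal w) ∧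
      (∀ w : Fin n, σ'.mem (cell (n + n * n) 10 w) = lab w)) σ τ := by
  obtain ⟨f1, f2, f3, f4, f5, f6, f7, f8, f9, f10⟩ := hS.facts
  have hn := hS.two_le_n
  have hord := hH.ord i (by omega)
  have hpar := hH.par i (by omega)
  have he := hH.tables.elim i (by omega)
  have hLe : L = 2 * n * s * n ^ (s - 1) := by rw [hS.L_eq, hS.N_eq]
  have hgp : goal (ps i) < L := by
    rw [hLe]
    refine (hT.entry (ps i) ?_).1
    rw [blob, he.right]
    simp [rl, he.ne.symm]
  obtain ⟨hstep, hz⟩ := hT.step hH.tables hI hG (by omega) (z := tab (n + n * n) L σ (n + i)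
    (goal (ps i))) rfl
  rw [← hLe] at hstep
  have e8 : n - 1 - 1 - j = i := by omega
  have hv := (vs i).2
  have hp := (ps i).2
  have hne : (vs i : ℕ) ≠ ps i := fun h => he.ne (Fin.ext h)
  have hgoal := hg (ps i)
  have hlab := hl (ps i)
  have hiL : (n + i + 1) * L ≤ 2 * (n * L) := by
    rw [← mul_assoc]
    exact Nat.mul_le_mul_right _ (by omega)
  rw [Nat.succ_mul] at hiL
  have htab : σ.mem (cell (n + n * n) 4 ((n + i) * L + goal (ps i)))
    = tab (n + n * n) L σ (n + i) (goal (ps i)) := rfl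
  refine wp_bounded fun hB0 => ?_
  have hzW : tab (n + n * n) L σ (n + i) (goal (ps i)) ≤ W := hB0.mem _
  refine wp_seq (wp_assign (fun hB => ?_) (wp_seq (wp_assign (fun hB => ?_)
    (wp_seq (wp_assign (fun hB => ?_) (wp_seq (wp_assign (fun hB => ?_) ?_)))))))
  · simp only [fits_sub, fits_reg, fits_const, hB.reg, true_and, and_true]; omega
  · simp only [fits_rd, fits_reg, hB.reg, hB.mem, hB0.mem, eval_reg, eval_sub, eval_const, State.set_reg,
      State.set_mem, Nat.reduceEqDiff, if_true, if_false, hE.r2, hE.r8, h10, e8, true_and, and_true]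
    simp only [cell]
    omega
  · simp only [fits_rd, fits_reg, hB.reg, hB.mem, hB0.mem, eval_reg, eval_sub, eval_const, State.set_reg,
      State.set_mem, Nat.reduceEqDiff, if_true, if_false, hE.r2, hE.r8, h10, e8, true_and, and_true]
    simp only [cell]
    omega
  · simp only [fits_rd, fits_sub, fits_add, fits_mul, fits_const, fits_reg, hB.reg, hB.mem, hB0.mem, eval_reg,
      eval_sub, eval_rd, eval_add, eval_mul, eval_const, State.set_reg, OfNat.zero_ne_ofNat,
      State.set_mem, Nat.reduceEqDiff, if_true, if_false, hE.r0, hE.r2, hE.r6, hE.r8, h10, e8, hpar,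
      hgoal, true_and, and_true]
    simp only [cell]
    omega
  simp only [eval_reg, eval_sub, eval_rd, eval_add, eval_mul, eval_const, State.set_reg,
    OfNat.zero_ne_ofNat, State.set_mem, Nat.reduceEqDiff, if_true, if_false, hE.r0, hE.r2, hE.r6,
    hE.r8, h10, e8, hpar, hord, hgoal, htab]
  set z := tab (n + n * n) L σ (n + i) (goal (ps i)) with hzdef
  set σ1 := (((σ.set 11 i).set 15 (vs i)).set 16 (ps i)).set 14 (z - 1) with hσ1
  have hF1 : Frame (n + n * n) [11, 15, 16, 14] [] σ σ1 :=
    ((((Frame.refl _ _ _ _).set (by decide)).set (by decide)).set (by decide)).set (by decide)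
  have g2 := (hE.frame hF1 rfl rfl).r2
  have g6 := (hE.frame hF1 rfl rfl).r6
  have g14 : σ1.reg 14 = z - 1 := by simp [hσ1, State.set_reg]
  have g15 : σ1.reg 15 = vs i := by simp [hσ1, State.set_reg]
  have g16 : σ1.reg 16 = ps i := by simp [hσ1, State.set_reg]
  refine wp_seq (wp_put (fun hB => ?_) (wp_seq (wp_put (fun hB => ?_) ?_)))
  · simp only [fits_reg, fits_div, fits_const, hB.reg, eval_reg, g15, g2, cell, true_and, and_true]
    omega
  · simp only [fits_reg, fits_mod, fits_div, fits_const, hB.reg, eval_reg, State.write_reg, g16, g2,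
      cell, true_and]
    omega
  simp only [eval_reg, eval_mod, eval_div, eval_const, State.write_reg, g2, g6, g14, g15, g16]
  have hpost : ∀ w : Fin n, ((σ1.write (cell (n + n * n) 9 (vs i)) ((z - 1) / 2 / L)).write
      (cell (n + n * n) 9 (ps i)) ((z - 1) / 2 % L)).mem (cell (n + n * n) 9 w) =
      if w = vs i then (z - 1) / 2 / L else if w = ps i then (z - 1) / 2 % L else goal w := by
    intro w
    rw [State.write_cell (by omega), State.write_cell (by omega), hF1.arr 9 w rfl (by omega), hg w]
    simp only [Fin.ext_iff]
    split <;> split <;> simp_all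
  refine wp_cond (fun hB => ?_) (fun h => ?_) (fun h => ?_)
  · simp only [fits_mod, fits_reg, fits_const, hB.reg, true_and]
    omega
  · refine wp_put (fun hB => ?_) ⟨by simp, _, _, hstep, fun w => ?_, fun w => ?_⟩
    · simp only [fits_reg, hB.reg, eval_reg, State.write_reg, g15, g2, cell, true_and]
      omega
    · simp only [eval_reg, State.write_reg, g2, g15]
      rw [State.write_cell_ne (by omega) (by omega) (by omega), hpost]
    · simp only [eval_reg, eval_mod, eval_const, State.write_reg, g14] at h
      simp only [eval_reg, State.write_reg, g2, g15]
      rw [State.write_cell (by omega), State.write_cell_ne (by omega) (by omega) (by omega),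
        State.write_cell_ne (by omega) (by omega) (by omega), hF1.arr 10 w rfl (by omega), hl w]
      simp only [← Fin.ext_iff, h, if_false]
      split <;> rfl
  · refine wp_put (fun hB => ?_) ⟨by simp, _, _, hstep, fun w => ?_, fun w => ?_⟩
    · simp only [fits_reg, fits_rd, hB.reg, hB.mem, hB0.mem, eval_reg, State.write_reg, g15, g16, g2,
        true_and, and_true]
      simp only [cell]
      omega
    · simp only [eval_reg, State.write_reg, g2, g15]
      rw [State.write_cell_ne (by omega) (by omega) (by omega), hpost]
    · simp only [eval_reg, eval_mod, eval_const, State.write_reg, g14] at h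
      simp only [eval_reg, eval_rd, State.write_reg, g2, g15, g16]
      rw [State.write_cell (by omega), State.write_cell_ne (by omega) (by omega) (by omega),
        State.write_cell_ne (by omega) (by omega) (by omega), hF1.arr 10 _ rfl (by omega), hlab,
        State.write_cell_ne (by omega) (by omega) (by omega),
        State.write_cell_ne (by omega) (by omega) (by omega), hF1.arr 10 w rfl (by omega), hl w]
      simp only [← Fin.ext_iff, h, if_true]
      split <;> rfl

theorem wp_traceProg {X : ℕ} (hS : Size n s N L W) (hE : Env n s N L m G ρ σ)
    (hI : Inst s m ρ) (hG : G.IsAcyclic) (hρ : ∀ u, ρ u < s)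
    (hH : Elimination G s ρ L vs ps (n - 1) σ) (h13 : σ.reg 13 = X) (hX : X < L)
    (hTB : tab (n + n * n) L σ (cur ps (n - 1) (ps (n - 2))) X ≠ 0)
    (hl : ∀ w : Fin n, σ.mem (cell (n + n * n) 10 w) = w) :
    wp W traceProg (fun σ' τ' => Frame (n + n * n) [10, 11, 14, 15, 16] [9, 10] σ σ' ∧
      (∃ lab : Fin n → Fin n, (∀ w : Fin n, σ'.mem (cell (n + n * n) 10 w) = lab w) ∧
        Conf s ρ (blob vs ps (n - 1)) lab ∧
        blobCode G s ρ (blob vs ps (n - 1)) lab (ps (n - 2)) = X) ∧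
      τ' ≤ τ + 300 * L) σ τ := by
  obtain ⟨f1, f2, f3, f4, f5, f6, f7, f8, f9, f10⟩ := hS.facts
  have hn := hS.two_le_n
  have hLe : L = 2 * n * s * n ^ (s - 1) := by rw [hS.L_eq, hS.N_eq]
  have hpar := hH.par (n - 2) (by omega)
  have hp := (ps (n - 2)).2
  have hlast := blob_last hH.tables.elim hn
  have e8 : n - 1 - 1 = n - 2 := by omega
  have hF0 : Frame (n + n * n) [] [9] σ (σ.write (cell (n + n * n) 9 (ps (n - 2))) X) :=
    ⟨fun _ _ => rfl, fun j i hj hj' => State.write_cell_ne (by omega) hj' (by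
        rintro rfl; simp at hj), fun a ha => by
      rw [State.write_mem, if_neg]
      unfold cell
      omega⟩
  refine wp_seq (wp_put (fun hB => ?_) ?_)
  · simp only [fits_rd, fits_sub, fits_const, fits_reg, hB.reg, hB.mem, eval_rd, eval_sub,
      eval_const, eval_reg, hE.r2, hE.r8, e8, hpar, true_and, and_true]
    simp only [cell]
    omega
  simp only [eval_rd, eval_sub, eval_const, eval_reg, hE.r2, hE.r8, e8, hpar, h13]
  have hE0 := hE.frame hF0 rfl rfl
  have hH0 := hH.frame hF0 rfl
  have ht0 : tab (n + n * n) L (σ.write (cell (n + n * n) 9 (ps (n - 2))) X)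
      = tab (n + n * n) L σ := by
    funext y x
    exact hF0.arr 4 _ rfl (by omega)
  refine wp_forLoop (Z := n + n * n) [11, 14, 15, 16] [9, 10]
    (fun j σ' => ∃ (goal : Fin n → ℕ) (lab : Fin n → Fin n),
      Trace G s ρ vs ps (tab (n + n * n) L σ) (n - 1) (ps (n - 2)) X (n - 1 - j) goal lab ∧
      (∀ w : Fin n, σ'.mem (cell (n + n * n) 9 w) = goal w) ∧
      (∀ w : Fin n, σ'.mem (cell (n + n * n) 10 w) = lab w))
    200 (n - 1) hE0.r8 (by omega) hE0.r2 (by decide) (by decide) (by decide)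
    (by decide) (by decide) (by decide) (fun j σ' v h => h) ?_ ?_ ?_
  -- Only `ps (n - 2)` is still a representative. The goals of the other vertices are irrelevant,
  -- and whatever array 9 contains is accepted.
  · refine ⟨fun w => if w = ps (n - 2) then X else σ.mem (cell (n + n * n) 9 w), id,
      Trace.last hlast (by simp) (by rwa [← hLe]) hTB, fun w => ?_, fun w => ?_⟩
    · rw [State.write_cell (by omega)]
      simp only [Fin.ext_iff]
    · rw [State.write_cell_ne (by omega) (by omega) (by omega), hl w]
      rfl
  · rintro j σ' τ' hj hF hij ⟨goal, lab, h1, h2, h3⟩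
    have ht : tab (n + n * n) L σ' = tab (n + n * n) L σ := by
      rw [← ht0]
      funext y x
      exact hF.arr 4 _ rfl (by omega)
    rw [← ht] at h1 ⊢
    rw [show n - 1 - j = n - 1 - (j + 1) + 1 by omega] at h1
    exact wp_traceBody hS (hE0.frame hF rfl rfl) hI hG (hH0.frame hF rfl) hij (by omega) h1 h2 h3
  · rintro σ' τ' hF ⟨goal, lab, h1, h2, h3⟩ hτ
    rw [Nat.sub_self] at h1
    refine ⟨(hF0.mono (by simp) (by simp)).trans hF, ⟨lab, h3, h1.first hH.tables hρ⟩, ?_⟩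
    simp at hτ
    omega

end best

/-! ### Gluing the pieces -/

/-- Invariant of the gluing process, where the pairs with property `P` have been treated. -/
structure Glued {n : ℕ} (s : ℕ) (ρ : Fin n → ℕ) (R : ℕ → Prop) (f₀ : Fin n → Fin n)
    (P : Fin n → Fin n → Prop) (f : Fin n → Fin n) : Prop where
  finer : Finer f₀ f
  lt : ∀ r, pieceW ρ f r < s
  ok : R (codeM ρ f)
  pairs : ∀ u v, P u v → ∀ g, IsFinal ρ (s - 1) g → Finer f g → f u = f v ∨ g u ≠ g v

section Glued

variable {n s m : ℕ} {ρ : Fin n → ℕ} {R : ℕ → Prop} {f₀ f : Fin n → Fin n}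
  {P : Fin n → Fin n → Prop} {u v : Fin n}

theorem Glued.merge (h : Glued s ρ R f₀ P f) (hne : f u ≠ f v)
    (hs : pieceW ρ f (f u) + pieceW ρ f (f v) < s)
    (hR : R (codeM ρ fun x => rl (f u) (f v) (f x))) :
    Glued s ρ R f₀ (fun u' v' => P u' v' ∨ (u' = u ∧ v' = v)) fun x => rl (f u) (f v) (f x) := by
  have hfin := finer_rl f (f u) (f v)
  refine ⟨h.finer.trans hfin, pieceW_lt_rl h.lt hne hs, hR, ?_⟩
  rintro u' v' (hp | ⟨rfl, rfl⟩) g hg hfg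
  · exact (h.pairs u' v' hp g hg (hfin.trans hfg)).imp_left fun h => hfin _ _ h
  · left
    simp [rl]

/-- If a final `g` coarser than `f` united `u` and `v`, then gluing their pieces would stay finer
than `g`, hence have weight below `s` and a code in the table. A refusal is therefore definitive:
later labellings are coarser and leave fewer `g` to consider, so no pair needs a second test. -/
theorem Glued.skip (hRt : GlueTable n s m R) (hI : Inst s m ρ) (h : Glued s ρ R f₀ P f)
    (hc : f u ≠ f v → pieceW ρ f (f u) + pieceW ρ f (f v) < s →
      ¬ R (codeM ρ fun x => rl (f u) (f v) (f x))) :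
    Glued s ρ R f₀ (fun u' v' => P u' v' ∨ (u' = u ∧ v' = v)) f := by
  refine ⟨h.finer, h.lt, h.ok, ?_⟩
  rintro u' v' (hp | ⟨rfl, rfl⟩) g hg hfg
  · exact h.pairs u' v' hp g hg hfg
  · by_contra! hcon
    obtain ⟨h1, h2⟩ := hcon
    have hfin := finer_rl_of hfg h2
    refine hc h1 ?_ (hRt.of_isFinal hI hg hfin)
    have := pieceW_lt_of_finer hI hfin hg (f v')
    rwa [pieceW_rl_right _ f h1] at this

/-- The table still provides a final `g` coarser than `f`. Once all pairs are treated, `g` unites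
nothing that `f` separates, so both have the same pieces. -/
theorem Glued.isFinal (hRt : GlueTable n s m R) (hI : Inst s m ρ) (h : Glued s ρ R f₀ P f)
    (hP : ∀ u v, P u v) : IsFinal ρ (s - 1) f := by
  obtain ⟨g, hg, hfg⟩ := hRt.exists_isFinal hI h.lt h.ok
  intro u
  rw [← hg u]
  unfold pieceW
  congr 1
  ext x
  simp only [mem_filter, mem_univ, true_and]
  refine ⟨hfg x u, fun hx => ?_⟩
  exact (h.pairs x u (hP x u) g hg hfg).resolve_right fun hc => hc hx

end Glued

/-- Compute the weights of the pieces in registers 22 and 23. -/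
def weighProg : Prog :=
  .assign 24 (const 0) ;; .assign 25 (const 0) ;; forLoop 26 0
    (.assign 24 (reg 24 + eqT (rd 10 (reg 26)) (reg 22) * rd 11 (reg 26)) ;;
      .assign 25 (reg 25 + eqT (rd 10 (reg 26)) (reg 23) * rd 11 (reg 26)))

/-- Give the label in register 23 to the piece in register 22. -/
def relabelProg : Prog :=
  forLoop 26 0 (.cond (eqT (rd 10 (reg 26)) (reg 22)) (put 10 (reg 26) (reg 23)) .skip)

/-- Glue the pieces of the vertices in registers 20 and 21 if possible. -/
def pairBody : Prog :=
  .assign 22 (rd 10 (reg 20)) ;; .assign 23 (rd 10 (reg 21)) ;;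
    .cond (neT (reg 22) (reg 23)) (weighProg ;;
      .cond (ltT (reg 24 + reg 25) (reg 4))
        (.assign 27 (reg 11 + rd 2 (reg 24 + reg 25) - rd 2 (reg 24) - rd 2 (reg 25)) ;;
          .cond (rd 3 (reg 27)) (.assign 11 (reg 27) ;; relabelProg) .skip) .skip) .skip

/-- Glue all pieces. -/
def pairProg : Prog :=
  .assign 11 (reg 13 / reg 7 / reg 4 + rd 2 (reg 13 / reg 7 % reg 4)) ;;
    forLoop 20 0 (forLoop 21 0 pairBody)

theorem pieceW_eq_psum {n : ℕ} (ρ : Fin n → ℕ) (f : Fin n → Fin n) (a : Fin n) :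
    pieceW ρ f a = psum (fun w => if f w = a then ρ w else 0) n := by
  rw [psum_self, pieceW, sum_filter]

/-! ### Specification of the gluing pass -/

section pair

variable {W n s N L m τ : ℕ} {σ : State} {G : SimpleGraph (Fin n)} {ρ : Fin n → ℕ}
  {f : Fin n → Fin n} {a b u v : Fin n}

theorem wp_weighProg (hS : Size n s N L W) (hE : Env n s N L m G ρ σ)
    (hf : ∀ w : Fin n, σ.mem (cell (n + n * n) 10 w) = f w) (h22 : σ.reg 22 = a)
    (h23 : σ.reg 23 = b) (hlt : ∀ r, pieceW ρ f r < s) :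
    wp W weighProg (fun σ' τ' => Frame (n + n * n) [24, 25, 26] [] σ σ' ∧
      σ'.reg 24 = pieceW ρ f a ∧ σ'.reg 25 = pieceW ρ f b ∧ τ' ≤ τ + (n * 108 + 20)) σ τ := by
  obtain ⟨f1, f2, f3, f4, f5, f6, f7, f8, f9, f10⟩ := hS.facts
  refine wp_seq (wp_assign (fun hB => by simp) (wp_seq (wp_assign (fun hB => by simp) ?_)))
  simp only [eval_const]
  set σ1 := (σ.set 24 0).set 25 0 with hσ1
  have hF1 : Frame (n + n * n) [24, 25] [] σ σ1 :=
    ((Frame.refl _ _ _ _).set (by decide)).set (by decide)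
  have hE1 := hE.frame hF1 rfl rfl
  refine wp_forLoop (Z := n + n * n) [24, 25] []
    (fun j σ' => σ'.reg 24 = psum (fun w => if f w = a then ρ w else 0) j ∧
      σ'.reg 25 = psum (fun w => if f w = b then ρ w else 0) j)
    100 n hE1.r0 (by omega) hE1.r2 (by decide) (by decide) (by decide)
    (by decide) (by decide) (by decide) (fun j σ' v h => by simpa [State.set_reg] using h)
    (by simp [hσ1, State.set_reg]) ?_ ?_
  · rintro j σ' τ' hj hF hij ⟨h24, h25⟩
    have hE2 := hE1.frame hF rfl rfl
    have k22 : σ'.reg 22 = a := (hF.reg 22 rfl).trans ((hF1.reg 22 rfl).trans h22)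
    have k23 : σ'.reg 23 = b := (hF.reg 23 rfl).trans ((hF1.reg 23 rfl).trans h23)
    have hr := hE2.rho ⟨j, hj⟩
    have hfj : σ'.mem (cell (n + n * n) 10 j) = f ⟨j, hj⟩ := by
      rw [hF.arr 10 j rfl (by omega), hF1.arr 10 j rfl (by omega)]
      exact hf ⟨j, hj⟩
    simp only at hr
    have hmul : ∀ c : Fin n, (if (f ⟨j, hj⟩ : ℕ) = c then 1 else 0) * ρ ⟨j, hj⟩ =
        if f ⟨j, hj⟩ = c then ρ ⟨j, hj⟩ else 0 := by
      intro c
      simp only [Fin.ext_iff]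
      split <;> simp
    have hle : ∀ c : Fin n, psum (fun w => if f w = c then ρ w else 0) j +
        (if f ⟨j, hj⟩ = c then ρ ⟨j, hj⟩ else 0) < s := by
      intro c
      have h1 := psum_succ (fun w => if f w = c then ρ w else 0) hj
      have h2 := psum_le (fun w => if f w = c then ρ w else 0) (j + 1)
      have h3 := hlt c
      rw [pieceW_eq_psum, psum_self] at h3
      omega
    have hla := hle a
    have hlb := hle b
    have h16 : 16 ≤ W := by omega
    have hcj : ∀ i < 16, cell (n + n * n) i j ≤ W := by
      intro i hi
      simp only [cell]
      omega
    have hc10 := hcj 10 (by omega)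
    have hc11 := hcj 11 (by omega)
    refine wp_bounded fun hB0 => ?_
    have hρW := hB0.mem (cell (n + n * n) 11 j)
    rw [hr] at hρW
    have hfW : (f ⟨j, hj⟩ : ℕ) ≤ W := by have := (f ⟨j, hj⟩).2; omega
    refine wp_seq (wp_assign (fun hB => ?_) (wp_assign (fun hB => ?_) ⟨by simp, ?_, ?_⟩))
    · simp only [fits_add, fits_mul, fits_eqT' (show 1 ≤ W by omega), fits_rd, fits_reg, hB.reg,
        eval_add, eval_mul, eval_eqT, eval_rd, eval_reg, hE2.r2, hij, hfj, hr, k22, h24, hmul,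
        true_and, and_true]
      omega
    · simp only [fits_add, fits_mul, fits_eqT' (show 1 ≤ W by omega), fits_rd, fits_reg, hB.reg,
        State.set_reg, State.set_mem, Nat.reduceEqDiff, if_false,
        eval_add, eval_mul, eval_eqT, eval_rd, eval_reg, hE2.r2, hij, hfj, hr, k23, h25, hmul,
        true_and, and_true]
      have := b.2
      omega
    · simp only [State.set_reg, State.set_mem, Nat.reduceEqDiff, if_false, if_true,
        eval_add, eval_mul, eval_eqT, eval_rd, eval_reg, hE2.r2, hij, hfj, hr, k22, h24, hmul]
      rw [psum_succ _ hj]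
    · simp only [State.set_reg, State.set_mem, Nat.reduceEqDiff, if_false, if_true,
        eval_add, eval_mul, eval_eqT, eval_rd, eval_reg, hE2.r2, hij, hfj, hr, k23, h25, hmul]
      rw [psum_succ _ hj]
  · rintro σ' τ' hF ⟨h24, h25⟩ hτ
    refine ⟨(hF1.mono (by simp) (by simp)).trans (hF.mono (by simp) (by simp)), ?_, ?_, ?_⟩
    · rw [h24, pieceW_eq_psum]
    · rw [h25, pieceW_eq_psum]
    · simp at hτ
      omega

theorem wp_relabelProg (hS : Size n s N L W) (hE : Env n s N L m G ρ σ)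
    (hf : ∀ w : Fin n, σ.mem (cell (n + n * n) 10 w) = f w) (h22 : σ.reg 22 = a)
    (h23 : σ.reg 23 = b) :
    wp W relabelProg (fun σ' τ' => Frame (n + n * n) [26] [10] σ σ' ∧
      (∀ w : Fin n, σ'.mem (cell (n + n * n) 10 w) = rl a b (f w)) ∧
      τ' ≤ τ + (n * 108 + 20)) σ τ := by
  obtain ⟨f1, f2, f3, f4, f5, f6, f7, f8, f9, f10⟩ := hS.facts
  refine wp_forLoop (Z := n + n * n) [] [10]
    (fun j σ' => ∀ w : Fin n, σ'.mem (cell (n + n * n) 10 w) =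
      if (w : ℕ) < j then (rl a b (f w) : Fin n) else f w)
    100 n hE.r0 (by omega) hE.r2 (by decide) (by decide) (by decide)
    (by decide) (by decide) (by decide) (fun j σ' v h => h) (by simpa using hf) ?_ ?_
  · intro j σ' τ' hj hF hij hI
    have e2 := (hE.frame hF rfl rfl).r2
    have k22 : σ'.reg 22 = a := (hF.reg 22 rfl).trans h22
    have k23 : σ'.reg 23 = b := (hF.reg 23 rfl).trans h23
    have hfj := hI ⟨j, hj⟩
    simp only [lt_irrefl, if_false] at hfj
    have hcj : cell (n + n * n) 10 j ≤ W := by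
      simp only [cell]
      omega
    refine wp_cond (fun hB => ?_) (fun h => ?_) (fun h => ?_)
    · simp only [fits_eqT' (show 1 ≤ W by omega), fits_rd, fits_reg, hB.reg, hB.mem, eval_reg, e2,
        hij, true_and, and_true]
      omega
    · simp only [eval_eqT, eval_rd, eval_reg, e2, hij, hfj, k22, ← Fin.ext_iff] at h
      have h' : f ⟨j, hj⟩ = a := by
        by_contra hc
        simp [hc] at h
      refine wp_put (fun hB => ?_) ⟨by simp, fun w => ?_⟩
      · simp only [fits_reg, hB.reg, eval_reg, e2, hij, true_and]
        omega
      · simp only [eval_reg, e2, hij, k23]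
        rw [State.write_cell (by omega), hI w]
        by_cases hwj : (w : ℕ) = j
        · obtain rfl : w = ⟨j, hj⟩ := Fin.ext hwj
          simp [h', rl]
        · rw [if_neg hwj]
          simp only [show (w : ℕ) < j + 1 ↔ (w : ℕ) < j by omega]
    · simp only [eval_eqT, eval_rd, eval_reg, e2, hij, hfj, k22, ← Fin.ext_iff] at h
      have h' : f ⟨j, hj⟩ ≠ a := by
        intro hc
        simp [hc] at h
      refine wp_skip ⟨by simp, fun w => ?_⟩
      rw [hI w]
      by_cases hwj : (w : ℕ) = j
      · obtain rfl : w = ⟨j, hj⟩ := Fin.ext hwj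
        simp [h', rl]
      · simp only [show (w : ℕ) < j + 1 ↔ (w : ℕ) < j by omega]
  · intro σ' τ' hF hI hτ
    exact ⟨hF, fun w => by rw [hI w, if_pos w.2], by omega⟩

/-- The state describes pieces that satisfy the invariant of the gluing process. -/
def GluedState {n : ℕ} (s : ℕ) (ρ : Fin n → ℕ) (R : ℕ → ℕ) (f₀ : Fin n → Fin n)
    (P : Fin n → Fin n → Prop) (σ : State) : Prop :=
  ∃ f, (∀ w : Fin n, σ.mem (cell (n + n * n) 10 w) = (f w : Fin n)) ∧ σ.reg 11 = codeM ρ f ∧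
    Glued s ρ (fun M => R M ≠ 0) f₀ P f

theorem wp_pairBody {R : ℕ → ℕ} {f₀ : Fin n → Fin n} {P : Fin n → Fin n → Prop}
    (hS : Size n s N L W) (hE : Env n s N L m G ρ σ) (hI : Inst s m ρ)
    (hR : ∀ M, σ.mem (cell (n + n * n) 3 M) = R M) (hRt : GlueTable n s m fun M => R M ≠ 0)
    (h20 : σ.reg 20 = u) (h21 : σ.reg 21 = v) (hG : GluedState s ρ R f₀ P σ) :
    wp W pairBody (fun σ' τ' => τ' ≤ τ + (n * 216 + 300) ∧
      GluedState s ρ R f₀ (fun u' v' => P u' v' ∨ (u' = u ∧ v' = v)) σ') σ τ := by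
  obtain ⟨f1, f2, f3, f4, f5, f6, f7, f8, f9, f10⟩ := hS.facts
  have hs2 := hS.two_le_s
  obtain ⟨f, hf, h11, hGl⟩ := hG
  have hu := u.2
  have hv := v.2
  have hfu := hf u
  have hfv := hf v
  have hcd := codeM_lt hI hGl.lt
  rw [← hS.N_eq] at hcd
  refine wp_seq (wp_assign (fun hB => ?_) (wp_seq (wp_assign (fun hB => ?_) ?_)))
  · simp only [fits_rd, fits_reg, hB.reg, hB.mem, eval_reg, hE.r2, h20, true_and, and_true]
    simp only [cell]
    omega
  · have hB1 := hB.mem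
    simp only [State.set_mem] at hB1
    simp only [fits_rd, fits_reg, hB.reg, hB1, eval_reg, State.set_reg, State.set_mem,
      Nat.reduceEqDiff, if_false, hE.r2, h21, true_and, and_true]
    simp only [cell]
    omega
  simp only [eval_rd, eval_reg, State.set_reg, State.set_mem, Nat.reduceEqDiff, if_false, hE.r2,
    h20, h21, hfu, hfv]
  set σ1 := (σ.set 22 (f u)).set 23 (f v) with hσ1
  have hF1 : Frame (n + n * n) [22, 23] [] σ σ1 :=
    ((Frame.refl _ _ _ _).set (by decide)).set (by decide)
  have hE1 := hE.frame hF1 rfl rfl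
  have g22 : σ1.reg 22 = f u := by simp [hσ1, State.set_reg]
  have g23 : σ1.reg 23 = f v := by simp [hσ1, State.set_reg]
  refine wp_cond (fun hB => ?_) (fun h => ?_) (fun h => ?_)
  · simp only [fits_neT (show 1 ≤ W by omega), fits_reg, hB.reg, true_and]
  · have hne : f u ≠ f v := by
      intro hc
      simp [g22, g23, hc] at h
    refine wp_seq (wp_mono (wp_weighProg hS hE1 hf g22 g23 hGl.lt) ?_)
    rintro σ2 τ2 ⟨hF2, h24, h25, hτ2⟩
    have hE2 := hE1.frame hF2 rfl rfl
    have hf2 : ∀ w : Fin n, σ2.mem (cell (n + n * n) 10 w) = f w := fun w => by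
      rw [hF2.arr 10 w rfl (by omega), hF1.arr 10 w rfl (by omega), hf w]
    have k11 : σ2.reg 11 = codeM ρ f := (hF2.reg 11 rfl).trans ((hF1.reg 11 rfl).trans h11)
    have wu := hGl.lt (f u)
    have wv := hGl.lt (f v)
    refine wp_cond (fun hB => ?_) (fun h => ?_) (fun h => ?_)
    · simp only [fits_ltT' (show 1 ≤ W by omega), fits_add, fits_reg, hB.reg, eval_reg, h24, h25,
        true_and, and_true]
      omega
    · have hlt : pieceW ρ f (f u) + pieceW ρ f (f v) < s := by
        simpa [h24, h25, hE2.r4] using h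
      have p1 := hE2.pw _ hlt
      have p2 := hE2.pw _ wu
      have p3 := hE2.pw _ wv
      have q1 := pw_le hS hlt
      have q2 := pw_le hS wu
      have q3 := pw_le hS wv
      -- The code of the glued labelling is updated from the two weights alone; it need not be
      -- recomputed from the labels.
      have hcode : codeM ρ f + pw n (pieceW ρ f (f u) + pieceW ρ f (f v))
          - pw n (pieceW ρ f (f u)) - pw n (pieceW ρ f (f v))
          = codeM ρ fun x => rl (f u) (f v) (f x) := by
        have := codeM_rl (ρ := ρ) f hne
        omega
      refine wp_seq (wp_assign (fun hB => ?_) ?_)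
      · simp only [fits_sub, fits_add, fits_rd, fits_reg, hB.reg, hB.mem, eval_add, eval_rd,
          eval_reg, hE2.r2, h24, h25, k11, p1, p2, p3, true_and, and_true]
        simp only [cell]
        omega
      simp only [eval_sub, eval_add, eval_rd, eval_reg, hE2.r2, h24, h25, k11, p1, p2, p3, hcode]
      set σ3 := σ2.set 27 (codeM ρ fun x => rl (f u) (f v) (f x)) with hσ3
      have hF3 : Frame (n + n * n) [27] [] σ2 σ3 := (Frame.refl _ _ _ _).set (by decide)
      have hE3 := hE2.frame hF3 rfl rfl
      have k27 : σ3.reg 27 = codeM ρ fun x => rl (f u) (f v) (f x) := by simp [hσ3]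
      have hR3 : ∀ M, σ3.mem (cell (n + n * n) 3 M) = R M := fun M => by
        rw [hF3.arr 3 M rfl (by omega), hF2.arr 3 M rfl (by omega), hF1.arr 3 M rfl (by omega), hR]
      have hcl : (codeM ρ fun x => rl (f u) (f v) (f x)) ≤ 2 * N := by omega
      refine wp_cond (fun hB => ?_) (fun h => ?_) (fun h => ?_)
      · simp only [fits_rd, fits_reg, hB.reg, hB.mem, eval_reg, hE3.r2, k27, true_and, and_true]
        simp only [cell]
        omega
      · simp only [eval_rd, eval_reg, hE3.r2, k27, hR3] at h
        refine wp_seq (wp_assign (fun hB => hB.reg _) ?_)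
        have hF4 : Frame (n + n * n) [11] [] σ3 (σ3.set 11 (eval σ3 (reg 27))) :=
          (Frame.refl _ _ _ _).set (by decide)
        refine wp_mono (wp_relabelProg hS (hE3.frame hF4 rfl rfl) (f := f) (a := f u) (b := f v)
          hf2 ?_ ?_) ?_
        · rw [hF4.reg 22 rfl, hF3.reg 22 rfl, hF2.reg 22 rfl, g22]
        · rw [hF4.reg 23 rfl, hF3.reg 23 rfl, hF2.reg 23 rfl, g23]
        rintro σ5 τ5 ⟨hF5, hf5, hτ5⟩
        refine ⟨?_, _, hf5, ?_, hGl.merge hne hlt h⟩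
        · simp at hτ2 hτ5 ⊢
          omega
        · rw [hF5.reg 11 rfl, State.set_reg_self, eval_reg, k27]
      · simp only [eval_rd, eval_reg, hE3.r2, k27, hR3] at h
        refine wp_skip ⟨?_, f, hf2, (hF3.reg 11 rfl).trans k11, hGl.skip hRt hI fun _ _ hc => hc h⟩
        simp at hτ2 ⊢
        omega
    · refine wp_skip ⟨?_, f, hf2, k11, hGl.skip hRt hI fun _ hc _ => ?_⟩
      · simp at hτ2 ⊢
        omega
      · simp [h24, h25, hE2.r4] at h
        omega
  · refine wp_skip ⟨?_, f, hf, (hF1.reg 11 rfl).trans h11, hGl.skip hRt hI fun hc _ _ => ?_⟩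
    · simp
      omega
    · simp only [eval_neT, eval_reg, g22, g23] at h
      apply hc
      by_contra hc'
      have : (f u : ℕ) ≠ f v := fun h => hc' (Fin.ext h)
      simp [this] at h

theorem wp_pairProg {X : ℕ} (hS : Size n s N L W) (hE : Env n s N L m G ρ σ) (hI : Inst s m ρ)
    (hRt : GlueTable n s m fun M => σ.mem (cell (n + n * n) 3 M) ≠ 0)
    (h13 : σ.reg 13 = X) (hX : X < L) (hcode : entryM n s X = codeM ρ f)
    (hf : ∀ w : Fin n, σ.mem (cell (n + n * n) 10 w) = f w) (hlt : ∀ r, pieceW ρ f r < s)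
    (hok : σ.mem (cell (n + n * n) 3 (codeM ρ f)) ≠ 0) :
    wp W pairProg (fun σ' τ' => Frame (n + n * n) [11, 20, 21, 22, 23, 24, 25, 26, 27] [10] σ σ' ∧
      (∃ g : Fin n → Fin n, (∀ w : Fin n, σ'.mem (cell (n + n * n) 10 w) = g w) ∧ Finer f g ∧
        IsFinal ρ (s - 1) g) ∧ τ' ≤ τ + 600 * (L * L)) σ τ := by
  obtain ⟨f1, f2, f3, f4, f5, f6, f7, f8, f9, f10⟩ := hS.facts
  have hn := hS.two_le_n
  have hs2 := hS.two_le_s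
  have hh : X / (2 * n) % s < s := Nat.mod_lt _ (by omega)
  have hpw := hE.pw _ hh
  have hpl := pw_le hS hh
  have hd : X / (2 * n) / s ≤ X := (Nat.div_le_self _ _).trans (Nat.div_le_self _ _)
  refine wp_seq (wp_assign (fun hB => ?_) ?_)
  · simp only [fits_add, fits_div, fits_mod, fits_rd, fits_reg, hB.reg, hB.mem, eval_div, eval_mod,
      eval_rd, eval_reg, hE.r2, hE.r4, hE.r7, h13, hpw, true_and, and_true]
    simp only [cell]
    omega
  simp only [eval_add, eval_div, eval_mod, eval_rd, eval_reg, hE.r2, hE.r4, hE.r7, h13, hpw]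
  have hc : X / (2 * n) / s + pw n (X / (2 * n) % s) = codeM ρ f := hcode
  rw [hc]
  set σ1 := σ.set 11 (codeM ρ f) with hσ1
  have hF1 : Frame (n + n * n) [11] [] σ σ1 := (Frame.refl _ _ _ _).set (by decide)
  have hE1 := hE.frame hF1 rfl rfl
  set R := fun M => σ.mem (cell (n + n * n) 3 M) with hR
  have hstart : GluedState s ρ R f (fun _ _ => False) σ1 :=
    ⟨f, hf, by simp [hσ1], fun _ _ h => h, hlt, hok, by simp⟩
  have hset : ∀ P σ' i v, i ≠ 11 → GluedState s ρ R f P σ' → GluedState s ρ R f P (σ'.set i v) := by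
    rintro P σ' i v hi ⟨g, h1, h2, h3⟩
    exact ⟨g, h1, by rw [State.set_reg, if_neg (Ne.symm hi), h2], h3⟩
  have hcongr : ∀ {P Q : Fin n → Fin n → Prop} {σ'}, (∀ u v, Q u v → P u v) →
      GluedState s ρ R f P σ' → GluedState s ρ R f Q σ' := by
    rintro P Q σ' hPQ ⟨g, h1, h2, h3⟩
    exact ⟨g, h1, h2, h3.finer, h3.lt, h3.ok, fun u v h => h3.pairs u v (hPQ u v h)⟩
  refine wp_forLoop (Z := n + n * n) [11, 21, 22, 23, 24, 25, 26, 27] [10]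
    (fun j σ' => GluedState s ρ R f (fun u _ => (u : ℕ) < j) σ')
    (n * (n * 216 + 308) + 6) n hE1.r0 (by omega) hE1.r2 (by decide) (by decide) (by decide)
    (by decide) (by decide) (by decide) (fun j σ' v h => hset _ _ _ _ (by decide) h)
    (hcongr (by simp) hstart) ?_ ?_
  · intro j σ' τ' hj hF hij hG
    have hE2 := hE1.frame hF rfl rfl
    refine wp_forLoop (Z := n + n * n) [11, 22, 23, 24, 25, 26, 27] [10]
      (fun j' σ' => GluedState s ρ R f
        (fun u v => (u : ℕ) < j ∨ ((u : ℕ) = j ∧ (v : ℕ) < j')) σ')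
      (n * 216 + 300) n hE2.r0 (by omega) hE2.r2 (by decide) (by decide) (by decide)
      (by decide) (by decide) (by decide) (fun j σ' v h => hset _ _ _ _ (by decide) h)
      (hcongr (by simp) hG) ?_ ?_
    · intro j' σ3 τ3 hj' hF3 hij' hG3
      refine wp_mono (wp_pairBody (u := ⟨j, hj⟩) (v := ⟨j', hj'⟩) hS (hE2.frame hF3 rfl rfl) hI
        (fun M => ?_) hRt ((hF3.reg 20 rfl).trans hij) hij' hG3) ?_
      · rw [hF3.arr 3 M rfl (by omega), hF.arr 3 M rfl (by omega), hF1.arr 3 M rfl (by omega)]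
      · rintro σ4 τ4 ⟨h1, h2⟩
        refine ⟨h1, hcongr (fun u v h => ?_) h2⟩
        simp only [Fin.ext_iff]
        omega
    · intro σ3 τ3 hF3 hG3 hτ3
      refine ⟨by rw [add_assoc] at hτ3; exact hτ3, hcongr (fun u v h => ?_) hG3⟩
      have := v.2
      omega
  · rintro σ' τ' hF ⟨g, h1, h2, h3⟩ hτ
    refine ⟨(hF1.mono (by simp) (by simp)).trans (hF.mono (by simp) (by simp)),
      ⟨g, h1, h3.finer, h3.isFinal hRt hI fun u _ => u.2⟩, ?_⟩
    simp only [steps_add, steps_div, steps_mod, steps_rd, steps_reg] at hτ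
    have e1 : n * (n * (n * 216 + 308) + 6 + 8)
        = 216 * (n * (n * n)) + 308 * (n * n) + 14 * n := by
      ring
    have e2 : n * (n * n) ≤ n * L := Nat.mul_le_mul_left _ f1
    have e3 : 2 * L ≤ n * L := Nat.mul_le_mul_right _ hn
    omega

end pair

/-! ### The complete program -/

/-- Replace the colors by the labels. -/
def outProg : Prog := forLoop 10 0 (.store (reg 10) (rd 10 (reg 10)))

/-- Preprocessing. -/
def preProg : Prog :=
  .assign 2 (reg 0 + reg 0 * reg 0) ;; countProg ;; gcdProg ;; radProg ;; rhoProg ;; pwProg ;;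
    constProg

/-- Compute all tables. -/
def tableProg : Prog := glueProg ;; initProg ;; elimProg

/-- Compute the partition from the tables. -/
def partProg : Prog := bestProg ;; traceProg ;; pairProg ;; outProg

/-- A program that solves Fair Correlation Clustering on forests. -/
def solveProg : Prog := preProg ;; tableProg ;; partProg

/-! ### The input state and the preprocessing -/

section pre

variable {W n k s N L m : ℕ} {G : SimpleGraph (Fin n)} {ρ : Fin n → ℕ} {c : Fin k → ℕ}
  {col : Fin n → Fin k}

theorem inputState_mem_col (v : Fin n) : (inputState G col).mem v = col v := by
  simp [inputState]

theorem inputState_mem_adj (u v : Fin n) : (inputState G col).mem (n + u * n + v) = adj01 G u v := by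
  have h1 : ¬ (n + u * n + v < n) := by omega
  have h : (∃ u' v' : Fin n, n + u * n + v = n + (u' : ℕ) * n + v' ∧ G.Adj u' v') ↔ G.Adj u v := by
    refine ⟨?_, fun h => ⟨u, v, rfl, h⟩⟩
    rintro ⟨u', v', h2, h3⟩
    have hdm : ∀ {a x : ℕ}, x < n → (a * n + x) / n = a := by
      intro a x hx
      rw [mul_comm, Nat.mul_add_div (by omega), Nat.div_eq_of_lt hx, add_zero]
    have h4 : (u : ℕ) = u' := by
      rw [← hdm v.2 (a := u), show (u : ℕ) * n + v = u' * n + v' by omega, hdm v'.2]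
    obtain rfl : u = u' := Fin.ext h4
    obtain rfl : v = v' := Fin.ext (by omega)
    exact h3
  simp only [inputState, h1, dif_neg, not_false_eq_true]
  by_cases hA : G.Adj u v
  · rw [if_pos (h.2 hA), adj01, if_pos hA]
  · rw [if_neg (fun hc => hA (h.1 hc)), adj01, if_neg hA]

theorem inputState_mem_cell (j i : ℕ) : (inputState G col).mem (cell (n + n * n) j i) = 0 := by
  have h1 : ¬ (cell (n + n * n) j i < n) := by
    unfold cell
    omega
  simp only [inputState, h1, dif_neg, not_false_eq_true]
  rw [if_neg]
  rintro ⟨u, v, h, -⟩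
  have := index_lt u v
  unfold cell at h
  omega

theorem inputState_bounded (hn : n ≤ W) (hk : k ≤ W) (h1 : 1 ≤ W) :
    Bounded W (inputState G col) := by
  refine ⟨fun r => ?_, fun a => ?_⟩
  · simp only [inputState]
    split
    · exact hn
    · split <;> omega
  · simp only [inputState]
    split
    · rename_i h
      have := (col ⟨a, h⟩).2
      omega
    · split <;> omega

theorem wp_preProg (hS : Size n s N L W) (hk : k ≤ n) (hs : s = setvars c) (hm : 0 < m)
    (hmn : m < n) (hg : univ.gcd c = 1) (hcol : ∀ i, #(colorClass col i) = m * c i) :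
    wp W preProg (fun σ' τ' => Env n s N L m G (rho c col) σ' ∧
      (∀ M, σ'.mem (cell (n + n * n) 3 M) = 0) ∧ (∀ M, σ'.mem (cell (n + n * n) 4 M) = 0) ∧
      (∀ M, σ'.mem (cell (n + n * n) 6 M) = 0) ∧ τ' ≤ 1000 * (L * L)) (inputState G col) 0 := by
  obtain ⟨f1, f2, f3, f4, f5, f6, f7, f8, f9, f10⟩ := hS.facts
  have hn := hS.two_le_n
  have hs2 := hS.two_le_s
  refine wp_seq (wp_assign (fun hB => ?_) ?_)
  · simp [inputState]
    omega
  simp only [eval_add, eval_mul, eval_reg, show (inputState G col).reg 0 = n from rfl]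
  set σ0 := (inputState G col).set 2 (n + n * n) with hσ0
  have e0 : σ0.reg 0 = n := by simp [hσ0, State.set_reg, inputState]
  have e1 : σ0.reg 1 = k := by simp [hσ0, State.set_reg, inputState]
  have e2 : σ0.reg 2 = n + n * n := by simp [hσ0]
  refine wp_seq (wp_mono (wp_countProg (col := col) e0 e2 (by omega) hk (by omega)
    inputState_mem_col (inputState_mem_cell 0)) ?_)
  rintro σ1 τ1 ⟨hF1, hc1, hτ1⟩
  have hc1' : ∀ i : Fin k, σ1.mem (cell (n + n * n) 0 i) = m * c i :=
    fun i => (hc1 i).trans (hcol i)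
  refine wp_seq (wp_mono (wp_gcdProg ((hF1.reg 0 rfl).trans e0) ((hF1.reg 1 rfl).trans e1) hk hm
    hmn.le hg ((hF1.reg 2 rfl).trans e2) (by omega) hc1') ?_)
  rintro σ2 τ2 ⟨hF2, h3, hτ2⟩
  have hF02 : Frame (n + n * n) [3, 10, 11, 12, 13] [0] σ0 σ2 :=
    (hF1.mono (by simp) (by simp)).trans (hF2.mono (by simp) (by simp))
  refine wp_seq (wp_mono (wp_radProg (c := c) ((hF02.reg 1 rfl).trans e1) hk h3 hm
    ((hF02.reg 2 rfl).trans e2) (by omega) (by omega)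
    (fun i => (hF2.arr 0 i rfl (by omega)).trans (hc1' i))) ?_)
  rintro σ3 τ3 ⟨hF3, h4, hr3, hτ3⟩
  have hF03 : Frame (n + n * n) [3, 4, 10, 11, 12, 13] [0, 1] σ0 σ3 :=
    (hF02.mono (by simp) (by simp)).trans (hF3.mono (by simp) (by simp))
  refine wp_seq (wp_mono (wp_rhoProg (c := c) (col := col) ((hF03.reg 0 rfl).trans e0) hk
    ((hF03.reg 2 rfl).trans e2) (by omega) (by omega)
    (fun v => (hF03.inp v (by omega)).trans (inputState_mem_col v)) hr3) ?_)
  rintro σ4 τ4 ⟨hF4, hρ4, hτ4⟩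
  have hF04 : Frame (n + n * n) [3, 4, 10, 11, 12, 13] [0, 1, 11] σ0 σ4 :=
    (hF03.mono (by simp) (by simp)).trans (hF4.mono (by simp) (by simp))
  refine wp_seq (wp_mono (wp_pwProg (s := s) ((hF04.reg 0 rfl).trans e0) (by omega)
    (((hF4.reg 4 rfl).trans h4).trans hs.symm) (by omega) ((hF04.reg 2 rfl).trans e2) (by omega)
    (by rw [← hS.N_eq]; omega)
    ((hF04.arr 2 0 rfl (by omega)).trans (inputState_mem_cell 2 0))) ?_)
  rintro σ5 τ5 ⟨hF5, h5, hpw5, hτ5⟩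
  have hF05 : Frame (n + n * n) [3, 4, 5, 10, 11, 12, 13] [0, 1, 2, 11] σ0 σ5 :=
    (hF04.mono (by simp) (by simp)).trans (hF5.mono (by simp) (by simp))
  refine wp_mono (wp_constProg (G := G) (ρ := rho c col) hS hmn ((hF05.reg 0 rfl).trans e0)
    ((hF05.reg 2 rfl).trans e2) ?_ ?_ (h5.trans hS.N_eq.symm)
    (fun u v => (hF05.inp _ (index_lt u v)).trans (inputState_mem_adj u v)) hpw5
    (fun v => (hF5.arr 11 v rfl (by omega)).trans (hρ4 v))) ?_
  · exact (hF5.reg 3 rfl).trans ((hF4.reg 3 rfl).trans ((hF3.reg 3 rfl).trans h3))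
  · exact (hF5.reg 4 rfl).trans (((hF4.reg 4 rfl).trans h4).trans hs.symm)
  rintro σ6 τ6 ⟨hF6, hE6, hτ6⟩
  have hF06 : Frame (n + n * n) [3, 4, 5, 6, 7, 8, 9, 10, 11, 12, 13] [0, 1, 2, 11] σ0 σ6 :=
    (hF05.mono (by simp) (by simp)).trans (hF6.mono (by simp) (by simp))
  refine ⟨hE6, fun M => (hF06.arr 3 M rfl (by omega)).trans (inputState_mem_cell 3 M),
    fun M => (hF06.arr 4 M rfl (by omega)).trans (inputState_mem_cell 4 M),
    fun M => (hF06.arr 6 M rfl (by omega)).trans (inputState_mem_cell 6 M), ?_⟩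
  simp only [steps_add, steps_mul, steps_reg] at hτ1
  omega

end pre

/-! ### The stages of the whole run -/

section solve

variable {W n s N L m τ : ℕ} {σ : State} {G : SimpleGraph (Fin n)} {ρ : Fin n → ℕ}
  {f g : Fin n → Fin n}

/-- The output overwrites the input cells, which the frame rule does not permit, hence the loop rule
without frame. The labels in array 10 lie above the cells that are written. -/
theorem wp_outProg (hS : Size n s N L W) (h0 : σ.reg 0 = n) (h2 : σ.reg 2 = n + n * n)
    (hf : ∀ w : Fin n, σ.mem (cell (n + n * n) 10 w) = f w) :
    wp W outProg (fun σ' τ' => (∀ w : Fin n, σ'.mem w = f w) ∧ τ' ≤ τ + 100 * L) σ τ := by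
  obtain ⟨f1, f2, f3, f4, f5, f6, f7, f8, f9, f10⟩ := hS.facts
  refine wp_forLoop_of_inv (fun j σ' => σ'.reg 2 = n + n * n ∧
    (∀ w : Fin n, σ'.mem (cell (n + n * n) 10 w) = f w) ∧ ∀ w : Fin n, (w : ℕ) < j → σ'.mem w = f w)
    40 n h0 (by omega) (by decide) (fun j s' v h => by simpa [State.set_reg] using h)
    ⟨h2, hf, by simp⟩ ?_ ?_
  · rintro j σ' τ' hj hij h0' ⟨k2, kf, kd⟩
    refine wp_store (fun hB => ?_) ⟨by simp, hij, h0', k2, fun w => ?_, fun w hw => ?_⟩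
    · simp only [fits_reg, fits_rd, hB.reg, hB.mem, eval_reg, k2, hij, true_and, and_true]
      simp only [cell]
      omega
    · simp only [eval_reg, eval_rd, hij, State.write_mem]
      rw [if_neg (by unfold cell; omega), kf w]
    · simp only [eval_reg, eval_rd, hij, k2, State.write_mem]
      split
      · rename_i h
        rw [← h, kf w]
      · exact kd w (by omega)
  · rintro σ' τ' ⟨-, -, h⟩ hτ
    exact ⟨fun w => h w w.2, by omega⟩

theorem wp_tableProg (hS : Size n s N L W) (hE : Env n s N L m G ρ σ) (hG : G.IsAcyclic)
    (hI : Inst s m ρ) (hρ : ∀ u, ρ u < s)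
    (h3 : ∀ M, σ.mem (cell (n + n * n) 3 M) = 0) (h4 : ∀ M, σ.mem (cell (n + n * n) 4 M) = 0)
    (h6 : ∀ M, σ.mem (cell (n + n * n) 6 M) = 0) :
    wp W tableProg (fun σ' τ' => Env n s N L m G ρ σ' ∧
      GlueTable n s m (fun M => σ'.mem (cell (n + n * n) 3 M) ≠ 0) ∧
      (∃ vs ps, Elimination G s ρ L vs ps (n - 1) σ') ∧
      (∀ v : Fin n, σ'.mem (cell (n + n * n) 10 v) = v) ∧
      τ' ≤ τ + 1100 * (n * (L * L))) σ τ := by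
  obtain ⟨f1, f2, f3, f4, f5, f6, f7, f8, f9, f10⟩ := hS.facts
  have hn := hS.two_le_n
  refine wp_seq (wp_mono (wp_glueProg hS hI.m_lt hE h3) ?_)
  rintro σ1 τ1 ⟨hF1, hR1, hτ1⟩
  have hE1 := hE.frame hF1 rfl rfl
  refine wp_seq (wp_mono (wp_initProg hS hE1 hρ
    (fun y => (hF1.arr 4 y rfl (by omega)).trans (h4 y))
    (fun y => (hF1.arr 6 y rfl (by omega)).trans (h6 y)) (fun _ => ⟨0, by omega⟩)
    (fun _ => ⟨0, by omega⟩)) ?_)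
  rintro σ2 τ2 ⟨hF2, hH2, hl2, hτ2⟩
  have hE2 := hE1.frame hF2 rfl rfl
  refine wp_mono (wp_elimProg hS hE2 hG hH2) ?_
  rintro σ3 τ3 ⟨hF3, hH3, hτ3⟩
  refine ⟨hE2.frame hF3 rfl rfl, ?_, hH3,
    fun v => (hF3.arr 10 v rfl (by omega)).trans (hl2 v), ?_⟩
  · have : (fun M => σ3.mem (cell (n + n * n) 3 M) ≠ 0)
        = fun M => σ1.mem (cell (n + n * n) 3 M) ≠ 0 := by
      funext M
      rw [hF3.arr 3 M rfl (by omega), hF2.arr 3 M rfl (by omega)]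
    rw [this]
    exact hR1
  · have : L * L ≤ n * (L * L) := Nat.le_mul_of_pos_left _ (by omega)
    omega

theorem gain2_le (h : ∀ x y, G.Adj x y → f x = f y → g x = g y) : gain2 G f ≤ gain2 G g := by
  refine sum_le_sum fun x _ => sum_le_sum fun y _ => ?_
  by_cases hxy : G.Adj x y
  · have := h x y hxy
    split
    · rename_i h1
      rw [if_pos (this h1)]
    · exact Nat.zero_le _
  · rw [adj01_eq_zero.2 hxy]
    split <;> simp

/-- Every final labelling is dominated by a good entry of the last table. -/
theorem exists_goodEntry {vs ps : ℕ → Fin n} {TB : ℕ → ℕ → ℕ} {R : ℕ → ℕ} (hn : 2 ≤ n)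
    (hT : Tables G s ρ vs ps TB (n - 1))
    (hI : Inst s m ρ) (hG : G.IsAcyclic) (hρ : ∀ u, ρ u < s)
    (hR : GlueTable n s m fun M => R M ≠ 0) (hg : IsFinal ρ (s - 1) g) :
    ∃ x < 2 * n * s * n ^ (s - 1), GoodEntry n s (TB (cur ps (n - 1) (ps (n - 2)))) R x ∧
      gain2 G g ≤ x % (2 * n) := by
  obtain ⟨f, hf, hfg, hgain, hTB⟩ := hT.complete hI hG hρ hg le_rfl
  have hlast := blob_last hT.elim hn
  obtain ⟨h1, h2⟩ := blobCode_last hI hG hlast hf.lt rfl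
  refine ⟨_, blobCode_lt hI hG hf.lt (ps (n - 2)), ⟨hTB _ (hlast _), ?_⟩, ?_⟩
  · rw [entryM, h2]
    exact hR.of_isFinal hI hg hfg
  · rw [h1]
    exact gain2_le fun x y hxy h => hgain x y hxy (by rw [hlast, hlast]) h

/-- Optimality: any final labelling is dominated by a good entry, the chosen entry has the largest
gain among the good ones, the traced pieces have exactly this gain, and gluing them loses no inner
edge. -/
theorem wp_partProg {vs ps : ℕ → Fin n} (hS : Size n s N L W) (hE : Env n s N L m G ρ σ)
    (hG : G.IsAcyclic) (hI : Inst s m ρ) (hρ : ∀ u, ρ u < s)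
    (hR : GlueTable n s m fun M => σ.mem (cell (n + n * n) 3 M) ≠ 0)
    (hH : Elimination G s ρ L vs ps (n - 1) σ)
    (hl : ∀ v : Fin n, σ.mem (cell (n + n * n) 10 v) = v)
    (hex : ∃ f : Fin n → Fin n, IsFinal ρ (s - 1) f) :
    wp W partProg (fun σ' τ' => (∃ g : Fin n → Fin n, (∀ w : Fin n, σ'.mem w = g w) ∧
      IsFinal ρ (s - 1) g ∧ ∀ f : Fin n → Fin n, IsFinal ρ (s - 1) f → gain2 G f ≤ gain2 G g) ∧
      τ' ≤ τ + 1200 * (L * L)) σ τ := by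
  obtain ⟨f1, f2, f3, f4, f5, f6, f7, f8, f9, f10⟩ := hS.facts
  have hn := hS.two_le_n
  have hLe : L = 2 * n * s * n ^ (s - 1) := by rw [hS.L_eq, hS.N_eq]
  have hgood : ∀ g : Fin n → Fin n, IsFinal ρ (s - 1) g → ∃ x < L,
      GoodEntry n s (tab (n + n * n) L σ (cur ps (n - 1) (ps (n - 2))))
        (fun M => σ.mem (cell (n + n * n) 3 M)) x ∧ gain2 G g ≤ x % (2 * n) := by
    intro g hg
    have := exists_goodEntry hn hH.tables hI hG hρ hR hg
    rwa [← hLe] at this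
  obtain ⟨f₀, hf₀⟩ := hex
  obtain ⟨x₀, hx₀, hx₀', -⟩ := hgood f₀ hf₀
  refine wp_seq (wp_mono (wp_bestProg hS hE hH ⟨x₀, hx₀, hx₀'⟩) ?_)
  rintro σ1 τ1 ⟨hF1, ⟨hX, ⟨hX1, hX2⟩, hmax⟩, hτ1⟩
  have hE1 := hE.frame hF1 rfl rfl
  have ht1 : tab (n + n * n) L σ1 = tab (n + n * n) L σ := by
    funext y x
    exact hF1.arr 4 _ rfl (by omega)
  refine wp_seq (wp_mono (wp_traceProg hS hE1 hI hG hρ (hH.frame hF1 rfl) rfl hX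
    (by rw [ht1]; exact hX1) (fun w => (hF1.arr 10 w rfl (by omega)).trans (hl w))) ?_)
  rintro σ2 τ2 ⟨hF2, ⟨lab, hl2, hconf, hcode⟩, hτ2⟩
  have hlast := blob_last hH.tables.elim hn
  obtain ⟨h1, h2⟩ := blobCode_last hI hG hlast hconf.lt hcode
  have hR2 : ∀ M, σ2.mem (cell (n + n * n) 3 M) = σ.mem (cell (n + n * n) 3 M) := fun M => by
    rw [hF2.arr 3 M rfl (by omega), hF1.arr 3 M rfl (by omega)]
  have hE2 := hE1.frame hF2 rfl rfl
  refine wp_seq (wp_mono (wp_pairProg hS hE2 hI (by simpa only [hR2] using hR)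
    (hF2.reg 13 rfl) hX h2 hl2 hconf.lt ?_) ?_)
  · rw [hR2, ← h2]
    exact hX2
  rintro σ3 τ3 ⟨hF3, ⟨g, hg, hfin, hgf⟩, hτ3⟩
  have hE3 := hE2.frame hF3 rfl rfl
  refine wp_mono (wp_outProg hS hE3.r0 hE3.r2 hg) ?_
  rintro σ4 τ4 ⟨h4, hτ4⟩
  refine ⟨⟨g, h4, hgf, fun f hf => ?_⟩, by omega⟩
  obtain ⟨x, hx, hx', hx''⟩ := hgood f hf
  calc gain2 G f ≤ x % (2 * n) := hx''
    _ ≤ σ1.reg 13 % (2 * n) := hmax x hx hx'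
    _ = gain2 G lab := h1
    _ ≤ gain2 G g := gain2_le fun x y _ h => hfin x y h

end solve

/-! ### Correctness and running time -/

theorem SolvesWithin.mono {n k : ℕ} {p : Prog} {G : SimpleGraph (Fin n)} {col : Fin n → Fin k}
    {T W T' W' : ℕ} (h : SolvesWithin p G col T W) (hT : T ≤ T') (hW : W ≤ W') :
    SolvesWithin p G col T' W' := by
  obtain ⟨t, s, h1, h2, h3⟩ := h
  exact ⟨t, s, h1.trans hT, h2.mono hW, h3⟩

theorem exists_part_eq_iff {n : ℕ} (g : Fin n → Fin n) :
    ∃ P : Finpartition (univ : Finset (Fin n)), ∀ u v, P.part u = P.part v ↔ g u = g v := by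
  classical
  refine ⟨Finpartition.ofSetoid (Setoid.ker g), fun u v => ?_⟩
  rw [← Finpartition.mem_part_iff_part_eq_part _ (mem_univ _) (mem_univ _),
    Finpartition.mem_part_ofSetoid_iff_rel]
  exact ⟨fun h => h.symm, fun h => h.symm⟩

section Instance

variable {n k m : ℕ} {c : Fin k → ℕ} {col : Fin n → Fin k}

theorem eq_mul_setmax (hcol : ∀ i, #(colorClass col i) = m * c i) : n = m * setmax c := by
  have h := card_eq_sum_card_fiberwise (f := col) (s := univ) (t := univ) (fun _ _ => mem_univ _)
  rw [card_univ, Fintype.card_fin] at h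
  rw [setmax, mul_sum, h]
  exact sum_congr rfl fun i _ => hcol i

theorem le_setmax (hc : ∀ i, 0 < c i) : k ≤ setmax c := by
  have h : ∑ _i : Fin k, 1 ≤ ∑ i, c i := sum_le_sum fun i _ => hc i
  simpa [setmax] using h

theorem rho_lt (hc : ∀ i, 0 < c i) (u : Fin n) : rho c col u < setvars c := by
  have h1 : c (col u) * rad (ext0 c) (col u) ≤ ∑ i, c i * rad (ext0 c) i :=
    single_le_sum (f := fun i => c i * rad (ext0 c) i) (fun _ _ => Nat.zero_le _) (mem_univ _)
  have h2 : rho c col u ≤ c (col u) * rad (ext0 c) (col u) := Nat.le_mul_of_pos_left _ (hc _)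
  have h3 := sum_c_mul_rad c
  omega

/-- Colors 0 and 1 both occur and have the different weights 1 and `c 0 + 1`; this is where two
colors are needed. Moreover `n = m * setmax c` with `setmax c ≥ 2` gives `m < n`. -/
theorem inst_rho (hk : 2 ≤ k) (hc : ∀ i, 0 < c i) (hm : 0 < m)
    (hcol : ∀ i, #(colorClass col i) = m * c i) : Inst (setvars c) m (rho c col) := by
  have hex : ∀ i, ∃ u, col u = i := by
    intro i
    have h : 0 < #(colorClass col i) := by
      rw [hcol]
      exact Nat.mul_pos hm (hc i)
    obtain ⟨u, hu⟩ := card_pos.1 h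
    exact ⟨u, by simpa [colorClass] using hu⟩
  obtain ⟨u, hu⟩ := hex ⟨0, by omega⟩
  obtain ⟨v, hv⟩ := hex ⟨1, by omega⟩
  have hu' : rho c col u = 1 := by simp [rho, hu, rad]
  have hv' : rho c col v = c ⟨0, by omega⟩ + 1 := by
    simp [rho, hv, rad, ext0, show 0 < k by omega]
  have hc0 := hc ⟨0, by omega⟩
  have hlt := rho_lt (col := col) hc u
  refine ⟨fun u => rad_pos _ _, ⟨u, v, by omega⟩, ?_, ?_, by omega⟩
  · rw [sum_rho]
    have h : setvars c - 1 = ∑ i, c i * rad (ext0 c) i := by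
      have := sum_c_mul_rad c
      omega
    rw [h, mul_sum]
    refine sum_congr rfl fun i _ => ?_
    rw [← mul_assoc, ← hcol i, colorClass]
  · have h1 := eq_mul_setmax hcol
    have h2 := le_setmax hc
    have h3 : m * 2 ≤ m * setmax c := Nat.mul_le_mul_left _ (by omega)
    omega

/-- The program solves the problem within time and word length of the order of `n * L ^ 2`,
where `L` is the length of a table. -/
theorem solveProg_solvesWithin {F : SimpleGraph (Fin n)} (hn : 0 < n) (hk : 2 ≤ k)
    (hc : ∀ i, 0 < c i) (hg : univ.gcd c = 1) (hF : F.IsAcyclic) (hr : HasColorRatio col c)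
    {L : ℕ} (hL : L = 2 * n * setvars c * n ^ (setvars c - 1)) :
    SolvesWithin solveProg F col (3300 * (n * (L * L))) (1000 * (L * L)) := by
  obtain ⟨m, hm, hcol⟩ := exists_card_colorClass (by simpa using hn) (by omega) hc hg hr
  have hI := inst_rho hk hc hm hcol
  have hS : Size n (setvars c) (n ^ (setvars c - 1)) L (1000 * (L * L)) :=
    ⟨hI.two_le_n, hI.two_le, rfl, hL, le_rfl⟩
  obtain ⟨f1, f2, f3, f4, f5, f6, f7, f8, f9, f10⟩ := hS.facts
  have hkn : k ≤ n := by
    have h1 := eq_mul_setmax hcol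
    have h2 := le_setmax hc
    have h3 : setmax c ≤ m * setmax c := Nat.le_mul_of_pos_left _ hm
    omega
  have hρ := rho_lt (col := col) hc
  have h : wp (1000 * (L * L)) solveProg (fun σ' τ' => (∃ g : Fin n → Fin n,
      (∀ w : Fin n, σ'.mem w = g w) ∧ IsFinal (rho c col) (setvars c - 1) g ∧
      ∀ f : Fin n → Fin n, IsFinal (rho c col) (setvars c - 1) f → gain2 F f ≤ gain2 F g) ∧
      τ' ≤ 3300 * (n * (L * L))) (inputState F col) 0 := by
    refine wp_seq (wp_mono (wp_preProg hS hkn rfl hm hI.m_lt hg hcol) ?_)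
    rintro σ1 τ1 ⟨hE1, h3, h4, h6, hτ1⟩
    refine wp_seq (wp_mono (wp_tableProg hS hE1 hF hI hρ h3 h4 h6) ?_)
    rintro σ2 τ2 ⟨hE2, hR2, ⟨vs, ps, hH2⟩, hl2, hτ2⟩
    refine wp_mono (wp_partProg hS hE2 hF hI hρ hR2 hH2 hl2
      (exists_isFinal hF hk hc hg hcol)) ?_
    rintro σ3 τ3 ⟨h7, hτ3⟩
    refine ⟨h7, ?_⟩
    have : L * L ≤ n * (L * L) := Nat.le_mul_of_pos_left _ hn
    omega
  obtain ⟨σ, t, hrun, ⟨g, hg1, hg2, hg3⟩, ht⟩ :=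
    h (inputState_bounded (by omega) (by omega) (by omega))
  obtain ⟨P, hP⟩ := exists_part_eq_iff g
  refine ⟨t, σ, by omega, hrun, P, isMinCostFair_of_isFinal hF hk hc hg hm hcol hg2 hg3 P hP,
    fun u v => ?_⟩
  rw [hP, hg1, hg1, Fin.ext_iff]

/-- The left side is `4 * n ^ (2 * s + 1) * s ^ 2` for `s = setvars c`, and `setmax c ≥ k ≥ 2`
leaves room in both exponents. -/
theorem le_timeBound (hn : 0 < n) (hk : 2 ≤ k) (hc : ∀ i, 0 < c i) {L : ℕ}
    (hL : L = 2 * n * setvars c * n ^ (setvars c - 1)) :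
    n * (L * L) ≤ 4 * timeBound n c := by
  have hd := (le_setmax hc).trans' hk
  have hs : 0 < setvars c := prod_pos fun i _ => Nat.succ_pos _
  obtain ⟨t, ht⟩ : ∃ t, setvars c = t + 1 := ⟨setvars c - 1, by omega⟩
  have e : n * (L * L) = 4 * (n ^ (2 * setvars c + 1) * setvars c ^ 2) := by
    rw [hL, ht, Nat.add_sub_cancel]
    ring
  rw [e, timeBound]
  refine Nat.mul_le_mul_left _ (Nat.mul_le_mul (Nat.pow_le_pow_right hn ?_)
    (Nat.pow_le_pow_right hs hd))
  omega

theorem setvars_le_two_pow (c : Fin k → ℕ) : setvars c ≤ 2 ^ setmax c := by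
  rw [setmax, ← prod_pow_eq_pow_sum]
  exact prod_le_prod' fun i _ => Nat.lt_two_pow_self

/-- As `setvars c ≤ 2 ^ setmax c`, the exponent and the factor can be made to depend on `setmax c`
only, so that one polynomial serves all ratios with the same sum. -/
theorem timeBound_le (hn : 0 < n) (c : Fin k → ℕ) : timeBound n c ≤
    n ^ (2 * 2 ^ setmax c + setmax c + 2) * (2 ^ setmax c) ^ setmax c := by
  have h := setvars_le_two_pow c
  refine Nat.mul_le_mul (Nat.pow_le_pow_right hn ?_) (Nat.pow_le_pow_left h _)
  omega

end Instance

end FairCC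

theorem mainTheorem5 :
    ∃ (p : FairCC.Prog) (C : ℕ) (q : ℕ → Polynomial ℕ),
      ∀ (n k : ℕ) (c : Fin k → ℕ) (F : SimpleGraph (Fin n)) (col : Fin n → Fin k),
        0 < n → 2 ≤ k → (∀ i, 0 < c i) → Finset.univ.gcd c = 1 →
        F.IsAcyclic → FairCC.HasColorRatio col c →
          FairCC.SolvesWithin p F col (C * FairCC.timeBound n c) (C * FairCC.timeBound n c) ∧
          FairCC.SolvesWithin p F col ((q (FairCC.setmax c)).eval n)
            ((q (FairCC.setmax c)).eval n) := by
  -- `13200 = 3300 * 4`, from the running time `3300 * (n * (L * L))` and `n * (L * L) ≤ 4 *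
  -- timeBound n c`. The word bound `1000 * (L * L)` is smaller.
  refine ⟨FairCC.solveProg, 13200, fun d => Polynomial.C (13200 * (2 ^ d) ^ d) *
    Polynomial.X ^ (2 * 2 ^ d + d + 2), ?_⟩
  intro n k c F col hn hk hc hg hF hr
  have h := FairCC.solveProg_solvesWithin hn hk hc hg hF hr rfl
  have h1 := FairCC.le_timeBound hn hk hc rfl
  have h2 := FairCC.timeBound_le hn c
  have h3 : FairCC.SolvesWithin FairCC.solveProg F col (13200 * FairCC.timeBound n c)
      (13200 * FairCC.timeBound n c) := by
    refine h.mono (by omega) ?_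
    have := Nat.le_mul_of_pos_left (2 * n * FairCC.setvars c * n ^ (FairCC.setvars c - 1) *
      (2 * n * FairCC.setvars c * n ^ (FairCC.setvars c - 1))) hn
    omega
  refine ⟨h3, h3.mono ?_ ?_⟩ <;>
  · simp only [Polynomial.eval_mul, Polynomial.eval_C, Polynomial.eval_pow, Polynomial.eval_X]
    calc _ ≤ _ := Nat.mul_le_mul_left 13200 h2
      _ = _ := by ring
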